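/- **Setting.** Let $N\ge 1$, let $\mathfrak g$ be $\mathfrak{gl}_N(\mathbb C)$ or $\mathfrak{sl}_N(\mathbb C)$, and $G=GL_N$ or $SL_N$ accordingly. For $a\in\mathbb C$ put $\lambda_a=\lambda-a$, and $\lambda_\infty=\lambda^{-1}$; $\iota_{\lambda_a}$ denotes Laurent expansion at $a\in\mathbb CP^1$. Let $P_{12}$ be the tensor Casimir of $\mathfrak g$ for the trace form, $P_{12}=P^+_{12}+P^0_{12}+P^-_{12}$ with $P^\pm_{12}\in\mathfrak n_\pm\otimes\mathfrak n_\mp$ ($\mathfrak n_+$, $\mathfrak n_-$ strictly upper, lower triangular) and $P^0_{12}$ in the square of the diagonal subalgebra, and let $P^\pm,P^0$ be the corresponding projectors on $\mathfrak g$. Let $r_{12}$ be one of the two skew-symmetric $r$-matrices $$r_{12}(\lambda,\mu)=\frac{P_{12}}{\mu-\lambda}\ \ (\text{rational},\ k=0),\qquad r_{12}(\lambda,\mu)=\frac{\mu P_{12}}{\mu-\lambda}-P^-_{12}-\tfrac12P^0_{12}\ \ (\text{trigonometric},\ k=-1).$$ The *principal part* $X(\lambda_a)_-$ of $X=\sum_n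 X_n\lambda_a^n\in\mathfrak g\otimes\mathbb C((\lambda_a))$ is, in the rational case, $\sum_{n<0}X_n\lambda_a^n$ if $a\in\mathbb C$ and $\sum_{n\le0}X_n\lambda_\infty^n$ if $a=\infty$; in the trigonometric case it is $\sum_{n<0}X_n\lambda_a^n$ plus the constant $(P^-+\frac12P^0)X_0$ if $a=0$, $(P^++\frac12P^0)X_0$ if $a=\infty$, and $-(P^-+\frac12P^0)\sum_{n<0}X_n(-a)^n$ otherwise. Fix a $\mathfrak g$-valued rational function $F(\lambda)=\sum_{a\in S}F^a(\lambda_a)_-$, with $S\subset\mathbb CP^1$ finite and $F^a(\lambda_a)_-$ principal parts at $a$; put $F^a(\lambda_a)_-=0$ for $a\notin S$. To each $a\in\mathbb CP^1$ and $n\in\mathbb Z$ attach a real time $t^a_n$, and put $\mathcal D_{\lambda_a}=\sum_{n\in\mathbb Z}\lambda_a^n\partial_{t^a_n}$ for $a\in\mathbb C$ and $\mathcal D_{\lambda_\infty}=\sum_{n\in\mathbb Z}\lambda_\infty^{n+k+1}\partial_{t^\infty_n}$. A *field* is a family $\phi=(\phi^a(\lambda_a))_{a\in\mathbb CP^1}$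 of $G$-valued Taylor series whose coefficients are smooth functions of the times on a domain (a set of times whose finite-dimensional coordinate slices are open; smooth means smooth in any finitely many times), normalised as follows: in the rational case $\phi^\infty$ has constant term $1$; in the trigonometric case $\phi^0$ and $\phi^\infty$ have upper, respectively lower, triangular constant terms whose diagonal parts are inverse to each other. Put $Q^a(\lambda_a)=\phi^a(\lambda_a)F^a(\lambda_a)_-\phi^a(\lambda_a)^{-1}$ and $\mathscr L^{a,b}(\lambda_a,\mu_b)=K^{a,b}(\lambda_a,\mu_b)-U^{a,b}(\lambda_a,\mu_b)$, where $$K^{a,b}(\lambda_a,\mu_b)=\mathrm{Tr}\big(\phi^a(\lambda_a)^{-1}\mathcal D_{\mu_b}\phi^a(\lambda_a)F^a(\lambda_a)_-\big)-\mathrm{Tr}\big(\phi^b(\mu_b)^{-1}\mathcal D_{\lambda_a}\phi^b(\mu_b)F^b(\mu_b)_-\big),$$ $$U^{a,b}(\lambda_a,\mu_b)=\tfrac12\mathrm{Tr}_{12}\big((\iota_{\lambda_a}\iota_{\mu_b}+\iota_{\mu_b}\iota_{\lambda_a})r_{12}(\lambda,\mu)\,Q^a_1(\lambda_a)Q^b_2(\mu_b)\big).$$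 In $\iota_{\lambda_a}\iota_{\mu_b}$ the expansion in $\mu_b$ is performed first. The *multiform Euler–Lagrange equations* in generating form say that for all $a,b,c\in\mathbb CP^1$ $$\delta\Big(\mathcal D_{\nu_c}\mathscr L^{a,b}(\lambda_a,\mu_b)+\mathcal D_{\mu_b}\mathscr L^{c,a}(\nu_c,\lambda_a)+\mathcal D_{\lambda_a}\mathscr L^{b,c}(\mu_b,\nu_c)\Big)=0,$$ i.e. at every point of the domain, and for every smooth one-parameter variation of $\phi$ through fields, the first variation of every coefficient of this generating series vanishes. **Theorem.** A field $\phi$ satisfies the multiform Euler–Lagrange equations of $\mathscr L$ if and only if it satisfies the generating Lax equation $$\mathcal D_{\mu_b}Q^a_1(\lambda_a)=\big[\mathrm{Tr}_2\big(\iota_{\lambda_a}\iota_{\mu_b}r_{12}(\lambda,\mu)\,Q^b_2(\mu_b)\big),\,Q^a_1(\lambda_a)\big]\qquad\text{for all }a,b\in\mathbb CP^1$$ on the whole domain, as an equality of all coefficients of $\lambda_a^p\mu_b^q$, $p,q\in\mathbb Z$. -/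

import Mathlib

open scoped Kronecker PowerSeries

namespace AdelicMultiform

noncomputable section

/-! ### Setting -/

/-- The matrix Lie algebra: all `N × N` matrices, or the traceless ones. -/
inductive LieKind
  | gl
  | sl

/-- The type of the `r`-matrix. -/
inductive RKind
  | rational
  | trigonometric

/-- The integer `k`: `0` in the rational case and `-1` in the trigonometric case. -/
def RKind.k : RKind → ℤ
  | .rational => 0
  | .trigonometric => -1

/-- The Riemann sphere, as a set of points. -/
abbrev CP1 := OnePoint ℂ

/-- The times `t^a_n`, with `a` a point of the sphere and `n` an integer. -/
abbrev TimeIdx := CP1 × ℤ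

/-- Membership in `𝔤 ⊗ R`, for a commutative ring `R` of coefficients. -/
def InLie {R : Type*} [CommRing R] {N : ℕ} (g : LieKind) (X : Matrix (Fin N) (Fin N) R) : Prop :=
  match g with
  | .gl => True
  | .sl => X.trace = 0

/-- Membership in the group `G(R)`, that is `GL_N(R)` or `SL_N(R)`. -/
def InGroup {R : Type*} [CommRing R] {N : ℕ} (g : LieKind) (X : Matrix (Fin N) (Fin N) R) : Prop :=
  match g with
  | .gl => IsUnit X.det
  | .sl => X.det = 1

/-! ### Laurent expansions of rational functions -/

/-- The Laurent series, in the local coordinate at `a`, of the variable `λ` itself: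
`λ = a + λ_a` at a finite point `a`, and `λ = λ_∞⁻¹` at infinity. -/
def globalCoord {K : Type*} [Field K] [Algebra ℂ K] : CP1 → LaurentSeries K
  | OnePoint.infty => HahnSeries.single (-1) 1
  | OnePoint.some a => HahnSeries.C (algebraMap ℂ K a) + HahnSeries.single 1 1

/-- The Laurent expansion `ι_{λ_a} f` at `a` of a rational function `f` of `λ`
with coefficients in the field `K`. -/
def expand {K : Type*} [Field K] [Algebra ℂ K] (a : CP1) (f : RatFunc K) : LaurentSeries K :=
  RatFunc.eval HahnSeries.C (globalCoord a) f

/-! ### The `r`-matrices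

An element of `𝔤𝔩_N ⊗ 𝔤𝔩_N` is a matrix indexed by pairs, by means of the Kronecker product. -/

/-- The tensor Casimir `P₁₂` of `𝔤` for the trace form: `∑ E_ij ⊗ E_ji` for `𝔤𝔩_N`, and its
traceless part `∑ E_ij ⊗ E_ji - N⁻¹ (1 ⊗ 1)` for `𝔰𝔩_N`. -/
def casimir (K : Type*) [Field K] (N : ℕ) (g : LieKind) :
    Matrix (Fin N × Fin N) (Fin N × Fin N) K :=
  let P := ∑ i : Fin N, ∑ j : Fin N, Matrix.single i j (1 : K) ⊗ₖ Matrix.single j i (1 : K)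
  match g with
  | .gl => P
  | .sl => P - (N : K)⁻¹ • 1

/-- The part `P⁰₁₂ ∈ 𝔥 ⊗ 𝔥` of the tensor Casimir. -/
def casimirZero (K : Type*) [Field K] (N : ℕ) (g : LieKind) :
    Matrix (Fin N × Fin N) (Fin N × Fin N) K :=
  let P := ∑ i : Fin N, Matrix.single i i (1 : K) ⊗ₖ Matrix.single i i (1 : K)
  match g with
  | .gl => P
  | .sl => P - (N : K)⁻¹ • 1

/-- The part `P⁻₁₂ = ∑_{i<j} E_ji ⊗ E_ij ∈ 𝔫₋ ⊗ 𝔫₊` of the tensor Casimir. -/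
def casimirMinus (K : Type*) [Field K] (N : ℕ) : Matrix (Fin N × Fin N) (Fin N × Fin N) K :=
  ∑ i : Fin N, ∑ j : Fin N,
    if i < j then Matrix.single j i (1 : K) ⊗ₖ Matrix.single i j (1 : K) else 0

/-- The `r`-matrix `r₁₂(l, m)` with spectral parameters `l` and `m` in a field `K`:
`P₁₂ / (m - l)` in the rational case, `m P₁₂ / (m - l) - P⁻₁₂ - P⁰₁₂ / 2` in the trigonometric
case. -/
def rMatrix (K : Type*) [Field K] (N : ℕ) (g : LieKind) (ρ : RKind) (l m : K) :
    Matrix (Fin N × Fin N) (Fin N × Fin N) K :=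
  match ρ with
  | .rational => (1 / (m - l)) • casimir K N g
  | .trigonometric =>
      (m / (m - l)) • casimir K N g - casimirMinus K N - (1 / 2 : K) • casimirZero K N g

/-- The coefficient of `λ_a^i μ_b^j` in `ι_{λ_a} ι_{μ_b} r₁₂(λ, μ)`. The `r`-matrix is regarded as
a rational function of `μ` over `ℂ(λ)`; it is expanded in `μ_b` first, then the coefficients, which
are rational functions of `λ`, are expanded in `λ_a`. -/
def rLamMu (N : ℕ) (g : LieKind) (ρ : RKind) (a b : CP1) (i j : ℤ) :
    Matrix (Fin N × Fin N) (Fin N × Fin N) ℂ :=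
  (rMatrix (RatFunc (RatFunc ℂ)) N g ρ (RatFunc.C RatFunc.X) RatFunc.X).map
    fun f => (expand a ((expand b f).coeff j)).coeff i

/-- The coefficient of `λ_a^i μ_b^j` in `ι_{μ_b} ι_{λ_a} r₁₂(λ, μ)`. Here the `r`-matrix is a
rational function of `λ` over `ℂ(μ)`, expanded in `λ_a` first and then in `μ_b`. -/
def rMuLam (N : ℕ) (g : LieKind) (ρ : RKind) (a b : CP1) (i j : ℤ) :
    Matrix (Fin N × Fin N) (Fin N × Fin N) ℂ :=
  (rMatrix (RatFunc (RatFunc ℂ)) N g ρ RatFunc.X (RatFunc.C RatFunc.X)).map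
    fun f => (expand b ((expand a f).coeff i)).coeff j

/-- The partial trace `Tr₂` over the second tensor factor. -/
def trTwo {N : ℕ} (M : Matrix (Fin N × Fin N) (Fin N × Fin N) ℂ) : Matrix (Fin N) (Fin N) ℂ :=
  Matrix.of fun i j => ∑ k : Fin N, M (i, k) (j, k)

/-! ### Principal parts -/

/-- The `n`-th coefficient of a matrix of Laurent series. -/
def lcoeff {N : ℕ} (Y : Matrix (Fin N) (Fin N) (LaurentSeries ℂ)) (n : ℤ) :
    Matrix (Fin N) (Fin N) ℂ :=
  Y.map fun y => y.coeff n

/-- A constant matrix as a matrix of Laurent series. -/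
def constL {N : ℕ} (M : Matrix (Fin N) (Fin N) ℂ) : Matrix (Fin N) (Fin N) (LaurentSeries ℂ) :=
  M.map fun z => HahnSeries.C z

/-- `P⁻ + P⁰ / 2`: the strictly lower triangular part plus half of the diagonal part. -/
def lowerHalf {N : ℕ} (M : Matrix (Fin N) (Fin N) ℂ) : Matrix (Fin N) (Fin N) ℂ :=
  Matrix.of fun i j => if j < i then M i j else if i = j then M i j / 2 else 0

/-- `P⁺ + P⁰ / 2`: the strictly upper triangular part plus half of the diagonal part. -/
def upperHalf {N : ℕ} (M : Matrix (Fin N) (Fin N) ℂ) : Matrix (Fin N) (Fin N) ℂ :=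
  Matrix.of fun i j => if i < j then M i j else if i = j then M i j / 2 else 0

/-- The principal part `Y(λ_a)_-` of a Laurent series in the local coordinate at `a`.

In the rational case it consists of the terms of negative degree, together with the constant term
if `a = ∞`. In the trigonometric case it consists of the terms of negative degree plus the constant
`(P⁻ + P⁰/2) Y_0` at `0`, the constant `(P⁺ + P⁰/2) Y_0` at `∞`, and the constant
`-(P⁻ + P⁰/2) ∑_{n < 0} Y_n (-b)^n` at any other point `b`. -/
def principalPart {N : ℕ} (ρ : RKind) (a : CP1) (Y : Matrix (Fin N) (Fin N) (LaurentSeries ℂ)) :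
    Matrix (Fin N) (Fin N) (LaurentSeries ℂ) :=
  open scoped Classical in
  match ρ, a with
  | .rational, OnePoint.infty => Y.map (HahnSeries.truncLT 1)
  | .rational, OnePoint.some _ => Y.map (HahnSeries.truncLT 0)
  | .trigonometric, OnePoint.infty =>
      constL (upperHalf (lcoeff Y 0)) + Y.map (HahnSeries.truncLT 0)
  | .trigonometric, OnePoint.some b =>
      if b = 0 then constL (lowerHalf (lcoeff Y 0)) + Y.map (HahnSeries.truncLT 0)
      else
        -constL (lowerHalf (∑ᶠ n : ℕ, ((-b) ^ (n + 1))⁻¹ • lcoeff Y (-(n + 1 : ℤ)))) +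
          Y.map (HahnSeries.truncLT 0)

/-- The rational function `∑_{n ≥ 0} Y_{-n} λ_a^{-n}` defined by a polynomial
`Y ∈ 𝔤 ⊗ ℂ[λ_a⁻¹]`. -/
def toRational {N : ℕ} (a : CP1) (Y : Matrix (Fin N) (Fin N) (LaurentSeries ℂ)) :
    Matrix (Fin N) (Fin N) (RatFunc ℂ) :=
  let invCoord : RatFunc ℂ :=
    match a with
    | OnePoint.infty => RatFunc.X
    | OnePoint.some z => (RatFunc.X - RatFunc.C z)⁻¹
  Y.map fun y => ∑ᶠ n : ℕ, RatFunc.C (y.coeff (-(n : ℤ))) * invCoord ^ n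

/-- `F(λ) = ∑_{a ∈ S} F^a(λ_a)_-` is a partial fraction decomposition of the `𝔤`-valued rational
function `F`, where `F^a(λ_a)_-` (here `Fm a`) is a `𝔤`-valued principal part at `a`, equal to
zero for `a ∉ S`. -/
def IsPartialFraction {N : ℕ} (g : LieKind) (ρ : RKind) (F : Matrix (Fin N) (Fin N) (RatFunc ℂ))
    (S : Finset CP1) (Fm : CP1 → Matrix (Fin N) (Fin N) (LaurentSeries ℂ)) : Prop :=
  (∀ a ∈ S, ∃ Y : Matrix (Fin N) (Fin N) (LaurentSeries ℂ),
    InLie g Y ∧ Fm a = principalPart ρ a Y) ∧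
  (∀ a ∉ S, Fm a = 0) ∧
  F = ∑ a ∈ S, toRational a (Fm a)

/-! ### The group of integral adèles -/

/-- The group `𝓐⁺(G)` of families `φ = (φ^a(λ_a))_a` of `G`-valued Taylor series: normalised by
`φ^∞_0 = 1` in the rational case; with `φ^0_0` upper triangular, `φ^∞_0` lower triangular and
inverse diagonal parts in the trigonometric case. -/
def InAdelicGroup {N : ℕ} (g : LieKind) (ρ : RKind)
    (φ : CP1 → Matrix (Fin N) (Fin N) ℂ⟦X⟧) : Prop :=
  (∀ a, InGroup g (φ a)) ∧
  match ρ with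
  | .rational => (φ OnePoint.infty).map PowerSeries.constantCoeff = 1
  | .trigonometric =>
      (∀ i j, j < i → PowerSeries.constantCoeff (φ (OnePoint.some 0) i j) = 0) ∧
      (∀ i j, i < j → PowerSeries.constantCoeff (φ OnePoint.infty i j) = 0) ∧
      (∀ i, PowerSeries.constantCoeff (φ (OnePoint.some 0) i i) *
        PowerSeries.constantCoeff (φ OnePoint.infty i i) = 1)

/-! ### Functions of infinitely many times -/

/-- The point of the space of times with coordinates `x` in the finitely many directions of `s`,
and those of `t` in all other directions. -/
def slice (t : TimeIdx → ℝ) (s : Finset TimeIdx) (x : s → ℝ) : TimeIdx → ℝ :=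
  open scoped Classical in fun i => if h : i ∈ s then x ⟨i, h⟩ else t i

/-- A domain in the space of times: its intersection with every finite-dimensional coordinate
slice is open. -/
def IsTimeDomain (Ω : Set (TimeIdx → ℝ)) : Prop :=
  ∀ (t : TimeIdx → ℝ) (s : Finset TimeIdx), IsOpen {x : s → ℝ | slice t s x ∈ Ω}

/-- A function on `Ω` is smooth if it is smooth in any finitely many of the times. -/
def SmoothOn (Ω : Set (TimeIdx → ℝ)) (f : (TimeIdx → ℝ) → ℂ) : Prop :=
  ∀ (t : TimeIdx → ℝ) (s : Finset TimeIdx),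
    ContDiffOn ℝ ((⊤ : ℕ∞) : WithTop ℕ∞) (fun x : s → ℝ => f (slice t s x))
      {x | slice t s x ∈ Ω}

/-- Joint smoothness in a real parameter `ε` and in any finitely many of the times. -/
def SmoothFamilyOn (Ω : Set (TimeIdx → ℝ)) (f : ℝ → (TimeIdx → ℝ) → ℂ) : Prop :=
  ∀ (t : TimeIdx → ℝ) (s : Finset TimeIdx),
    ContDiffOn ℝ ((⊤ : ℕ∞) : WithTop ℕ∞) (fun y : ℝ × (s → ℝ) => f y.1 (slice t s y.2))
      {y | slice t s y.2 ∈ Ω}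

/-- The partial derivative `∂f/∂t_i` at `t`. -/
def pd (i : TimeIdx) (f : (TimeIdx → ℝ) → ℂ) (t : TimeIdx → ℝ) : ℂ :=
  open scoped Classical in deriv (fun u : ℝ => f (Function.update t i u)) (t i)

/-- The time whose derivative is the coefficient of `λ_a^p` in the operator `𝓓_{λ_a}`, where
`𝓓_{λ_a} = ∑_n λ_a^n ∂_{t^a_n}` for finite `a` and `𝓓_{λ_∞} = ∑_n λ_∞^{n+k+1} ∂_{t^∞_n}`. -/
def timeOf (ρ : RKind) (a : CP1) (p : ℤ) : TimeIdx :=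
  match a with
  | OnePoint.infty => (OnePoint.infty, p - ρ.k - 1)
  | OnePoint.some z => (OnePoint.some z, p)

/-! ### Fields, the Lagrangian multiform and its Euler-Lagrange equations -/

/-- Families of matrices of Taylor series depending on the times. -/
abbrev Config (N : ℕ) := (TimeIdx → ℝ) → CP1 → Matrix (Fin N) (Fin N) ℂ⟦X⟧

/-- A field configuration on `Ω`: a smooth function of the times with values in `𝓐⁺(G)`. -/
def IsField {N : ℕ} (g : LieKind) (ρ : RKind) (Ω : Set (TimeIdx → ℝ)) (φ : Config N) : Prop :=
  (∀ t ∈ Ω, InAdelicGroup g ρ (φ t)) ∧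
  ∀ a i j m, SmoothOn Ω fun t => PowerSeries.coeff m (φ t a i j)

/-- The coefficientwise derivative `∂_τ φ^a` with respect to the time `τ`. -/
def dField {N : ℕ} (φ : Config N) (τ : TimeIdx) (t : TimeIdx → ℝ) (a : CP1) :
    Matrix (Fin N) (Fin N) ℂ⟦X⟧ :=
  Matrix.of fun i j => PowerSeries.mk fun m => pd τ (fun u => PowerSeries.coeff m (φ u a i j)) t

/-- Taylor series as Laurent series. -/
def toL {N : ℕ} (M : Matrix (Fin N) (Fin N) ℂ⟦X⟧) : Matrix (Fin N) (Fin N) (LaurentSeries ℂ) :=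
  M.map (HahnSeries.ofPowerSeries ℤ ℂ)

/-- `Q^a(λ_a) = φ^a(λ_a) F^a(λ_a)_- φ^a(λ_a)⁻¹`. -/
def orbitQ {N : ℕ} (Fm : CP1 → Matrix (Fin N) (Fin N) (LaurentSeries ℂ)) (φ : Config N)
    (t : TimeIdx → ℝ) (a : CP1) : Matrix (Fin N) (Fin N) (LaurentSeries ℂ) :=
  toL (φ t a) * Fm a * toL (φ t a)⁻¹

/-- The coefficient of `λ_a^p μ_b^q` in `Tr (φ^a(λ_a)⁻¹ 𝓓_{μ_b} φ^a(λ_a) F^a(λ_a)_-)`. -/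
def kinHalf {N : ℕ} (ρ : RKind) (Fm : CP1 → Matrix (Fin N) (Fin N) (LaurentSeries ℂ))
    (φ : Config N) (t : TimeIdx → ℝ) (a b : CP1) (p q : ℤ) : ℂ :=
  (toL (φ t a)⁻¹ * toL (dField φ (timeOf ρ b q) t a) * Fm a).trace.coeff p

/-- The coefficient of `λ_a^p μ_b^q` in the kinetic term `K^{a,b}(λ_a, μ_b)`. -/
def kinetic {N : ℕ} (ρ : RKind) (Fm : CP1 → Matrix (Fin N) (Fin N) (LaurentSeries ℂ))
    (φ : Config N) (t : TimeIdx → ℝ) (a b : CP1) (p q : ℤ) : ℂ :=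
  kinHalf ρ Fm φ t a b p q - kinHalf ρ Fm φ t b a q p

/-- The coefficient of `λ_a^p μ_b^q` in the potential term `U^{a,b}(λ_a, μ_b)`, which is
`½ Tr₁₂ ((ι_{λ_a} ι_{μ_b} + ι_{μ_b} ι_{λ_a}) r₁₂(λ, μ) Q^a₁(λ_a) Q^b₂(μ_b))`.
Only finitely many terms of the sum are non-zero. -/
def potential {N : ℕ} (g : LieKind) (ρ : RKind)
    (Fm : CP1 → Matrix (Fin N) (Fin N) (LaurentSeries ℂ))
    (φ : Config N) (t : TimeIdx → ℝ) (a b : CP1) (p q : ℤ) : ℂ :=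
  (1 / 2) * ∑ᶠ ij : ℤ × ℤ,
    ((rLamMu N g ρ a b ij.1 ij.2 + rMuLam N g ρ a b ij.1 ij.2) *
      (lcoeff (orbitQ Fm φ t a) (p - ij.1) ⊗ₖ (1 : Matrix (Fin N) (Fin N) ℂ)) *
      ((1 : Matrix (Fin N) (Fin N) ℂ) ⊗ₖ lcoeff (orbitQ Fm φ t b) (q - ij.2))).trace

/-- The coefficient of `λ_a^p μ_b^q` in the generating Lagrangian multiform
`𝓛^{a,b}(λ_a, μ_b) = K^{a,b}(λ_a, μ_b) - U^{a,b}(λ_a, μ_b)`. -/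
def lagrangian {N : ℕ} (g : LieKind) (ρ : RKind)
    (Fm : CP1 → Matrix (Fin N) (Fin N) (LaurentSeries ℂ))
    (φ : Config N) (t : TimeIdx → ℝ) (a b : CP1) (p q : ℤ) : ℂ :=
  kinetic ρ Fm φ t a b p q - potential g ρ Fm φ t a b p q

/-- The coefficient of `λ_a^p μ_b^q ν_c^s` in the generating form
`𝓓_{ν_c} 𝓛^{a,b}(λ_a, μ_b) + 𝓓_{μ_b} 𝓛^{c,a}(ν_c, λ_a) + 𝓓_{λ_a} 𝓛^{b,c}(μ_b, ν_c)`
of the exterior derivative `d𝓛`. -/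
def dLagrangian {N : ℕ} (g : LieKind) (ρ : RKind)
    (Fm : CP1 → Matrix (Fin N) (Fin N) (LaurentSeries ℂ))
    (φ : Config N) (t : TimeIdx → ℝ) (a b c : CP1) (p q s : ℤ) : ℂ :=
  pd (timeOf ρ c s) (fun u => lagrangian g ρ Fm φ u a b p q) t +
    pd (timeOf ρ b q) (fun u => lagrangian g ρ Fm φ u c a s p) t +
    pd (timeOf ρ a p) (fun u => lagrangian g ρ Fm φ u b c q s) t

/-- A smooth one-parameter variation `Φ_ε` of `φ` through field configurations on `Ω`. -/
def IsVariation {N : ℕ} (g : LieKind) (ρ : RKind) (Ω : Set (TimeIdx → ℝ)) (φ : Config N)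
    (Φ : ℝ → Config N) : Prop :=
  (∀ t ∈ Ω, Φ 0 t = φ t) ∧
  (∀ ε, ∀ t ∈ Ω, InAdelicGroup g ρ (Φ ε t)) ∧
  ∀ a i j m, SmoothFamilyOn Ω fun ε t => PowerSeries.coeff m (Φ ε t a i j)

/-- The multiform Euler-Lagrange equations `δ d𝓛 = 0` in generating form. At every point the
variational differential of `d𝓛`, evaluated on every variation of the field, vanishes. Since the
values at a point of the variation of the field and of its derivatives are arbitrary (subject only
to the linearised constraints of `𝓐⁺(G)`), this is the vanishing of the coefficients of all the
independent vertical forms `δφ`, `δ∂φ`, ... -/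
def MultiformEL {N : ℕ} (g : LieKind) (ρ : RKind)
    (Fm : CP1 → Matrix (Fin N) (Fin N) (LaurentSeries ℂ))
    (Ω : Set (TimeIdx → ℝ)) (φ : Config N) : Prop :=
  ∀ Φ : ℝ → Config N, IsVariation g ρ Ω φ Φ →
    ∀ t ∈ Ω, ∀ (a b c : CP1) (p q s : ℤ),
      HasDerivAt (fun ε : ℝ => dLagrangian g ρ Fm (Φ ε) t a b c p q s) 0 0

/-! ### The generating Lax equation -/

/-- The coefficient of `λ_a^p μ_b^q` in `Tr₂ (ι_{λ_a} ι_{μ_b} r₁₂(λ, μ) Q^b₂(μ_b))`.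
Only finitely many terms of the sum are non-zero. -/
def laxV {N : ℕ} (g : LieKind) (ρ : RKind)
    (Fm : CP1 → Matrix (Fin N) (Fin N) (LaurentSeries ℂ))
    (φ : Config N) (t : TimeIdx → ℝ) (a b : CP1) (p q : ℤ) : Matrix (Fin N) (Fin N) ℂ :=
  ∑ᶠ j : ℤ, trTwo (rLamMu N g ρ a b p j *
    ((1 : Matrix (Fin N) (Fin N) ℂ) ⊗ₖ lcoeff (orbitQ Fm φ t b) (q - j)))

/-- The generating Lax equation
`𝓓_{μ_b} Q^a₁(λ_a) = [Tr₂ (ι_{λ_a} ι_{μ_b} r₁₂(λ, μ) Q^b₂(μ_b)), Q^a₁(λ_a)]`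
on `Ω`, for all `a`, `b`, as an equality of the coefficients of `λ_a^p μ_b^q`. -/
def GeneratingLax {N : ℕ} (g : LieKind) (ρ : RKind)
    (Fm : CP1 → Matrix (Fin N) (Fin N) (LaurentSeries ℂ))
    (Ω : Set (TimeIdx → ℝ)) (φ : Config N) : Prop :=
  ∀ t ∈ Ω, ∀ (a b : CP1) (p q : ℤ),
    (Matrix.of fun i j => pd (timeOf ρ b q) (fun u => lcoeff (orbitQ Fm φ u a) p i j) t) =
      ∑ᶠ n : ℤ, ⁅laxV g ρ Fm φ t a b (p - n) q, lcoeff (orbitQ Fm φ t a) n⁆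

end

end AdelicMultiform

/-!
The proof rests on a formula which exhibits `d𝓛` as an expression of order two in the defects of the
Lax equation. For a field `φ` and points `a`, `b` let

  `E^{a,b}(λ_a, μ_b) = 𝓓_{μ_b} φ^a (φ^a)⁻¹ - Tr₂ (ι_{λ_a} ι_{μ_b} r₁₂(λ, μ) Q^b₂(μ_b))`

(`laxDefect`). Since `𝓓_{μ_b} Q^a = [𝓓_{μ_b} φ^a (φ^a)⁻¹, Q^a]`, the Lax equation says that every
`E^{a,b}` commutes with `Q^a` (`IsField.generatingLax_iff`). For every field, solution or not,

  `d𝓛^{a,b,c} = Tr ([E^{a,b}, E^{a,c}] Q^a) + Tr ([E^{b,c}, E^{b,a}] Q^b)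
    + Tr ([E^{c,a}, E^{c,b}] Q^c)`

(`IsField.dLagrangian_eq`). The kinetic terms give the part without `r`, the second derivatives of
`φ` dropping out because the times commute, and the potential terms give the part linear in `r`. Two
properties of the `r`-matrix enter. Skew-symmetry (`skew_ratPartAt`) allows the two orders of
expansion in the potential to be exchanged against traces which vanish. The closure relation
(`closure_ratPartAt`), which takes the place of the classical Yang-Baxter equation, kills the part
quadratic in `r`. Both are consequences of the residue theorem: the Laurent coefficients in `μ_b` of
the Lax matrix are expansions of a rational function `V`, and `V + X` has no poles for an adèle `X`
concentrated at `b`, a multiple of `Q^b`. The rational adèles are isotropic for the residue pairing,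
and so are the integral ones (at `0` and `∞`, in the trigonometric case, because the constant terms
are triangular with opposite diagonals), both are closed under commutators, and the adèles `X`
commute.

If the Lax equation holds, all `E` commute with the `Q`, and since variations move `Q^a` in its
adjoint orbit, the first variation of `Tr ([E, E'] Q)` vanishes (`multiformEL_of_generatingLax`).

Conversely, fix `a`, `b`, a point `t₀` and a time `τ` belonging to a third point `c`, and vary `φ^a`
to `(1 + ε (t_τ - t₀_τ) η λ_a^n) φ^a`, with `η` nilpotent of rank one and `n ≥ 1`. These are
variations through fields (`IsField.isVariation_bump`), and at `t₀` they change nothing except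
`E^{a,c}`, to which they add `ε η λ_a^n`. So `d𝓛` is affine in `ε`, and its slope pairs `η` with the
commutators `W = [E, Q]`. As the matrices `η` span the traceless matrices, this gives `W = 0` if
`a ≠ b`. If `a = b`, it gives `W^{a,a}_{p-n,q} = W^{a,a}_{q-n,p}`, where the indices are the degrees
in `λ_a` and `μ_a`; the cases `n = 1, 2` show that `W^{a,a}_{p,q}` depends on `p + q` only, and it
vanishes because the pole order of `W^{a,a}` in `λ_a` is bounded independently of `q`
(`generatingLax_of_multiformEL`).
-/

open scoped Kronecker PowerSeries

namespace AdelicMultiform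

noncomputable section

/-! ### Laurent series and the expansion homomorphisms -/

/-- The Cauchy product, written as a sum over an interval that depends only on lower bounds for the
degrees of the two factors. -/
theorem coeff_mul_eq_sum_Icc {K : Type*} [CommRing K] {f g : LaurentSeries K} {A B : ℤ}
    (hf : ∀ n < A, f.coeff n = 0) (hg : ∀ n < B, g.coeff n = 0) (n : ℤ) :
    (f * g).coeff n = ∑ i ∈ Finset.Icc A (n - B), f.coeff i * g.coeff (n - i) := by
  rw [HahnSeries.coeff_mul]
  refine Finset.sum_of_injOn Prod.fst ?_ ?_ ?_ ?_
  · rintro ⟨i, j⟩ hij ⟨i', j'⟩ hij' h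
    simp only [Finset.mem_coe, Finset.mem_antidiagonal] at hij hij' h
    ext
    · exact h
    · simp only; omega
  · rintro ⟨i, j⟩ hij
    simp only [Finset.mem_coe, Finset.mem_antidiagonal, HahnSeries.mem_support] at hij
    simp only [Finset.coe_Icc, Set.mem_Icc]
    obtain ⟨h1, h2, h3⟩ := hij
    constructor
    · by_contra h
      exact h1 (hf i (by omega))
    · by_contra h
      exact h2 (hg j (by omega))
  · intro i _ hi
    by_contra h
    refine hi ⟨(i, n - i), ?_, rfl⟩
    simp only [Finset.mem_coe, Finset.mem_antidiagonal, HahnSeries.mem_support]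
    exact ⟨left_ne_zero_of_mul h, right_ne_zero_of_mul h, by omega⟩
  · rintro ⟨i, j⟩ hij
    simp only [Finset.mem_antidiagonal] at hij
    obtain ⟨-, -, h3⟩ := hij
    simp only [← h3, add_sub_cancel_left]

theorem exists_lower_bound {K : Type*} [Zero K] (f : LaurentSeries K) :
    ∃ B : ℤ, ∀ n < B, f.coeff n = 0 :=
  ⟨f.order, fun _ h => HahnSeries.coeff_eq_zero_of_lt_order h⟩

theorem exists_common_lower_bound {K ι : Type*} [Zero K] [Finite ι] (f : ι → LaurentSeries K) :
    ∃ B : ℤ, ∀ i, ∀ n < B, (f i).coeff n = 0 := by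
  choose b hb using fun i => exists_lower_bound (f i)
  obtain ⟨B, hB⟩ := (Set.finite_range b).bddBelow
  exact ⟨B, fun i n hn => hb i n (lt_of_lt_of_le hn (hB ⟨i, rfl⟩))⟩

theorem coeff_mul_eq_zero {K : Type*} [CommRing K] {f g : LaurentSeries K} {A B : ℤ}
    (hf : ∀ n < A, f.coeff n = 0) (hg : ∀ n < B, g.coeff n = 0) {n : ℤ} (hn : n < A + B) :
    (f * g).coeff n = 0 := by
  rw [coeff_mul_eq_sum_Icc hf hg, Finset.Icc_eq_empty (by omega), Finset.sum_empty]

section Expand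

variable {K : Type*} [Field K] [Algebra ℂ K]

/-- The local coordinate is transcendental: no nonzero polynomial vanishes at it. -/
theorem eval₂_globalCoord_ne_zero (a : CP1) {q : Polynomial K} (hq : q ≠ 0) :
    Polynomial.eval₂ (HahnSeries.C : K →+* LaurentSeries K) (globalCoord a) q ≠ 0 := by
  induction a using OnePoint.rec with
  | infty =>
    intro h
    have h2 := congrArg (fun f : LaurentSeries K => f.coeff (-(q.natDegree : ℤ))) h
    simp only [globalCoord, Polynomial.eval₂_eq_sum_range, HahnSeries.single_pow,
      HahnSeries.coeff_sum, HahnSeries.coeff_zero] at h2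
    rw [Finset.sum_eq_single q.natDegree] at h2
    · simp at h2
      exact hq h2
    · intro j _ hj
      rw [HahnSeries.C_mul_eq_smul, HahnSeries.coeff_smul, HahnSeries.coeff_single_of_ne,
        smul_zero]
      intro h3
      apply hj
      simp at h3
      omega
    · intro h3
      simp at h3
  | coe z =>
    have h1 : ∀ q : Polynomial K, Polynomial.eval₂ (HahnSeries.C : K →+* LaurentSeries K)
        (globalCoord (OnePoint.some z)) q =
        HahnSeries.ofPowerSeries ℤ K
          ((Polynomial.taylor (algebraMap ℂ K z) q : Polynomial K) : K⟦X⟧) := by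
      intro q
      rw [Polynomial.taylor_apply]
      induction q using Polynomial.induction_on' with
      | add p q hp hq => simp [Polynomial.eval₂_add, hq, hp]
      | monomial n c => simp [globalCoord, add_comm]
    rw [h1]
    intro h
    rw [← map_zero (HahnSeries.ofPowerSeries ℤ K)] at h
    have h3 := HahnSeries.ofPowerSeries_injective h
    rw [Polynomial.coe_eq_zero_iff] at h3
    exact hq ((Polynomial.taylor_eq_zero _ _).1 h3)

theorem nonZeroDivisors_le_comap_eval₂ (a : CP1) :
    nonZeroDivisors (Polynomial K) ≤ (nonZeroDivisors (LaurentSeries K)).comap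
      (Polynomial.eval₂RingHom HahnSeries.C (globalCoord a)) :=
  fun _ hq => mem_nonZeroDivisors_of_ne_zero
    (eval₂_globalCoord_ne_zero a (nonZeroDivisors.ne_zero hq))

/-- The Laurent expansion at a point, as a ring homomorphism. -/
def expandHom (a : CP1) : RatFunc K →+* LaurentSeries K :=
  RatFunc.liftRingHom (Polynomial.eval₂RingHom HahnSeries.C (globalCoord a))
    (nonZeroDivisors_le_comap_eval₂ a)

theorem expand_eq_expandHom (a : CP1) (f : RatFunc K) : expand a f = expandHom a f := by
  conv_rhs => rw [← RatFunc.num_div_denom f]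
  rw [expandHom, RatFunc.liftRingHom_apply_div]
  rfl

@[simp]
theorem expandHom_C (a : CP1) (c : K) : expandHom a (RatFunc.C c) = HahnSeries.C c := by
  rw [← expand_eq_expandHom, expand, RatFunc.eval_C]

@[simp]
theorem expandHom_X (a : CP1) : expandHom a (RatFunc.X : RatFunc K) = globalCoord a := by
  rw [← expand_eq_expandHom, expand, RatFunc.eval_X]

end Expand

/-! ### The Laurent coefficients of the Cauchy kernel and the residue theorem -/

/-- The coefficient of `μ_a^j` in the expansion at `μ = a` of the Cauchy kernel `1 / (μ - λ)`, as a
rational function of `λ` (see `coeff_expandHom_cauchy`). -/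
def cauchyCoeff (a : CP1) (j : ℤ) : RatFunc ℂ :=
  match a with
  | OnePoint.infty => if 1 ≤ j then RatFunc.X ^ (j - 1).toNat else 0
  | OnePoint.some z => if 0 ≤ j then -((RatFunc.X - RatFunc.C z)⁻¹) ^ (j.toNat + 1) else 0

theorem coeff_ofPowerSeries_of_neg {K : Type*} [Semiring K] (g : K⟦X⟧) {n : ℤ} (hn : n < 0) :
    (HahnSeries.ofPowerSeries ℤ K g).coeff n = 0 := by
  rw [PowerSeries.coeff_coe, if_pos hn]

theorem globalCoord_infty {K : Type*} [Field K] [Algebra ℂ K] :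
    (globalCoord OnePoint.infty : LaurentSeries K) = HahnSeries.single (-1) 1 := rfl

theorem expandHom_X_sub_C_self (z : ℂ) :
    expandHom (OnePoint.some z) (RatFunc.X - RatFunc.C z : RatFunc ℂ) = HahnSeries.single 1 1 := by
  rw [map_sub, expandHom_X, expandHom_C]
  simp [globalCoord]

theorem expandHom_inv_X_sub_C_of_ne {z w : ℂ} (h : w ≠ z) : ∃ g : ℂ⟦X⟧,
    expandHom (OnePoint.some w) ((RatFunc.X - RatFunc.C z : RatFunc ℂ)⁻¹) =
      HahnSeries.ofPowerSeries ℤ ℂ g := by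
  have hc : PowerSeries.constantCoeff (PowerSeries.C (w - z) + PowerSeries.X : ℂ⟦X⟧) ≠ 0 := by
    simpa using sub_ne_zero.2 h
  refine ⟨(PowerSeries.C (w - z) + PowerSeries.X)⁻¹, ?_⟩
  rw [map_inv₀]
  refine inv_eq_of_mul_eq_one_right ?_
  have : expandHom (OnePoint.some w) (RatFunc.X - RatFunc.C z : RatFunc ℂ) =
      HahnSeries.ofPowerSeries ℤ ℂ (PowerSeries.C (w - z) + PowerSeries.X) := by
    rw [map_sub, expandHom_X, expandHom_C]
    simp [globalCoord]
    ring
  rw [this, ← map_mul, PowerSeries.mul_inv_cancel _ hc, map_one]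

theorem expandHom_infty_inv_X_sub_C (z : ℂ) : ∃ g : ℂ⟦X⟧, PowerSeries.constantCoeff g = 1 ∧
    expandHom OnePoint.infty ((RatFunc.X - RatFunc.C z : RatFunc ℂ)⁻¹) =
      HahnSeries.single 1 1 * HahnSeries.ofPowerSeries ℤ ℂ g := by
  have hc : PowerSeries.constantCoeff (1 - PowerSeries.C z * PowerSeries.X : ℂ⟦X⟧) ≠ 0 := by
    simp
  refine ⟨(1 - PowerSeries.C z * PowerSeries.X)⁻¹, by simp, ?_⟩
  rw [map_inv₀]
  refine inv_eq_of_mul_eq_one_right ?_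
  have : expandHom OnePoint.infty (RatFunc.X - RatFunc.C z : RatFunc ℂ) =
      HahnSeries.single (-1) 1 *
        HahnSeries.ofPowerSeries ℤ ℂ (1 - PowerSeries.C z * PowerSeries.X) := by
    rw [map_sub, expandHom_X, expandHom_C]
    simp [globalCoord, mul_sub, HahnSeries.C_apply]
  rw [this, mul_mul_mul_comm, ← map_mul, PowerSeries.mul_inv_cancel _ hc,
    HahnSeries.single_mul_single]
  simp

theorem coeff_expandHom_cauchyCoeff_of_neg {w : ℂ} {a : CP1} (h : a ≠ OnePoint.some w) (j : ℤ)
    {n : ℤ} (hn : n < 0) : (expandHom (OnePoint.some w) (cauchyCoeff a j)).coeff n = 0 := by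
  induction a using OnePoint.rec with
  | infty =>
    simp only [cauchyCoeff]
    split_ifs
    · have : globalCoord (OnePoint.some w) =
          HahnSeries.ofPowerSeries ℤ ℂ (PowerSeries.C w + PowerSeries.X) := by
        simp [globalCoord]
      rw [map_pow, expandHom_X, this, ← map_pow, coeff_ofPowerSeries_of_neg _ hn]
    · simp
  | coe z =>
    simp only [cauchyCoeff]
    split_ifs
    · obtain ⟨g, hg⟩ := expandHom_inv_X_sub_C_of_ne (z := z) (w := w) (by rintro rfl; exact h rfl)
      rw [map_neg, map_pow, hg, ← map_pow, HahnSeries.coeff_neg, coeff_ofPowerSeries_of_neg _ hn,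
        neg_zero]
    · simp

theorem coeff_expandHom_infty_cauchyCoeff (z : ℂ) (j : ℤ) {n : ℤ} (hn : n ≤ 1) :
    (expandHom OnePoint.infty (cauchyCoeff (OnePoint.some z) j)).coeff n =
      if j = 0 ∧ n = 1 then -1 else 0 := by
  simp only [cauchyCoeff]
  split_ifs with h0 h1 h1
  · obtain ⟨rfl, rfl⟩ := h1
    obtain ⟨g, hg1, hg⟩ := expandHom_infty_inv_X_sub_C z
    simp only [map_neg, hg, HahnSeries.coeff_neg, Int.toNat_zero, zero_add, pow_one,
      HahnSeries.coeff_single_mul, one_mul, sub_self, PowerSeries.coeff_coe]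
    simpa using hg1
  · obtain ⟨g, hg1, hg⟩ := expandHom_infty_inv_X_sub_C z
    rw [map_neg, map_pow, hg, mul_pow, HahnSeries.single_pow, ← map_pow, one_pow,
      HahnSeries.coeff_neg, HahnSeries.coeff_single_mul, one_mul, coeff_ofPowerSeries_of_neg,
      neg_zero]
    simp only [nsmul_eq_mul, Nat.cast_add, Int.toNat_of_nonneg h0]
    by_contra h2
    push_cast at h2
    exact h1 ⟨by omega, by omega⟩
  · omega
  · simp

theorem coeff_expandHom_cauchyCoeff_self (z : ℂ) (j n : ℤ) :
    (expandHom (OnePoint.some z) (cauchyCoeff (OnePoint.some z) j)).coeff n =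
      if 0 ≤ j ∧ n = -j - 1 then -1 else 0 := by
  simp only [cauchyCoeff]
  by_cases h0 : 0 ≤ j
  · simp only [h0, if_true, true_and]
    rw [map_neg, map_pow, map_inv₀, expandHom_X_sub_C_self, HahnSeries.inv_single,
      HahnSeries.single_pow, HahnSeries.coeff_neg, HahnSeries.coeff_single]
    have : (j.toNat + 1) • (-1 : ℤ) = -j - 1 := by
      simp [h0]; ring
    rw [this]
    split_ifs <;> simp
  · simp [h0]

theorem coeff_expandHom_infty_cauchyCoeff_infty (j n : ℤ) :
    (expandHom OnePoint.infty (cauchyCoeff OnePoint.infty j)).coeff n =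
      if 1 ≤ j ∧ n = 1 - j then 1 else 0 := by
  simp only [cauchyCoeff]
  by_cases h0 : 1 ≤ j
  · simp only [h0, if_true, true_and]
    rw [map_pow, expandHom_X, globalCoord_infty, HahnSeries.single_pow, HahnSeries.coeff_single]
    have : (j - 1).toNat • (-1 : ℤ) = 1 - j := by
      simp only [nsmul_eq_mul]
      omega
    rw [this]
    simp
  · simp [h0]

/-- The Laurent series whose product with the expansion of `f` at `a` has the residue of `f dλ` at
`a` as its constant term: `λ_a` for finite `a`, and `-λ_∞⁻¹` at infinity. -/
def diffCoord (a : CP1) : LaurentSeries ℂ :=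
  match a with
  | OnePoint.infty => HahnSeries.single (-1) (-1)
  | OnePoint.some _ => HahnSeries.single 1 1

/-- The finite sums of residues of `f dλ` over large sets of points vanish. -/
def ResidueSumVanishes (f : RatFunc ℂ) : Prop :=
  ∃ T₀ : Finset CP1, ∀ T, T₀ ⊆ T → ∑ z ∈ T, (diffCoord z * expandHom z f).coeff 0 = 0

theorem ResidueSumVanishes.add {f g : RatFunc ℂ} (hf : ResidueSumVanishes f)
    (hg : ResidueSumVanishes g) : ResidueSumVanishes (f + g) := by
  classical
  obtain ⟨S, hS⟩ := hf
  obtain ⟨T, hT⟩ := hg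
  refine ⟨S ∪ T, fun U hU => ?_⟩
  simp only [map_add, mul_add, HahnSeries.coeff_add, Finset.sum_add_distrib]
  rw [hS U (Finset.union_subset_left hU), hT U (Finset.union_subset_right hU), add_zero]

theorem ResidueSumVanishes.C_mul (c : ℂ) {f : RatFunc ℂ} (hf : ResidueSumVanishes f) :
    ResidueSumVanishes (RatFunc.C c * f) := by
  obtain ⟨S, hS⟩ := hf
  refine ⟨S, fun U hU => ?_⟩
  have h : ∀ z, (diffCoord z * expandHom z (RatFunc.C c * f)).coeff 0 =
      c * (diffCoord z * expandHom z f).coeff 0 := by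
    intro z
    rw [map_mul, expandHom_C, mul_left_comm, HahnSeries.C_mul_eq_smul]
    rfl
  simp only [h, ← Finset.mul_sum, hS U hU, mul_zero]

theorem residueSumVanishes_cauchyCoeff (a : CP1) (j : ℤ) :
    ResidueSumVanishes (cauchyCoeff a j) := by
  classical
  refine ⟨{a, OnePoint.infty}, fun T hT => ?_⟩
  rw [← Finset.sum_subset hT]
  · induction a using OnePoint.rec with
    | infty =>
      simp only [Finset.mem_singleton, Finset.insert_eq_of_mem, Finset.sum_singleton, diffCoord]
      rw [HahnSeries.coeff_single_mul,
        coeff_expandHom_infty_cauchyCoeff_infty, if_neg (by omega)]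
      simp
    | coe z =>
      rw [Finset.sum_pair (OnePoint.coe_ne_infty z)]
      simp only [diffCoord]
      rw [HahnSeries.coeff_single_mul, HahnSeries.coeff_single_mul]
      have h1 := coeff_expandHom_infty_cauchyCoeff z j (n := 1) le_rfl
      have h2 := coeff_expandHom_cauchyCoeff_self z j (-1)
      have h3 : (expandHom (↑z : CP1) (cauchyCoeff (↑z : CP1) j)).coeff (0 - 1) =
        if 0 ≤ j ∧ (-1 : ℤ) = -j - 1 then -1 else 0 := h2
      have h4 : (expandHom OnePoint.infty (cauchyCoeff (↑z : CP1) j)).coeff (0 - -1) =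
        if j = 0 ∧ (1 : ℤ) = 1 then -1 else 0 := h1
      rw [h3, h4]
      by_cases hj : j = 0
      · subst hj; norm_num
      · rw [if_neg (by omega), if_neg (by tauto)]; simp
  · intro w _ hw
    simp only [Finset.mem_insert, Finset.mem_singleton, not_or] at hw
    obtain ⟨w, rfl⟩ := OnePoint.ne_infty_iff_exists.1 hw.2
    simp only [diffCoord]
    rw [HahnSeries.coeff_single_mul]
    have := coeff_expandHom_cauchyCoeff_of_neg (w := w) (Ne.symm hw.1) j (n := 0 - 1) (by norm_num)
    rw [one_mul]
    exact this

theorem cauchyCoeff_infty (n : ℕ) : cauchyCoeff OnePoint.infty (n + 1) = RatFunc.X ^ n := by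
  simp [cauchyCoeff]

theorem cauchyCoeff_coe (z : ℂ) (n : ℕ) :
    cauchyCoeff (OnePoint.some z) n = -((RatFunc.X - RatFunc.C z)⁻¹) ^ (n + 1) := by
  simp [cauchyCoeff]

theorem X_sub_C_ne_zero (z : ℂ) : (RatFunc.X - RatFunc.C z : RatFunc ℂ) ≠ 0 := by
  intro h
  have := congrArg (expandHom (OnePoint.some z)) h
  rw [expandHom_X_sub_C_self, map_zero] at this
  exact one_ne_zero (HahnSeries.single_eq_zero_iff.1 this)

/-- The partial fraction expansion, in the form: the coefficients of the Cauchy kernel span the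
space of rational functions. -/
theorem span_cauchyCoeff_induction {P : RatFunc ℂ → Prop} (hk : ∀ a j, P (cauchyCoeff a j))
    (hadd : ∀ f g, P f → P g → P (f + g)) (hsmul : ∀ c f, P f → P (RatFunc.C c * f))
    (f : RatFunc ℂ) : P f := by
  let S : Submodule ℂ (RatFunc ℂ) :=
    Submodule.span ℂ (Set.range fun aj : CP1 × ℤ => cauchyCoeff aj.1 aj.2)
  have hS : ∀ f ∈ S, P f := by
    intro f hf
    induction hf using Submodule.span_induction with
    | mem x hx => obtain ⟨aj, rfl⟩ := hx; exact hk _ _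
    | zero => simpa using hsmul 0 _ (hk OnePoint.infty 0)
    | add x y _ _ hx hy => exact hadd _ _ hx hy
    | smul c x _ hx => rw [RatFunc.smul_eq_C_mul]; exact hsmul c x hx
  have hpow : ∀ n : ℕ, RatFunc.X ^ n ∈ S := fun n =>
    Submodule.subset_span ⟨(OnePoint.infty, n + 1), cauchyCoeff_infty n⟩
  have hinv : ∀ (z : ℂ) (n : ℕ), ((RatFunc.X - RatFunc.C z)⁻¹ : RatFunc ℂ) ^ (n + 1) ∈ S := by
    intro z n
    rw [← neg_neg ((RatFunc.X - RatFunc.C z)⁻¹ ^ (n + 1) : RatFunc ℂ)]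
    exact S.neg_mem (Submodule.subset_span ⟨(OnePoint.some z, n), cauchyCoeff_coe z n⟩)
  -- The span is stable under multiplication by `1 / (X - w)`.
  have hmul : ∀ (w : ℂ), ∀ f ∈ S, f * (RatFunc.X - RatFunc.C w)⁻¹ ∈ S := by
    intro w f hf
    have hw := X_sub_C_ne_zero w
    induction hf using Submodule.span_induction with
    | mem x hx =>
      obtain ⟨⟨a, j⟩, rfl⟩ := hx
      simp only
      induction a using OnePoint.rec with
      | infty =>
        simp only [cauchyCoeff]
        split_ifs
        · generalize (j - 1).toNat = n
          induction n with
          | zero => simpa using hinv w 0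
          | succ n ih =>
            have : (RatFunc.X ^ (n + 1) * (RatFunc.X - RatFunc.C w)⁻¹ : RatFunc ℂ) =
                RatFunc.X ^ n + w • (RatFunc.X ^ n * (RatFunc.X - RatFunc.C w)⁻¹) := by
              rw [RatFunc.smul_eq_C_mul]
              field_simp
              ring
            rw [this]
            exact S.add_mem (hpow n) (S.smul_mem _ ih)
        · simp
      | coe z =>
        simp only [cauchyCoeff]
        split_ifs
        · rw [neg_mul]
          refine S.neg_mem ?_
          have hz := X_sub_C_ne_zero z
          by_cases hzw : z = w
          · subst hzw
            rw [← pow_succ]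
            exact hinv _ _
          · have hC : (RatFunc.C z - RatFunc.C w : RatFunc ℂ) ≠ 0 := by
              rw [← map_sub, Ne, map_eq_zero]
              exact sub_ne_zero.2 hzw
            have step : ∀ g : RatFunc ℂ,
                g * (RatFunc.X - RatFunc.C z)⁻¹ * (RatFunc.X - RatFunc.C w)⁻¹ = (z - w)⁻¹ •
                  (g * (RatFunc.X - RatFunc.C z)⁻¹ - g * (RatFunc.X - RatFunc.C w)⁻¹) := by
              intro g
              rw [RatFunc.smul_eq_C_mul, map_inv₀, map_sub]
              field_simp
              ring
            generalize j.toNat = n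
            induction n with
            | zero =>
              have := step 1
              simp only [one_mul] at this
              rw [zero_add, pow_one, this]
              exact S.smul_mem _ (S.sub_mem (by simpa using hinv z 0) (by simpa using hinv w 0))
            | succ n ih =>
              rw [pow_succ, step, ← pow_succ]
              exact S.smul_mem _ (S.sub_mem (hinv z _) ih)
        · simp
    | zero => simp
    | add x y _ _ hx hy => rw [add_mul]; exact S.add_mem hx hy
    | smul c x _ hx => rw [smul_mul_assoc]; exact S.smul_mem _ hx
  apply hS
  rw [← RatFunc.num_div_denom f]
  have hpoly : ∀ p : Polynomial ℂ, algebraMap (Polynomial ℂ) (RatFunc ℂ) p ∈ S := by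
    intro p
    induction p using Polynomial.induction_on' with
    | add p q hp hq => rw [map_add]; exact S.add_mem hp hq
    | monomial n c =>
      rw [RatFunc.algebraMap_monomial, ← RatFunc.smul_eq_C_mul]
      exact S.smul_mem _ (hpow n)
  have hsplit := (IsAlgClosed.splits f.denom).eq_prod_roots
  rw [(RatFunc.monic_denom f).leadingCoeff, map_one, one_mul] at hsplit
  rw [hsplit]
  generalize f.denom.roots = s
  induction s using Multiset.induction_on with
  | empty => simpa using hpoly _
  | cons z s ih =>
    have := hmul z _ ih
    simp only [Multiset.map_cons, Multiset.prod_cons, map_mul, map_sub, RatFunc.algebraMap_X,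
      RatFunc.algebraMap_C, div_eq_mul_inv, mul_inv] at this ⊢
    convert this using 1
    ring

/-- The residue theorem on the Riemann sphere. -/
theorem residueSumVanishes (f : RatFunc ℂ) : ResidueSumVanishes f :=
  span_cauchyCoeff_induction residueSumVanishes_cauchyCoeff (fun _ _ => .add)
    (fun c _ => .C_mul c) f

/-! ### Laurent matrices: lower bounds for degrees and coefficients -/

/-- All coefficients of degree less than `B` of all entries vanish. -/
def VanishesBelow {N : ℕ} (B : ℤ) (Y : Matrix (Fin N) (Fin N) (LaurentSeries ℂ)) : Prop :=
  ∀ i j, ∀ n < B, (Y i j).coeff n = 0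

section LaurentMatrices

variable {N : ℕ} {X Y : Matrix (Fin N) (Fin N) (LaurentSeries ℂ)} {A B : ℤ}

theorem exists_vanishesBelow (Y : Matrix (Fin N) (Fin N) (LaurentSeries ℂ)) :
    ∃ B, VanishesBelow B Y := by
  obtain ⟨B, hB⟩ := exists_common_lower_bound fun ij : Fin N × Fin N => Y ij.1 ij.2
  exact ⟨B, fun i j => hB (i, j)⟩

theorem VanishesBelow.mono (hY : VanishesBelow B Y) (h : A ≤ B) : VanishesBelow A Y :=
  fun i j n hn => hY i j n (lt_of_lt_of_le hn h)

theorem VanishesBelow.mul (hX : VanishesBelow A X) (hY : VanishesBelow B Y) :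
    VanishesBelow (A + B) (X * Y) := by
  intro i j n hn
  rw [Matrix.mul_apply, HahnSeries.coeff_sum]
  exact Finset.sum_eq_zero fun k _ => coeff_mul_eq_zero (hX i k) (hY k j) hn

theorem VanishesBelow.sub (hX : VanishesBelow B X) (hY : VanishesBelow B Y) :
    VanishesBelow B (X - Y) := by
  intro i j n hn
  rw [Matrix.sub_apply, HahnSeries.coeff_sub, hX i j n hn, hY i j n hn, sub_zero]

theorem VanishesBelow.coeff_trace (hX : VanishesBelow B X) {n : ℤ} (hn : n < B) :
    X.trace.coeff n = 0 := by
  rw [Matrix.trace, HahnSeries.coeff_sum]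
  exact Finset.sum_eq_zero fun i _ => hX i i n hn

theorem coeff_trace_eq (X : Matrix (Fin N) (Fin N) (LaurentSeries ℂ)) (n : ℤ) :
    X.trace.coeff n = (lcoeff X n).trace := by
  rw [Matrix.trace, HahnSeries.coeff_sum]
  rfl

theorem lcoeff_sub (X Y : Matrix (Fin N) (Fin N) (LaurentSeries ℂ)) (n : ℤ) :
    lcoeff (X - Y) n = lcoeff X n - lcoeff Y n := by
  ext i j
  simp [lcoeff]

theorem lcoeff_mul_eq_sum (hX : VanishesBelow A X) (hY : VanishesBelow B Y) (n : ℤ) :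
    lcoeff (X * Y) n = ∑ i ∈ Finset.Icc A (n - B), lcoeff X i * lcoeff Y (n - i) := by
  ext i j
  rw [Matrix.sum_apply]
  simp only [lcoeff, Matrix.map_apply, Matrix.mul_apply, HahnSeries.coeff_sum]
  rw [Finset.sum_comm]
  exact Finset.sum_congr rfl fun k _ => coeff_mul_eq_sum_Icc (hX i k) (hY k j) n

theorem lcoeff_mul_lowest (hX : VanishesBelow A X) (hY : VanishesBelow B Y) :
    lcoeff (X * Y) (A + B) = lcoeff X A * lcoeff Y B := by
  rw [lcoeff_mul_eq_sum hX hY]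
  simp

end LaurentMatrices

/-! ### The projection of an adèle to the rational functions -/

/-- The rational function `∑_j f_{q-j} k_{b,j}`, with `k_{b,j}` the coefficients of the Cauchy
kernel at `b`: the coefficient of `μ_b^q` in the expansion at `μ = b` of `f(μ_b) / (μ - λ)`.
Up to sign it is the principal part at `b` of a multiple of `λ_b^{-q} f(λ_b)`. -/
def cauchyTransform (b : CP1) (q : ℤ) (f : LaurentSeries ℂ) : RatFunc ℂ :=
  ∑ᶠ j : ℤ, RatFunc.C (f.coeff (q - j)) * cauchyCoeff b j

theorem cauchyCoeff_of_neg (b : CP1) {j : ℤ} (hj : j < 0) : cauchyCoeff b j = 0 := by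
  induction b using OnePoint.rec with
  | infty => exact if_neg (by omega)
  | coe z => exact if_neg (by omega)

theorem cauchyTransform_eq_sum {f : LaurentSeries ℂ} {B : ℤ} (hf : ∀ n < B, f.coeff n = 0)
    (b : CP1) (q : ℤ) :
    cauchyTransform b q f =
      ∑ j ∈ Finset.Icc 0 (q - B), RatFunc.C (f.coeff (q - j)) * cauchyCoeff b j := by
  rw [cauchyTransform, finsum_eq_sum_of_support_subset]
  intro j hj
  rw [Function.mem_support] at hj
  simp only [Finset.coe_Icc, Set.mem_Icc]
  constructor
  · by_contra h
    exact right_ne_zero_of_mul hj (cauchyCoeff_of_neg b (by omega))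
  · by_contra h
    exact left_ne_zero_of_mul hj (by rw [hf _ (by omega), map_zero])

theorem coeff_expandHom_cauchyTransform (a b : CP1) (q : ℤ) (f : LaurentSeries ℂ) (n : ℤ) :
    (expandHom a (cauchyTransform b q f)).coeff n =
      ∑ᶠ j : ℤ, f.coeff (q - j) * (expandHom a (cauchyCoeff b j)).coeff n := by
  obtain ⟨B, hB⟩ := exists_lower_bound f
  rw [cauchyTransform_eq_sum hB, map_sum, HahnSeries.coeff_sum, finsum_eq_sum_of_support_subset]
  · refine Finset.sum_congr rfl fun j _ => ?_
    rw [map_mul, expandHom_C, HahnSeries.C_mul_eq_smul, HahnSeries.coeff_smul, smul_eq_mul]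
  · intro j hj
    rw [Function.mem_support] at hj
    simp only [Finset.coe_Icc, Set.mem_Icc]
    constructor
    · by_contra h
      exact right_ne_zero_of_mul hj (by simp [cauchyCoeff_of_neg b (show j < 0 by omega)])
    · by_contra h
      exact left_ne_zero_of_mul hj (hB _ (by omega))

/-- The multiple of `λ_a^{-p} f(λ_a)`, regarded as an adèle concentrated at `a`, whose pairing with
an adèle `g` under the residue pairing for `dλ` is the coefficient of `λ_a^p` in `g f`. -/
def shiftAt (a : CP1) (p : ℤ) (f : LaurentSeries ℂ) : LaurentSeries ℂ :=
  (diffCoord a)⁻¹ * HahnSeries.single (-p) 1 * f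

theorem diffCoord_infty : diffCoord OnePoint.infty = HahnSeries.single (-1) (-1) := rfl

theorem diffCoord_coe (z : ℂ) : diffCoord (OnePoint.some z) = HahnSeries.single 1 1 := rfl

theorem inv_diffCoord_infty : (diffCoord OnePoint.infty)⁻¹ = HahnSeries.single 1 (-1) := by
  change (HahnSeries.single (-1 : ℤ) (-1 : ℂ))⁻¹ = _
  rw [HahnSeries.inv_single, neg_neg, inv_neg_one]

theorem inv_diffCoord_coe (z : ℂ) :
    (diffCoord (OnePoint.some z))⁻¹ = HahnSeries.single (-1) 1 := by
  simp [diffCoord, HahnSeries.inv_single]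

theorem coeff_shiftAt_infty (p : ℤ) (f : LaurentSeries ℂ) (n : ℤ) :
    (shiftAt OnePoint.infty p f).coeff n = -f.coeff (n - 1 + p) := by
  rw [shiftAt, inv_diffCoord_infty, HahnSeries.single_mul_single, HahnSeries.coeff_single_mul]
  rw [show n - (1 + -p) = n - 1 + p by ring]
  ring

theorem coeff_shiftAt_coe (z : ℂ) (p : ℤ) (f : LaurentSeries ℂ) (n : ℤ) :
    (shiftAt (OnePoint.some z) p f).coeff n = f.coeff (n + 1 + p) := by
  rw [shiftAt, inv_diffCoord_coe, HahnSeries.single_mul_single, HahnSeries.coeff_single_mul]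
  rw [show n - (-1 + -p) = n + 1 + p by ring]
  ring

open scoped Classical in
/-- The component at `z` of the sum of the adèle `shiftAt a p f`, concentrated at `a`, and of the
rational function `cauchyTransform a p f`. It is integral: see `coeff_cauchyIntegral_coe` and
`coeff_cauchyIntegral_infty`. -/
def cauchyIntegral (a : CP1) (p : ℤ) (f : LaurentSeries ℂ) (z : CP1) : LaurentSeries ℂ :=
  expandHom z (cauchyTransform a p f) + if z = a then shiftAt a p f else 0

theorem coeff_cauchyIntegral_coe (a : CP1) (p : ℤ) (f : LaurentSeries ℂ) (z : ℂ) {n : ℤ}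
    (hn : n < 0) : (cauchyIntegral a p f (OnePoint.some z)).coeff n = 0 := by
  rw [cauchyIntegral, HahnSeries.coeff_add, coeff_expandHom_cauchyTransform]
  split_ifs with h
  · subst h
    simp only [coeff_expandHom_cauchyCoeff_self, coeff_shiftAt_coe]
    rw [finsum_eq_single _ (-n - 1)]
    · rw [if_pos (by omega), show p - (-n - 1) = n + 1 + p by ring]
      ring
    · intro j hj
      rw [if_neg (by omega), mul_zero]
  · rw [HahnSeries.coeff_zero, add_zero]
    simp only [coeff_expandHom_cauchyCoeff_of_neg (Ne.symm h) _ hn, mul_zero, finsum_zero]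

theorem coeff_cauchyIntegral_infty (a : CP1) (p : ℤ) (f : LaurentSeries ℂ) {n : ℤ} (hn : n ≤ 1) :
    (cauchyIntegral a p f OnePoint.infty).coeff n = if n = 1 then -f.coeff p else 0 := by
  rw [cauchyIntegral, HahnSeries.coeff_add, coeff_expandHom_cauchyTransform]
  induction a using OnePoint.rec with
  | infty =>
    rw [if_pos rfl]
    simp only [coeff_expandHom_infty_cauchyCoeff_infty, coeff_shiftAt_infty]
    rw [finsum_eq_single _ (1 - n)]
    · rw [show p - (1 - n) = n - 1 + p by ring]
      split_ifs with h1 h2 h2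
      · omega
      · ring
      · subst h2; simp
      · omega
    · intro j hj
      rw [if_neg (by omega), mul_zero]
  | coe z =>
    rw [if_neg (OnePoint.infty_ne_coe z), HahnSeries.coeff_zero, add_zero]
    have h : ∀ j : ℤ, (expandHom OnePoint.infty (cauchyCoeff (z : CP1) j)).coeff n =
      if j = 0 ∧ n = 1 then -1 else 0 := fun j => coeff_expandHom_infty_cauchyCoeff z j hn
    simp only [h]
    rw [finsum_eq_single _ 0]
    · split_ifs with h1 h2 h2 <;> simp_all
    · intro j hj
      rw [if_neg (by tauto), mul_zero]

/-! ### The rational and the integral part of an adèle concentrated at a point -/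

section RationalPart

variable {N : ℕ}

/-- The factor of the Cauchy kernel `1 / (μ - λ)` in the `r`-matrix: `1` in the rational case and
`λ` in the trigonometric case. The residue pairing uses `dλ` divided by this factor. -/
def RKind.multiplier : RKind → RatFunc ℂ
  | .rational => 1
  | .trigonometric => RatFunc.X

/-- The action of the constant term of the `r`-matrix, written as the Casimir times
`RKind.multiplier / (μ - λ)` plus a constant. In the trigonometric case the constant is
`P₁₂ - P⁻₁₂ - P⁰₁₂ / 2 = P⁺₁₂ + P⁰₁₂ / 2`, because `μ / (μ - λ) = λ / (μ - λ) + 1`. -/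
def RKind.constPart (ρ : RKind) (M : Matrix (Fin N) (Fin N) ℂ) : Matrix (Fin N) (Fin N) ℂ :=
  match ρ with
  | .rational => 0
  | .trigonometric => upperHalf M

/-- The coefficient of `μ_b^q` in `Tr₂ (ι_{μ_b} r₁₂(λ, μ) Y₂(μ_b))`, as a matrix of rational
functions of `λ`. Its expansions are the Lax matrices: see `laxV_eq_lcoeff_ratPartAt`. -/
def ratPart (ρ : RKind) (b : CP1) (q : ℤ) (Y : Matrix (Fin N) (Fin N) (LaurentSeries ℂ)) :
    Matrix (Fin N) (Fin N) (RatFunc ℂ) :=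
  ρ.multiplier • Y.map (cauchyTransform b q) + (ρ.constPart (lcoeff Y q)).map RatFunc.C

/-- The expansion at `a` of `ratPart ρ b q Y`. -/
def ratPartAt (ρ : RKind) (b : CP1) (q : ℤ) (Y : Matrix (Fin N) (Fin N) (LaurentSeries ℂ))
    (a : CP1) : Matrix (Fin N) (Fin N) (LaurentSeries ℂ) :=
  (ratPart ρ b q Y).map (expandHom a)

/-- The residue at `a` of `f dλ` in the rational case and of `f dλ / λ` in the trigonometric case
is the constant term of `weight ρ a * f`. -/
def weight (ρ : RKind) (a : CP1) : LaurentSeries ℂ :=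
  diffCoord a * expandHom a ρ.multiplier⁻¹

/-- A scalar multiple of a matrix. The scalar action is that of the ring of entries on matrices. -/
def scaleMatrix {R : Type*} [CommRing R] (r : R) (Y : Matrix (Fin N) (Fin N) R) :
    Matrix (Fin N) (Fin N) R :=
  r • Y

theorem scaleMatrix_apply {R : Type*} [CommRing R] (r : R) (Y : Matrix (Fin N) (Fin N) R)
    (i j : Fin N) : scaleMatrix r Y i j = r * Y i j := rfl

theorem mul_scaleMatrix {R : Type*} [CommRing R] (r : R) (X Y : Matrix (Fin N) (Fin N) R) :
    X * scaleMatrix r Y = scaleMatrix r (X * Y) :=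
  Matrix.mul_smul _ _ _

theorem scaleMatrix_mul {R : Type*} [CommRing R] (r : R) (X Y : Matrix (Fin N) (Fin N) R) :
    scaleMatrix r X * Y = scaleMatrix r (X * Y) :=
  Matrix.smul_mul _ _ _

theorem scaleMatrix_scaleMatrix {R : Type*} [CommRing R] (r s : R)
    (X : Matrix (Fin N) (Fin N) R) : scaleMatrix r (scaleMatrix s X) = scaleMatrix (r * s) X :=
  smul_smul _ _ _

theorem trace_scaleMatrix {R : Type*} [CommRing R] (r : R) (X : Matrix (Fin N) (Fin N) R) :
    (scaleMatrix r X).trace = r * X.trace :=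
  Matrix.trace_smul _ _

open scoped Classical in
/-- The adèle concentrated at `a` whose pairing with `X` is the coefficient of `λ_a^p` in
`Tr (X Y)`. -/
def pointAdele (ρ : RKind) (a : CP1) (p : ℤ) (Y : Matrix (Fin N) (Fin N) (LaurentSeries ℂ))
    (z : CP1) : Matrix (Fin N) (Fin N) (LaurentSeries ℂ) :=
  if z = a then scaleMatrix ((weight ρ a)⁻¹ * HahnSeries.single (-p) 1) Y else 0

/-- The integral part of the adèle `pointAdele ρ a p Y`, whose rational part is
`-ratPart ρ a p Y`. -/
def integralPart (ρ : RKind) (a : CP1) (p : ℤ) (Y : Matrix (Fin N) (Fin N) (LaurentSeries ℂ))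
    (z : CP1) : Matrix (Fin N) (Fin N) (LaurentSeries ℂ) :=
  ratPartAt ρ a p Y z + pointAdele ρ a p Y z

theorem RKind.multiplier_ne_zero (ρ : RKind) : ρ.multiplier ≠ 0 := by
  cases ρ
  · exact one_ne_zero
  · exact RatFunc.X_ne_zero

theorem diffCoord_ne_zero (a : CP1) : diffCoord a ≠ 0 := by
  induction a using OnePoint.rec with
  | infty => exact HahnSeries.single_ne_zero (by norm_num)
  | coe z => exact HahnSeries.single_ne_zero one_ne_zero

theorem weight_ne_zero (ρ : RKind) (a : CP1) : weight ρ a ≠ 0 :=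
  mul_ne_zero (diffCoord_ne_zero a)
    ((map_ne_zero (expandHom a)).2 (inv_ne_zero ρ.multiplier_ne_zero))

theorem integralPart_apply (ρ : RKind) (a : CP1) (p : ℤ)
    (Y : Matrix (Fin N) (Fin N) (LaurentSeries ℂ)) (z : CP1) (i j : Fin N) :
    integralPart ρ a p Y z i j = expandHom z ρ.multiplier * cauchyIntegral a p (Y i j) z +
      HahnSeries.C (ρ.constPart (lcoeff Y p) i j) := by
  have h : (weight ρ a)⁻¹ = expandHom a ρ.multiplier * (diffCoord a)⁻¹ := by
    rw [weight, mul_inv, map_inv₀, inv_inv, mul_comm]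
  simp only [integralPart, ratPartAt, ratPart, pointAdele, cauchyIntegral, Matrix.add_apply,
    Matrix.map_apply, Matrix.smul_apply, smul_eq_mul, map_add, map_mul, expandHom_C]
  by_cases hz : z = a
  · subst hz
    simp only [if_true, scaleMatrix_apply, h, shiftAt]
    ring
  · simp only [if_neg hz, Matrix.zero_apply]
    ring

theorem integralPart_rational (a : CP1) (p : ℤ) (Y : Matrix (Fin N) (Fin N) (LaurentSeries ℂ))
    (z : CP1) (i j : Fin N) :
    integralPart .rational a p Y z i j = cauchyIntegral a p (Y i j) z := by
  rw [integralPart_apply]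
  simp [RKind.multiplier, RKind.constPart]

theorem vanishesBelow_integralPart_rational_infty (a : CP1) (p : ℤ)
    (Y : Matrix (Fin N) (Fin N) (LaurentSeries ℂ)) :
    VanishesBelow 1 (integralPart .rational a p Y OnePoint.infty) := by
  intro i j n hn
  rw [integralPart_rational, coeff_cauchyIntegral_infty _ _ _ hn.le, if_neg hn.ne]

theorem coeff_integralPart_trigonometric_coe (a : CP1) (p : ℤ)
    (Y : Matrix (Fin N) (Fin N) (LaurentSeries ℂ)) (z : ℂ) (i j : Fin N) (n : ℤ) :
    (integralPart .trigonometric a p Y (OnePoint.some z) i j).coeff n =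
      z * (cauchyIntegral a p (Y i j) (OnePoint.some z)).coeff n +
        (cauchyIntegral a p (Y i j) (OnePoint.some z)).coeff (n - 1) +
        if n = 0 then upperHalf (lcoeff Y p) i j else 0 := by
  rw [integralPart_apply]
  have : globalCoord (OnePoint.some z) = (HahnSeries.C z + HahnSeries.single 1 1 :
    LaurentSeries ℂ) := rfl
  simp only [RKind.multiplier, RKind.constPart, expandHom_X, HahnSeries.coeff_add]
  rw [this, add_mul, HahnSeries.coeff_add, HahnSeries.C_mul_eq_smul, HahnSeries.coeff_smul,
    HahnSeries.coeff_single_mul, one_mul, HahnSeries.C_apply, HahnSeries.coeff_single, smul_eq_mul]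
  split_ifs <;> rfl

theorem coeff_integralPart_trigonometric_infty (a : CP1) (p : ℤ)
    (Y : Matrix (Fin N) (Fin N) (LaurentSeries ℂ)) (i j : Fin N) (n : ℤ) :
    (integralPart .trigonometric a p Y OnePoint.infty i j).coeff n =
      (cauchyIntegral a p (Y i j) OnePoint.infty).coeff (n + 1) +
        if n = 0 then upperHalf (lcoeff Y p) i j else 0 := by
  rw [integralPart_apply]
  simp only [RKind.multiplier, RKind.constPart, expandHom_X, HahnSeries.coeff_add]
  rw [globalCoord_infty, HahnSeries.coeff_single_mul, one_mul, HahnSeries.C_apply,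
    HahnSeries.coeff_single, sub_neg_eq_add]
  split_ifs <;> rfl

/-- The integral part has no pole at any point. -/
theorem vanishesBelow_integralPart (ρ : RKind) (a : CP1) (p : ℤ)
    (Y : Matrix (Fin N) (Fin N) (LaurentSeries ℂ)) (z : CP1) :
    VanishesBelow 0 (integralPart ρ a p Y z) := by
  cases ρ with
  | rational =>
    induction z using OnePoint.rec with
    | infty => exact (vanishesBelow_integralPart_rational_infty a p Y).mono (by norm_num)
    | coe z =>
      intro i j n hn
      rw [integralPart_rational]
      exact coeff_cauchyIntegral_coe a p (Y i j) z hn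
  | trigonometric =>
    induction z using OnePoint.rec with
    | infty =>
      intro i j n hn
      rw [coeff_integralPart_trigonometric_infty, coeff_cauchyIntegral_infty _ _ _ (by omega),
        if_neg (by omega), if_neg (by omega), add_zero]
    | coe z =>
      intro i j n hn
      have h1 := coeff_integralPart_trigonometric_coe a p Y z i j n
      rw [coeff_cauchyIntegral_coe _ _ _ _ hn, coeff_cauchyIntegral_coe _ _ _ _ (by omega),
        if_neg hn.ne] at h1
      exact h1.trans (by ring)

theorem lcoeff_integralPart_zero (a : CP1) (p : ℤ)
    (Y : Matrix (Fin N) (Fin N) (LaurentSeries ℂ)) :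
    lcoeff (integralPart .trigonometric a p Y (OnePoint.some 0)) 0 = upperHalf (lcoeff Y p) := by
  ext i j
  rw [lcoeff, Matrix.map_apply, coeff_integralPart_trigonometric_coe,
    coeff_cauchyIntegral_coe _ _ _ _ (n := 0 - 1) (by norm_num)]
  simp

theorem lcoeff_integralPart_infty (a : CP1) (p : ℤ)
    (Y : Matrix (Fin N) (Fin N) (LaurentSeries ℂ)) :
    lcoeff (integralPart .trigonometric a p Y OnePoint.infty) 0 = -lowerHalf (lcoeff Y p) := by
  ext i j
  rw [lcoeff, Matrix.map_apply, coeff_integralPart_trigonometric_infty,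
    coeff_cauchyIntegral_infty _ _ _ (by norm_num), if_pos (by norm_num), if_pos rfl]
  simp only [upperHalf, lowerHalf, Matrix.of_apply, Matrix.neg_apply, lcoeff, Matrix.map_apply]
  rcases lt_trichotomy i j with h | h | h
  · simp [h, h.not_gt, h.ne]
  · simp [h]; ring
  · simp [h, h.not_gt, h.ne']

/-- At a point other than `0` and `∞`, the weight of the trigonometric case vanishes to first
order. -/
theorem coeff_weight_trigonometric {z : ℂ} (hz : z ≠ 0) {n : ℤ} (hn : n < 1) :
    (weight .trigonometric (OnePoint.some z)).coeff n = 0 := by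
  obtain ⟨g, hg⟩ := expandHom_inv_X_sub_C_of_ne hz
  rw [map_zero, sub_zero] at hg
  have : weight .trigonometric (OnePoint.some z) =
    HahnSeries.single 1 1 * HahnSeries.ofPowerSeries ℤ ℂ g := by rw [← hg]; rfl
  rw [this, HahnSeries.coeff_single_mul, coeff_ofPowerSeries_of_neg _ (by omega), mul_zero]

theorem weight_trigonometric_zero : weight .trigonometric (OnePoint.some 0) = 1 := by
  have h : (globalCoord (OnePoint.some 0) : LaurentSeries ℂ) = HahnSeries.single 1 1 := by
    simp [globalCoord]
  rw [weight, map_inv₀]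
  simp only [RKind.multiplier, expandHom_X]
  rw [h]
  exact mul_inv_cancel₀ (HahnSeries.single_ne_zero one_ne_zero)

theorem weight_trigonometric_infty :
    weight .trigonometric OnePoint.infty = HahnSeries.single 0 (-1) := by
  rw [weight, map_inv₀]
  simp only [RKind.multiplier, expandHom_X]
  rw [globalCoord_infty, HahnSeries.inv_single, diffCoord_infty, HahnSeries.single_mul_single]
  simp

theorem weight_rational (a : CP1) : weight .rational a = diffCoord a := by
  simp [weight, RKind.multiplier]

/-- An adèle without poles has no residue at a point where the differential is holomorphic. -/
theorem coeff_weight_mul_trace (ρ : RKind) {z : CP1}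
    (hz : ρ = .rational ∨ (z ≠ OnePoint.some 0 ∧ z ≠ OnePoint.infty))
    {X : Matrix (Fin N) (Fin N) (LaurentSeries ℂ)} (h0 : VanishesBelow 0 X)
    (h2 : ρ = .rational → z = OnePoint.infty → VanishesBelow 2 X) :
    (weight ρ z * X.trace).coeff 0 = 0 := by
  cases ρ with
  | rational =>
    rw [weight_rational]
    induction z using OnePoint.rec with
    | infty =>
      rw [diffCoord_infty, HahnSeries.coeff_single_mul, (h2 rfl rfl).coeff_trace (by norm_num),
        mul_zero]
    | coe z =>
      rw [diffCoord_coe, HahnSeries.coeff_single_mul, h0.coeff_trace (by norm_num), mul_zero]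
  | trigonometric =>
    obtain ⟨h, h'⟩ := hz.resolve_left (by simp)
    obtain ⟨z, rfl⟩ := OnePoint.ne_infty_iff_exists.1 h'
    refine coeff_mul_eq_zero (fun n hn => coeff_weight_trigonometric (fun h0 => h ?_) hn)
      (fun n hn => h0.coeff_trace hn) (by norm_num)
    rw [h0]

end RationalPart

/-! ### Triangular matrices -/

section Triangular

variable {N : ℕ}

theorem mul_apply_self_of_triangular {A B : Matrix (Fin N) (Fin N) ℂ}
    (hA : ∀ i j, j < i → A i j = 0) (hB : ∀ i j, j < i → B i j = 0) (i : Fin N) :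
    (A * B) i i = A i i * B i i := by
  rw [Matrix.mul_apply, Finset.sum_eq_single i]
  · intro k _ hk
    rcases lt_or_gt_of_ne hk with h | h
    · rw [hA i k h, zero_mul]
    · rw [hB k i h, mul_zero]
  · simp

theorem mul_triangular {A B : Matrix (Fin N) (Fin N) ℂ}
    (hA : ∀ i j, j < i → A i j = 0) (hB : ∀ i j, j < i → B i j = 0) (i j : Fin N) (hij : j < i) :
    (A * B) i j = 0 := by
  rw [Matrix.mul_apply]
  refine Finset.sum_eq_zero fun k _ => ?_
  rcases lt_or_ge k i with h | h
  · rw [hA i k h, zero_mul]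
  · rw [hB k j (hij.trans_le h), mul_zero]

theorem trace_commutator_mul_of_triangular {A B C : Matrix (Fin N) (Fin N) ℂ}
    (hA : ∀ i j, j < i → A i j = 0) (hB : ∀ i j, j < i → B i j = 0)
    (hC : ∀ i j, j < i → C i j = 0) : ((A * B - B * A) * C).trace = 0 := by
  rw [sub_mul, Matrix.trace_sub, sub_eq_zero]
  refine Finset.sum_congr rfl fun i _ => ?_
  simp only [Matrix.diag_apply]
  rw [mul_apply_self_of_triangular (mul_triangular hA hB) hC,
    mul_apply_self_of_triangular (mul_triangular hB hA) hC, mul_apply_self_of_triangular hA hB,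
    mul_apply_self_of_triangular hB hA, mul_comm (A i i)]

theorem upperHalf_apply_of_lt (A : Matrix (Fin N) (Fin N) ℂ) (i j : Fin N) (h : j < i) :
    upperHalf A i j = 0 := by
  simp [upperHalf, h.not_gt, h.ne']

theorem transpose_lowerHalf (A : Matrix (Fin N) (Fin N) ℂ) :
    (lowerHalf A).transpose = upperHalf A.transpose := by
  ext i j
  simp only [lowerHalf, upperHalf, Matrix.transpose_apply, Matrix.of_apply, eq_comm]

theorem trace_commutator_mul_upperHalf (A B C : Matrix (Fin N) (Fin N) ℂ) :
    ((upperHalf A * upperHalf B - upperHalf B * upperHalf A) * upperHalf C).trace = 0 :=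
  trace_commutator_mul_of_triangular (upperHalf_apply_of_lt A) (upperHalf_apply_of_lt B)
    (upperHalf_apply_of_lt C)

theorem trace_commutator_mul_lowerHalf (A B C : Matrix (Fin N) (Fin N) ℂ) :
    ((lowerHalf A * lowerHalf B - lowerHalf B * lowerHalf A) * lowerHalf C).trace = 0 := by
  rw [← Matrix.trace_transpose]
  simp only [Matrix.transpose_mul, Matrix.transpose_sub, transpose_lowerHalf]
  rw [Matrix.trace_mul_comm, ← neg_sub, neg_mul, Matrix.trace_neg, trace_commutator_mul_upperHalf,
    neg_zero]

theorem trace_lowerHalf_mul_lowerHalf (A B : Matrix (Fin N) (Fin N) ℂ) :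
    (lowerHalf A * lowerHalf B).trace = (upperHalf A * upperHalf B).trace := by
  rw [← Matrix.trace_transpose, Matrix.transpose_mul, transpose_lowerHalf, transpose_lowerHalf,
    Matrix.trace_mul_comm]
  refine Finset.sum_congr rfl fun i _ => ?_
  simp only [Matrix.diag_apply]
  rw [mul_apply_self_of_triangular (upperHalf_apply_of_lt _) (upperHalf_apply_of_lt _),
    mul_apply_self_of_triangular (upperHalf_apply_of_lt _) (upperHalf_apply_of_lt _)]
  simp [upperHalf]

end Triangular

/-! ### Skew-symmetry and the closure relation -/

section Closure

variable {N : ℕ}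

theorem lcoeff_integralPart_mul (ρ : RKind) (a b : CP1) (p q : ℤ)
    (X Y : Matrix (Fin N) (Fin N) (LaurentSeries ℂ)) (z : CP1) :
    lcoeff (integralPart ρ a p X z * integralPart ρ b q Y z) 0 =
      lcoeff (integralPart ρ a p X z) 0 * lcoeff (integralPart ρ b q Y z) 0 := by
  simpa using lcoeff_mul_lowest (vanishesBelow_integralPart ρ a p X z)
    (vanishesBelow_integralPart ρ b q Y z)

/-- The commutator of two integral adèles is orthogonal to all integral adèles: at `0` and `∞`, in
the trigonometric case, because the constant terms are triangular. -/
theorem coeff_weight_mul_trace_commutator_integralPart (ρ : RKind) (a b c : CP1) (p q s : ℤ)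
    (X Y Z : Matrix (Fin N) (Fin N) (LaurentSeries ℂ)) (z : CP1) :
    (weight ρ z * ((integralPart ρ a p X z * integralPart ρ b q Y z -
      integralPart ρ b q Y z * integralPart ρ a p X z) * integralPart ρ c s Z z).trace).coeff 0 =
      0 := by
  have hX := vanishesBelow_integralPart ρ a p X z
  have hY := vanishesBelow_integralPart ρ b q Y z
  have hZ := vanishesBelow_integralPart ρ c s Z z
  have h0 : VanishesBelow 0 ((integralPart ρ a p X z * integralPart ρ b q Y z -
      integralPart ρ b q Y z * integralPart ρ a p X z) * integralPart ρ c s Z z) := by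
    simpa using (VanishesBelow.sub (hX.mul hY) (hY.mul hX)).mul hZ
  by_cases hz : ρ = .rational ∨ (z ≠ OnePoint.some 0 ∧ z ≠ OnePoint.infty)
  · refine coeff_weight_mul_trace ρ hz h0 ?_
    rintro rfl rfl
    have hX := vanishesBelow_integralPart_rational_infty a p X
    have hY := vanishesBelow_integralPart_rational_infty b q Y
    have hZ := vanishesBelow_integralPart_rational_infty c s Z
    exact ((VanishesBelow.sub (hX.mul hY) (hY.mul hX)).mul hZ).mono (by norm_num)
  · push Not at hz
    obtain ⟨hρ, hz⟩ := hz
    obtain rfl : ρ = .trigonometric := by cases ρ <;> simp_all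
    have key : lcoeff ((integralPart .trigonometric a p X z * integralPart .trigonometric b q Y z -
        integralPart .trigonometric b q Y z * integralPart .trigonometric a p X z) *
        integralPart .trigonometric c s Z z) 0 =
        (lcoeff (integralPart .trigonometric a p X z) 0 *
          lcoeff (integralPart .trigonometric b q Y z) 0 -
          lcoeff (integralPart .trigonometric b q Y z) 0 *
          lcoeff (integralPart .trigonometric a p X z) 0) *
          lcoeff (integralPart .trigonometric c s Z z) 0 := by
      have := lcoeff_mul_lowest (VanishesBelow.sub (hX.mul hY) (hY.mul hX)) hZ
      simpa [lcoeff_sub, lcoeff_integralPart_mul] using this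
    by_cases h : z = OnePoint.some 0
    · subst h
      rw [weight_trigonometric_zero, one_mul, coeff_trace_eq, key]
      simp only [lcoeff_integralPart_zero]
      exact trace_commutator_mul_upperHalf _ _ _
    · obtain rfl := hz h
      rw [weight_trigonometric_infty, HahnSeries.coeff_single_zero_mul, coeff_trace_eq, key]
      have h (A B C : Matrix (Fin N) (Fin N) ℂ) :
          ((-A * -B - -B * -A) * -C).trace = -((A * B - B * A) * C).trace := by
        rw [neg_mul_neg, neg_mul_neg, mul_neg, Matrix.trace_neg]
      rw [lcoeff_integralPart_infty, lcoeff_integralPart_infty, lcoeff_integralPart_infty, h,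
        trace_commutator_mul_lowerHalf, neg_zero, mul_zero]

/-- The integral adèles are isotropic: in the trigonometric case the contributions of `0` and `∞`
cancel. -/
theorem sum_coeff_weight_mul_trace_integralPart (ρ : RKind) (a b : CP1) (p q : ℤ)
    (X Y : Matrix (Fin N) (Fin N) (LaurentSeries ℂ)) {T : Finset CP1}
    (h0 : OnePoint.some 0 ∈ T) (hinf : OnePoint.infty ∈ T) :
    ∑ z ∈ T, (weight ρ z * (integralPart ρ b q Y z * integralPart ρ a p X z).trace).coeff 0 =
      0 := by
  have hv : ∀ z, VanishesBelow 0 (integralPart ρ b q Y z * integralPart ρ a p X z) := fun z => by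
    simpa using (vanishesBelow_integralPart ρ b q Y z).mul (vanishesBelow_integralPart ρ a p X z)
  cases ρ with
  | rational =>
    refine Finset.sum_eq_zero fun z _ => coeff_weight_mul_trace _ (Or.inl rfl) (hv z) ?_
    rintro - rfl
    exact (vanishesBelow_integralPart_rational_infty b q Y).mul
      (vanishesBelow_integralPart_rational_infty a p X)
  | trigonometric =>
    rw [Finset.sum_eq_add_of_mem _ _ h0 hinf (OnePoint.coe_ne_infty 0)]
    · rw [weight_trigonometric_zero, weight_trigonometric_infty, one_mul,
        HahnSeries.coeff_single_zero_mul, neg_one_mul, coeff_trace_eq, coeff_trace_eq,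
        lcoeff_integralPart_mul, lcoeff_integralPart_mul]
      simp only [lcoeff_integralPart_zero, lcoeff_integralPart_infty, neg_mul_neg]
      rw [trace_lowerHalf_mul_lowerHalf, add_neg_cancel]
    · exact fun z _ hz => coeff_weight_mul_trace _ (Or.inr hz) (hv z) (by simp)

theorem coeff_weight_mul_trace_pointAdele (ρ : RKind) (c : CP1) (s : ℤ)
    (X Z : Matrix (Fin N) (Fin N) (LaurentSeries ℂ)) :
    (weight ρ c * (X * pointAdele ρ c s Z c).trace).coeff 0 = (X * Z).trace.coeff s := by
  rw [pointAdele, if_pos rfl, mul_scaleMatrix, trace_scaleMatrix, ← mul_assoc,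
    ← mul_assoc, mul_inv_cancel₀ (weight_ne_zero ρ c), one_mul, HahnSeries.coeff_single_mul]
  simp

theorem sum_coeff_weight_mul_trace_pointAdele (ρ : RKind) (c : CP1) (s : ℤ)
    (X : CP1 → Matrix (Fin N) (Fin N) (LaurentSeries ℂ))
    (Z : Matrix (Fin N) (Fin N) (LaurentSeries ℂ)) {T : Finset CP1} (hc : c ∈ T) :
    ∑ z ∈ T, (weight ρ z * (X z * pointAdele ρ c s Z z).trace).coeff 0 =
      (X c * Z).trace.coeff s := by
  rw [Finset.sum_eq_single_of_mem c hc, coeff_weight_mul_trace_pointAdele]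
  intro z _ hz
  rw [pointAdele, if_neg hz, mul_zero, Matrix.trace_zero, mul_zero, HahnSeries.coeff_zero]

theorem commute_pointAdele (ρ : RKind) {a b : CP1} (p q : ℤ)
    {X Y : Matrix (Fin N) (Fin N) (LaurentSeries ℂ)} (h : a = b → X * Y = Y * X) (z : CP1) :
    pointAdele ρ a p X z * pointAdele ρ b q Y z = pointAdele ρ b q Y z * pointAdele ρ a p X z := by
  rw [pointAdele, pointAdele]
  split_ifs with h1 h2
  · simp only [mul_scaleMatrix, scaleMatrix_mul, scaleMatrix_scaleMatrix,
      h (h1.symm.trans h2)]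
    rw [mul_comm]
  all_goals simp

theorem weight_mul_trace_map (ρ : RKind) (A : Matrix (Fin N) (Fin N) (RatFunc ℂ)) (z : CP1) :
    weight ρ z * (A.map (expandHom z)).trace =
      diffCoord z * expandHom z (ρ.multiplier⁻¹ * A.trace) := by
  rw [weight, map_mul, mul_assoc, Matrix.trace, Matrix.trace, map_sum]
  rfl

theorem trace_commutator_mul_cyclic {R : Type*} [CommRing R] (A B C : Matrix (Fin N) (Fin N) R) :
    ((A * B - B * A) * C).trace = ((B * C - C * B) * A).trace := by
  rw [sub_mul, sub_mul, Matrix.trace_sub, Matrix.trace_sub, Matrix.trace_mul_cycle B C A,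
    Matrix.trace_mul_cycle B A C]

theorem trace_commutator_mul_add {R : Type*} [CommRing R]
    (V₁ V₂ V₃ X₁ X₂ X₃ : Matrix (Fin N) (Fin N) R)
    (h₁₂ : X₁ * X₂ = X₂ * X₁) (h₂₃ : X₂ * X₃ = X₃ * X₂) (h₃₁ : X₃ * X₁ = X₁ * X₃) :
    (((V₁ + X₁) * (V₂ + X₂) - (V₂ + X₂) * (V₁ + X₁)) * (V₃ + X₃)).trace =
      ((V₁ * V₂ - V₂ * V₁) * V₃).trace + (((V₂ * V₃ - V₃ * V₂) * X₁).trace +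
        ((V₃ * V₁ - V₁ * V₃) * X₂).trace + ((V₁ * V₂ - V₂ * V₁) * X₃).trace) := by
  have e : ((V₁ + X₁) * (V₂ + X₂) - (V₂ + X₂) * (V₁ + X₁)) * (V₃ + X₃) =
      (V₁ * V₂ - V₂ * V₁) * V₃ + (V₁ * V₂ - V₂ * V₁) * X₃ + (V₁ * X₂ - X₂ * V₁) * V₃ +
      (X₁ * V₂ - V₂ * X₁) * V₃ + (V₁ * X₂ - X₂ * V₁) * X₃ + (X₁ * V₂ - V₂ * X₁) * X₃ +
      (X₁ * X₂ - X₂ * X₁) * (V₃ + X₃) := by noncomm_ring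
  rw [e]
  simp only [Matrix.trace_add]
  rw [h₁₂, sub_self, zero_mul, Matrix.trace_zero, trace_commutator_mul_cyclic V₁ X₂ X₃, h₂₃,
    sub_self, zero_mul, Matrix.trace_zero, ← trace_commutator_mul_cyclic X₃ X₁ V₂, h₃₁,
    sub_self, zero_mul, Matrix.trace_zero, trace_commutator_mul_cyclic X₁ V₂ V₃,
    ← trace_commutator_mul_cyclic V₃ V₁ X₂]
  ring

theorem map_expandHom_mul (A B : Matrix (Fin N) (Fin N) (RatFunc ℂ)) (z : CP1) :
    (A * B).map (expandHom z) = A.map (expandHom z) * B.map (expandHom z) :=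
  Matrix.map_mul

theorem map_expandHom_sub (A B : Matrix (Fin N) (Fin N) (RatFunc ℂ)) (z : CP1) :
    (A - B).map (expandHom z) = A.map (expandHom z) - B.map (expandHom z) :=
  Matrix.map_sub _ (map_sub _) _ _

/-- The closure relation for the rational projections of three commuting families. It combines
three facts: rational adèles form a Lie algebra without residues, integral adèles likewise, and
the adèles concentrated at points commute. -/
theorem closure_ratPartAt (ρ : RKind) (a b c : CP1) (p q s : ℤ)
    (X Y Z : Matrix (Fin N) (Fin N) (LaurentSeries ℂ))
    (hab : a = b → X * Y = Y * X) (hbc : b = c → Y * Z = Z * Y) (hca : c = a → Z * X = X * Z) :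
    ((ratPartAt ρ b q Y a * ratPartAt ρ c s Z a -
        ratPartAt ρ c s Z a * ratPartAt ρ b q Y a) * X).trace.coeff p +
      ((ratPartAt ρ c s Z b * ratPartAt ρ a p X b -
        ratPartAt ρ a p X b * ratPartAt ρ c s Z b) * Y).trace.coeff q +
      ((ratPartAt ρ a p X c * ratPartAt ρ b q Y c -
        ratPartAt ρ b q Y c * ratPartAt ρ a p X c) * Z).trace.coeff s = 0 := by
  classical
  obtain ⟨T₀, hT₀⟩ := residueSumVanishes (ρ.multiplier⁻¹ *
    ((ratPart ρ a p X * ratPart ρ b q Y - ratPart ρ b q Y * ratPart ρ a p X) *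
      ratPart ρ c s Z).trace)
  set T := T₀ ∪ {a, b, c} with hT
  have h1 := hT₀ T Finset.subset_union_left
  simp only [← weight_mul_trace_map, map_expandHom_mul, map_expandHom_sub] at h1
  rw [← sum_coeff_weight_mul_trace_pointAdele ρ a p (fun z => ratPartAt ρ b q Y z *
      ratPartAt ρ c s Z z - ratPartAt ρ c s Z z * ratPartAt ρ b q Y z) X (T := T) (by simp [hT]),
    ← sum_coeff_weight_mul_trace_pointAdele ρ b q (fun z => ratPartAt ρ c s Z z *
      ratPartAt ρ a p X z - ratPartAt ρ a p X z * ratPartAt ρ c s Z z) Y (T := T) (by simp [hT]),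
    ← sum_coeff_weight_mul_trace_pointAdele ρ c s (fun z => ratPartAt ρ a p X z *
      ratPartAt ρ b q Y z - ratPartAt ρ b q Y z * ratPartAt ρ a p X z) Z (T := T) (by simp [hT]),
    ← Finset.sum_add_distrib, ← Finset.sum_add_distrib]
  have h2 := Finset.sum_congr (rfl : T = T) fun z (_ : z ∈ T) =>
    coeff_weight_mul_trace_commutator_integralPart ρ a b c p q s X Y Z z
  have h3 := fun z => trace_commutator_mul_add (ratPartAt ρ a p X z) (ratPartAt ρ b q Y z)
    (ratPartAt ρ c s Z z) _ _ _ (commute_pointAdele ρ p q hab z)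
    (commute_pointAdele ρ q s hbc z) (commute_pointAdele ρ s p hca z)
  simp only [integralPart, h3] at h2
  rw [Finset.sum_const_zero] at h2
  simp only [mul_add (weight ρ _), HahnSeries.coeff_add] at h2
  rw [Finset.sum_add_distrib] at h2
  exact (eq_neg_of_add_eq_zero_right h2).trans (neg_eq_zero.2 h1)

/-- The skew-symmetry of the `r`-matrix: the difference between the two orders of expansion is a
delta distribution times the tensor Casimir, which is invisible if `Tr (X Y) = 0` when `a = b`. -/
theorem skew_ratPartAt (ρ : RKind) (a b : CP1) (p q : ℤ)
    (X Y : Matrix (Fin N) (Fin N) (LaurentSeries ℂ)) (h : a = b → (X * Y).trace = 0) :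
    (ratPartAt ρ b q Y a * X).trace.coeff p + (ratPartAt ρ a p X b * Y).trace.coeff q = 0 := by
  classical
  obtain ⟨T₀, hT₀⟩ := residueSumVanishes (ρ.multiplier⁻¹ *
    (ratPart ρ b q Y * ratPart ρ a p X).trace)
  set T := T₀ ∪ {a, b, OnePoint.some 0, OnePoint.infty} with hT
  have h1 := hT₀ T Finset.subset_union_left
  simp only [← weight_mul_trace_map, map_expandHom_mul] at h1
  have h2 := sum_coeff_weight_mul_trace_integralPart ρ a b p q X Y (T := T) (by simp [hT])
    (by simp [hT])
  have h3 : ∀ z, (integralPart ρ b q Y z * integralPart ρ a p X z).trace =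
      (ratPartAt ρ b q Y z * ratPartAt ρ a p X z).trace +
        ((ratPartAt ρ b q Y z * pointAdele ρ a p X z).trace +
        (ratPartAt ρ a p X z * pointAdele ρ b q Y z).trace) := by
    intro z
    have h4 : (pointAdele ρ b q Y z * pointAdele ρ a p X z).trace = 0 := by
      rw [pointAdele, pointAdele]
      split_ifs with h1 h2
      · rw [mul_scaleMatrix, scaleMatrix_mul, trace_scaleMatrix, trace_scaleMatrix,
          Matrix.trace_mul_comm, h (h2.symm.trans h1), mul_zero, mul_zero]
      all_goals simp
    rw [integralPart, integralPart, add_mul, mul_add, mul_add]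
    simp only [Matrix.trace_add]
    rw [h4, Matrix.trace_mul_comm (pointAdele ρ b q Y z)]
    ring
  simp only [h3, mul_add, HahnSeries.coeff_add] at h2
  rw [Finset.sum_add_distrib] at h2
  rw [← sum_coeff_weight_mul_trace_pointAdele ρ a p (fun z => ratPartAt ρ b q Y z) X (T := T)
      (by simp [hT]),
    ← sum_coeff_weight_mul_trace_pointAdele ρ b q (fun z => ratPartAt ρ a p X z) Y (T := T)
      (by simp [hT]), ← Finset.sum_add_distrib]
  exact (eq_neg_of_add_eq_zero_right h2).trans (neg_eq_zero.2 h1)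

end Closure

/-! ### The `r`-matrices -/

section RMatrix

/-- The series with coefficients `cauchyCoeff b j` is inverse to the expansion of `μ - λ`. -/
theorem exists_mul_eq_one_expandHom_sub (b : CP1) :
    ∃ S : LaurentSeries (RatFunc ℂ), (∀ j, S.coeff j = cauchyCoeff b j) ∧
      expandHom b (RatFunc.X - RatFunc.C (RatFunc.X : RatFunc ℂ) : RatFunc (RatFunc ℂ)) * S =
        1 := by
  induction b using OnePoint.rec with
  | infty =>
    refine ⟨HahnSeries.single 1 1 * HahnSeries.ofPowerSeries ℤ _
      (PowerSeries.mk fun n => RatFunc.X ^ n), fun j => ?_, ?_⟩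
    · rw [HahnSeries.coeff_single_mul, one_mul, PowerSeries.coeff_coe]
      by_cases hj : 1 ≤ j
      · rw [if_neg (by omega), PowerSeries.coeff_mk]
        simp only [cauchyCoeff, if_pos hj]
        congr 1
        omega
      · rw [if_pos (by omega)]
        exact (if_neg hj).symm
    · have h : expandHom OnePoint.infty
          (RatFunc.X - RatFunc.C (RatFunc.X : RatFunc ℂ) : RatFunc (RatFunc ℂ)) =
          HahnSeries.single (-1) 1 * HahnSeries.ofPowerSeries ℤ _
            (1 - PowerSeries.C RatFunc.X * PowerSeries.X) := by
        rw [map_sub, expandHom_X, expandHom_C]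
        simp [globalCoord, mul_sub, HahnSeries.C_apply]
      have h2 : (1 - PowerSeries.C RatFunc.X * PowerSeries.X : (RatFunc ℂ)⟦X⟧) *
          (PowerSeries.mk fun n => RatFunc.X ^ n) = 1 := by
        ext n
        rw [sub_mul, one_mul, map_sub, mul_assoc, PowerSeries.coeff_C_mul]
        cases n with
        | zero => simp
        | succ n =>
          rw [PowerSeries.coeff_succ_X_mul, PowerSeries.coeff_mk, PowerSeries.coeff_mk,
            PowerSeries.coeff_one, if_neg (Nat.succ_ne_zero n), pow_succ']
          ring
      rw [h, mul_mul_mul_comm, ← map_mul, h2, HahnSeries.single_mul_single]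
      simp
  | coe z =>
    set c : RatFunc ℂ := RatFunc.X - RatFunc.C z with hc
    have hc0 : c ≠ 0 := X_sub_C_ne_zero z
    refine ⟨HahnSeries.ofPowerSeries ℤ _ (PowerSeries.mk fun n => -(c⁻¹) ^ (n + 1)),
      fun j => ?_, ?_⟩
    · rw [PowerSeries.coeff_coe]
      by_cases hj : 0 ≤ j
      · rw [if_neg (by omega), PowerSeries.coeff_mk]
        simp only [cauchyCoeff, if_pos hj]
        congr 3
        omega
      · rw [if_pos (by omega)]
        exact (if_neg hj).symm
    · have h : expandHom (OnePoint.some z)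
          (RatFunc.X - RatFunc.C (RatFunc.X : RatFunc ℂ) : RatFunc (RatFunc ℂ)) =
          HahnSeries.ofPowerSeries ℤ _ (PowerSeries.X - PowerSeries.C c) := by
        rw [map_sub, expandHom_X, expandHom_C]
        simp [globalCoord, hc, RatFunc.algebraMap_eq_C]
        ring
      have h2 : (PowerSeries.X - PowerSeries.C c : (RatFunc ℂ)⟦X⟧) *
          (PowerSeries.mk fun n => -(c⁻¹) ^ (n + 1)) = 1 := by
        ext n
        rw [sub_mul, map_sub, PowerSeries.coeff_C_mul]
        cases n with
        | zero => simp [hc0]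
        | succ n =>
          rw [PowerSeries.coeff_succ_X_mul, PowerSeries.coeff_mk, PowerSeries.coeff_mk,
            PowerSeries.coeff_one, if_neg (Nat.succ_ne_zero n), pow_succ' c⁻¹ (n + 1)]
          field_simp
          ring
      rw [h, ← map_mul, h2, map_one]

/-- The expansion of the Cauchy kernel `1 / (μ - λ)` in `μ`. -/
theorem coeff_expandHom_cauchy (b : CP1) (j : ℤ) :
    (expandHom b
      ((RatFunc.X - RatFunc.C (RatFunc.X : RatFunc ℂ) : RatFunc (RatFunc ℂ))⁻¹)).coeff j =
      cauchyCoeff b j := by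
  obtain ⟨S, hS, h⟩ := exists_mul_eq_one_expandHom_sub b
  rw [map_inv₀, inv_eq_of_mul_eq_one_right h, hS]

variable {N : ℕ}

theorem casimir_map {K L : Type*} [Field K] [Field L] (f : K →+* L) (g : LieKind)
    (x y : Fin N × Fin N) : casimir L N g x y = f (casimir K N g x y) := by
  cases g <;>
  simp [casimir, Matrix.sum_apply, Matrix.single_apply, apply_ite f, Matrix.one_apply]

theorem casimirZero_map {K L : Type*} [Field K] [Field L] (f : K →+* L) (g : LieKind)
    (x y : Fin N × Fin N) : casimirZero L N g x y = f (casimirZero K N g x y) := by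
  cases g <;>
  simp [casimirZero, Matrix.sum_apply, Matrix.single_apply, apply_ite f, Matrix.one_apply]

theorem casimirMinus_map {K L : Type*} [Field K] [Field L] (f : K →+* L)
    (x y : Fin N × Fin N) : casimirMinus L N x y = f (casimirMinus K N x y) := by
  simp only [casimirMinus, Matrix.sum_apply, map_sum]
  refine Finset.sum_congr rfl fun i _ => Finset.sum_congr rfl fun j _ => ?_
  split_ifs <;> simp [Matrix.single_apply, apply_ite f]

theorem trTwo_mul_apply (M : Matrix (Fin N × Fin N) (Fin N × Fin N) ℂ)
    (Y : Matrix (Fin N) (Fin N) ℂ) (i j : Fin N) :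
    trTwo (M * ((1 : Matrix (Fin N) (Fin N) ℂ) ⊗ₖ Y)) i j =
      ∑ k, ∑ l, M (i, k) (j, l) * Y l k := by
  simp only [trTwo, Matrix.of_apply, Matrix.mul_apply, Matrix.kroneckerMap_apply,
    Fintype.sum_prod_type, Matrix.one_apply]
  refine Finset.sum_congr rfl fun k _ => ?_
  rw [Finset.sum_eq_single j]
  · simp
  · intro x _ hx
    simp [hx]
  · simp

/-- The full trace through the partial trace. -/
theorem trace_mul_kronecker (M : Matrix (Fin N × Fin N) (Fin N × Fin N) ℂ)
    (X Y : Matrix (Fin N) (Fin N) ℂ) :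
    (M * (X ⊗ₖ (1 : Matrix (Fin N) (Fin N) ℂ)) * ((1 : Matrix (Fin N) (Fin N) ℂ) ⊗ₖ Y)).trace =
      (trTwo (M * ((1 : Matrix (Fin N) (Fin N) ℂ) ⊗ₖ Y)) * X).trace := by
  rw [mul_assoc, ← Matrix.mul_kronecker_mul, one_mul, mul_one]
  simp only [Matrix.trace, Matrix.diag_apply, Matrix.mul_apply, trTwo_mul_apply,
    Fintype.sum_prod_type, Matrix.kroneckerMap_apply, Finset.sum_mul]
  refine Finset.sum_congr rfl fun i _ => ?_
  rw [Finset.sum_comm]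
  refine Finset.sum_congr rfl fun j _ => Finset.sum_congr rfl fun k _ =>
    Finset.sum_congr rfl fun l _ => ?_
  ring

theorem trTwo_add (A B : Matrix (Fin N × Fin N) (Fin N × Fin N) ℂ) :
    trTwo (A + B) = trTwo A + trTwo B := by
  ext i j
  simp [trTwo, Finset.sum_add_distrib]

theorem trTwo_smul (c : ℂ) (A : Matrix (Fin N × Fin N) (Fin N × Fin N) ℂ) :
    trTwo (c • A) = c • trTwo A := by
  ext i j
  simp [trTwo, Finset.mul_sum]

theorem sum_one_apply_mul (Y : Matrix (Fin N) (Fin N) ℂ) (i j : Fin N) :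
    ∑ k, ∑ l, (1 : Matrix (Fin N × Fin N) (Fin N × Fin N) ℂ) (i, k) (j, l) * Y l k =
      if i = j then Y.trace else 0 := by
  by_cases h : i = j <;> simp [Matrix.one_apply, h, Matrix.trace]

/-- The tensor Casimir acts by the identity on traceless matrices (and on all matrices in the case
of `𝔤𝔩_N`). -/
theorem trTwo_casimir (g : LieKind) {Y : Matrix (Fin N) (Fin N) ℂ}
    (hY : g = .sl → Y.trace = 0) :
    trTwo (casimir ℂ N g * ((1 : Matrix (Fin N) (Fin N) ℂ) ⊗ₖ Y)) = Y := by
  have key : ∀ i j, ∑ k, ∑ l, casimir ℂ N .gl (i, k) (j, l) * Y l k = Y i j := by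
    intro i j
    simp only [casimir, Matrix.sum_apply, Matrix.kroneckerMap_apply, Matrix.single_apply]
    rw [Finset.sum_eq_single j, Finset.sum_eq_single i]
    · simp [ite_and]
    · intro l _ hl
      rw [Finset.sum_eq_zero, zero_mul]
      intro x _
      refine Finset.sum_eq_zero fun y _ => ?_
      by_cases h : x = i ∧ y = j
      · rw [h.1, if_neg (fun h' : y = j ∧ i = l => hl h'.2.symm), mul_zero]
      · rw [if_neg h, zero_mul]
    · simp
    · intro k _ hk
      refine Finset.sum_eq_zero fun l _ => ?_
      rw [Finset.sum_eq_zero, zero_mul]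
      intro x _
      refine Finset.sum_eq_zero fun y _ => ?_
      by_cases h : x = i ∧ y = j
      · rw [if_neg (fun h' : y = k ∧ x = l => hk (h'.1.symm.trans h.2)), mul_zero]
      · rw [if_neg h, zero_mul]
    · simp
  ext i j
  rw [trTwo_mul_apply]
  cases g with
  | gl => exact key i j
  | sl =>
    have : ∀ x y, casimir ℂ N .sl x y = casimir ℂ N .gl x y -
      (N : ℂ)⁻¹ * (1 : Matrix (Fin N × Fin N) (Fin N × Fin N) ℂ) x y := fun x y => rfl
    simp only [this, sub_mul, Finset.sum_sub_distrib, key, mul_assoc, ← Finset.mul_sum,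
      sum_one_apply_mul, hY rfl, ite_self, mul_zero, sub_zero]

theorem trTwo_casimirMinus (Y : Matrix (Fin N) (Fin N) ℂ) :
    trTwo (casimirMinus ℂ N * ((1 : Matrix (Fin N) (Fin N) ℂ) ⊗ₖ Y)) =
      Matrix.of fun i j => if j < i then Y i j else 0 := by
  ext i j
  rw [trTwo_mul_apply]
  have h : ∀ k l, casimirMinus ℂ N (i, k) (j, l) = if j < i ∧ k = j ∧ l = i then 1 else 0 := by
    intro k l
    simp only [casimirMinus, Matrix.sum_apply]
    rw [Finset.sum_eq_single j, Finset.sum_eq_single i]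
    · by_cases h : j < i <;> simp [h, Matrix.single_apply, eq_comm]
    · intro y _ hy
      split_ifs <;> simp [Matrix.single_apply, hy]
    · simp
    · intro x _ hx
      refine Finset.sum_eq_zero fun y _ => ?_
      split_ifs <;> simp [Matrix.single_apply, hx]
    · simp
  simp only [h, Matrix.of_apply]
  by_cases hij : j < i
  · simp [hij, ite_and]
  · simp [hij]

theorem trTwo_casimirZero (g : LieKind) {Y : Matrix (Fin N) (Fin N) ℂ}
    (hY : g = .sl → Y.trace = 0) :
    trTwo (casimirZero ℂ N g * ((1 : Matrix (Fin N) (Fin N) ℂ) ⊗ₖ Y)) =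
      Matrix.diagonal fun i => Y i i := by
  have key : ∀ i j, ∑ k, ∑ l, casimirZero ℂ N .gl (i, k) (j, l) * Y l k =
      Matrix.diagonal (fun i => Y i i) i j := by
    intro i j
    have h : ∀ k l, casimirZero ℂ N .gl (i, k) (j, l) =
        if i = j ∧ k = i ∧ l = i then 1 else 0 := by
      intro k l
      simp only [casimirZero, Matrix.sum_apply]
      rw [Finset.sum_eq_single i]
      · by_cases h : i = j
        · subst h; simp [Matrix.single_apply, eq_comm]
        · simp [Matrix.single_apply, h]
      · intro x _ hx
        simp [Matrix.single_apply, hx]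
      · simp
    simp only [h]
    by_cases hij : i = j
    · subst hij; simp [ite_and]
    · simp [hij]
  ext i j
  rw [trTwo_mul_apply]
  cases g with
  | gl => exact key i j
  | sl =>
    have : ∀ x y, casimirZero ℂ N .sl x y = casimirZero ℂ N .gl x y -
      (N : ℂ)⁻¹ * (1 : Matrix (Fin N × Fin N) (Fin N × Fin N) ℂ) x y := fun x y => rfl
    simp only [this, sub_mul, Finset.sum_sub_distrib, key, mul_assoc, ← Finset.mul_sum,
      sum_one_apply_mul, hY rfl, ite_self, mul_zero, sub_zero]

theorem lowerHalf_eq (Y : Matrix (Fin N) (Fin N) ℂ) :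
    lowerHalf Y = (Matrix.of fun i j => if j < i then Y i j else 0) +
      (1 / 2 : ℂ) • Matrix.diagonal fun i => Y i i := by
  ext i j
  simp only [lowerHalf, Matrix.of_apply, Matrix.add_apply, Matrix.smul_apply]
  rcases lt_trichotomy i j with h | h | h
  · simp [h.not_gt, h.ne]
  · subst h; simp; ring
  · simp [h, h.ne']

theorem upperHalf_add_lowerHalf (Y : Matrix (Fin N) (Fin N) ℂ) :
    upperHalf Y + lowerHalf Y = Y := by
  ext i j
  simp only [lowerHalf, upperHalf, Matrix.of_apply, Matrix.add_apply]
  rcases lt_trichotomy i j with h | h | h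
  · simp [h, h.not_gt, h.ne]
  · subst h; simp
  · simp [h, h.ne', h.not_gt]

theorem trace_upperHalf_mul (X Y : Matrix (Fin N) (Fin N) ℂ) :
    (upperHalf X * Y).trace = (lowerHalf Y * X).trace := by
  simp only [Matrix.trace, Matrix.diag_apply, Matrix.mul_apply, upperHalf, lowerHalf,
    Matrix.of_apply]
  rw [Finset.sum_comm]
  refine Finset.sum_congr rfl fun i _ => Finset.sum_congr rfl fun j _ => ?_
  by_cases h : i = j
  · subst h; simp; ring
  · by_cases h' : j < i
    · simp [h', mul_comm]
    · simp [h', h, Ne.symm h]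

/-- The matrix `Tr₂ (r₁₂ Y₂)`, for the coefficient `r₁₂` of `λ_a^i μ_b^j` in
`ι_{λ_a} ι_{μ_b} r₁₂(λ, μ)` (see `trTwo_rLamMu`). -/
def kernelAct (ρ : RKind) (a b : CP1) (i j : ℤ) (Y : Matrix (Fin N) (Fin N) ℂ) :
    Matrix (Fin N) (Fin N) ℂ :=
  (expandHom a (ρ.multiplier * cauchyCoeff b j)).coeff i • Y +
    if i = 0 ∧ j = 0 then ρ.constPart Y else 0

theorem coeff_coeff_expandHom (a b : CP1) (f : RatFunc (RatFunc ℂ)) (c d : ℂ) (i j : ℤ) :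
    (expandHom a ((expandHom b (f * RatFunc.C (RatFunc.C c) + RatFunc.C (RatFunc.C d))).coeff
      j)).coeff i = (expandHom a ((expandHom b f).coeff j)).coeff i * c +
        if i = 0 ∧ j = 0 then d else 0 := by
  rw [map_add, map_mul, expandHom_C, expandHom_C, mul_comm, HahnSeries.C_mul_eq_smul,
    HahnSeries.coeff_add, HahnSeries.coeff_smul, smul_eq_mul, map_add, map_mul, expandHom_C,
    HahnSeries.C_mul_eq_smul, HahnSeries.coeff_add, HahnSeries.coeff_smul, smul_eq_mul,
    HahnSeries.C_apply, HahnSeries.coeff_single, mul_comm c]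
  congr 1
  by_cases hj : j = 0
  · rw [if_pos hj, expandHom_C, HahnSeries.C_apply, HahnSeries.coeff_single]
    by_cases hi : i = 0 <;> simp [hi, hj]
  · simp [hj]

/-- The part of the `r`-matrix that does not depend on the spectral parameters. -/
def rConst (N : ℕ) (g : LieKind) (ρ : RKind) :
    Matrix (Fin N × Fin N) (Fin N × Fin N) ℂ :=
  match ρ with
  | .rational => 0
  | .trigonometric => -casimirMinus ℂ N - (1 / 2 : ℂ) • casimirZero ℂ N g

theorem rMatrix_apply {K : Type*} [Field K] (f : ℂ →+* K) (g : LieKind) (ρ : RKind) (l m : K)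
    (x y : Fin N × Fin N) :
    rMatrix K N g ρ l m x y =
      ((match ρ with | .rational => 1 | .trigonometric => m) * (m - l)⁻¹) *
        f (casimir ℂ N g x y) + f (rConst N g ρ x y) := by
  have h1 := casimir_map (N := N) f g x y
  have h2 := casimirZero_map (N := N) f g x y
  have h3 := casimirMinus_map (N := N) f x y
  cases ρ with
  | rational => simp [rMatrix, rConst, h1]
  | trigonometric =>
    simp only [rMatrix, rConst, Matrix.sub_apply, Matrix.smul_apply, Matrix.neg_apply, h1, h2, h3,
      smul_eq_mul, map_sub, map_neg, map_mul, map_div₀, map_one, map_ofNat]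
    ring

theorem rMatrix_apply' {K : Type*} [Field K] (f : ℂ →+* K) (g : LieKind) (ρ : RKind) (l m : K)
    (x y : Fin N × Fin N) :
    rMatrix K N g ρ l m x y =
      (-((match ρ with | .rational => 1 | .trigonometric => m) * (l - m)⁻¹)) *
        f (casimir ℂ N g x y) + f (rConst N g ρ x y) := by
  rw [rMatrix_apply f, ← neg_sub l m, inv_neg, mul_neg]

theorem trTwo_rConst (g : LieKind) (ρ : RKind) {Y : Matrix (Fin N) (Fin N) ℂ}
    (hY : g = .sl → Y.trace = 0) :
    trTwo (rConst N g ρ * ((1 : Matrix (Fin N) (Fin N) ℂ) ⊗ₖ Y)) =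
      match ρ with
      | .rational => 0
      | .trigonometric => -lowerHalf Y := by
  cases ρ with
  | rational => ext i j; simp [rConst, trTwo]
  | trigonometric =>
    have : rConst N g .trigonometric =
      (-1 : ℂ) • casimirMinus ℂ N + (-(1 / 2 : ℂ)) • casimirZero ℂ N g := by
      rw [neg_one_smul, neg_smul, ← sub_eq_add_neg]; rfl
    simp only
    rw [this, add_mul, smul_mul_assoc, smul_mul_assoc, trTwo_add, trTwo_smul, trTwo_smul,
      trTwo_casimirMinus, trTwo_casimirZero g hY, lowerHalf_eq, neg_smul, neg_smul, one_smul,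
      neg_add]

/-- The partial trace of a multiple of the Casimir plus a constant. -/
theorem trTwo_smul_casimir_add (g : LieKind) {Y : Matrix (Fin N) (Fin N) ℂ}
    (hY : g = .sl → Y.trace = 0) (c : ℂ) (p : Prop) [Decidable p]
    (M : Matrix (Fin N × Fin N) (Fin N × Fin N) ℂ) :
    trTwo ((c • casimir ℂ N g + if p then M else 0) *
      ((1 : Matrix (Fin N) (Fin N) ℂ) ⊗ₖ Y)) =
      c • Y + if p then trTwo (M * ((1 : Matrix (Fin N) (Fin N) ℂ) ⊗ₖ Y)) else 0 := by
  rw [add_mul, smul_mul_assoc, trTwo_add, trTwo_smul, trTwo_casimir g hY]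
  split_ifs
  · rfl
  · ext i j; simp [trTwo]

theorem rLamMu_eq (g : LieKind) (ρ : RKind) (a b : CP1) (i j : ℤ) :
    rLamMu N g ρ a b i j = ((expandHom a (ρ.multiplier * cauchyCoeff b j)).coeff i +
      match ρ with | .rational => 0 | .trigonometric => if i = 0 ∧ j = 0 then 1 else 0) •
        casimir ℂ N g + if i = 0 ∧ j = 0 then rConst N g ρ else 0 := by
  ext x y
  rw [rLamMu, Matrix.map_apply, expand_eq_expandHom, expand_eq_expandHom,
    rMatrix_apply ((RatFunc.C (K := RatFunc ℂ)).comp (RatFunc.C (K := ℂ))), RingHom.comp_apply,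
    RingHom.comp_apply, coeff_coeff_expandHom]
  have h : (expandHom a ((expandHom b ((match ρ with
      | .rational => 1 | .trigonometric => RatFunc.X : RatFunc (RatFunc ℂ)) *
      (RatFunc.X - RatFunc.C (RatFunc.X : RatFunc ℂ))⁻¹)).coeff j)).coeff i =
      (expandHom a (ρ.multiplier * cauchyCoeff b j)).coeff i +
      match ρ with | .rational => 0 | .trigonometric => if i = 0 ∧ j = 0 then 1 else 0 := by
    cases ρ with
    | rational =>
      simp only [RKind.multiplier]
      rw [one_mul, one_mul, coeff_expandHom_cauchy, add_zero]
    | trigonometric =>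
      have h0 : (RatFunc.X - RatFunc.C (RatFunc.X : RatFunc ℂ) : RatFunc (RatFunc ℂ)) ≠ 0 := by
        intro h
        obtain ⟨S, -, hS⟩ := exists_mul_eq_one_expandHom_sub OnePoint.infty
        rw [h, map_zero, zero_mul] at hS
        exact zero_ne_one hS
      have h1 : (RatFunc.X * (RatFunc.X - RatFunc.C (RatFunc.X : RatFunc ℂ))⁻¹ :
          RatFunc (RatFunc ℂ)) = 1 + RatFunc.C (RatFunc.X : RatFunc ℂ) *
            (RatFunc.X - RatFunc.C (RatFunc.X : RatFunc ℂ))⁻¹ := by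
        field_simp
        ring
      simp only [h1, RKind.multiplier]
      rw [map_add, map_mul, map_one, expandHom_C, HahnSeries.coeff_add, HahnSeries.C_mul_eq_smul,
        HahnSeries.coeff_smul, smul_eq_mul, coeff_expandHom_cauchy, map_add, HahnSeries.coeff_add,
        add_comm, HahnSeries.coeff_one]
      congr 1
      by_cases hj : j = 0 <;> simp [hj, HahnSeries.coeff_one]
  rw [h]
  split_ifs <;> simp

theorem rMuLam_eq (g : LieKind) (ρ : RKind) (a b : CP1) (i j : ℤ) :
    rMuLam N g ρ a b i j = (-(expandHom b (ρ.multiplier * cauchyCoeff a i)).coeff j) •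
        casimir ℂ N g + if i = 0 ∧ j = 0 then rConst N g ρ else 0 := by
  ext x y
  rw [rMuLam, Matrix.map_apply, expand_eq_expandHom, expand_eq_expandHom,
    rMatrix_apply' ((RatFunc.C (K := RatFunc ℂ)).comp (RatFunc.C (K := ℂ))), RingHom.comp_apply,
    RingHom.comp_apply, coeff_coeff_expandHom]
  have h : (expandHom b ((expandHom a (-((match ρ with
      | .rational => 1 | .trigonometric => RatFunc.C (RatFunc.X : RatFunc ℂ) :
      RatFunc (RatFunc ℂ)) *
      (RatFunc.X - RatFunc.C (RatFunc.X : RatFunc ℂ))⁻¹))).coeff i)).coeff j =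
      -(expandHom b (ρ.multiplier * cauchyCoeff a i)).coeff j := by
    rw [map_neg, HahnSeries.coeff_neg, map_neg, HahnSeries.coeff_neg]
    cases ρ with
    | rational =>
      simp only [RKind.multiplier]
      rw [one_mul, one_mul, coeff_expandHom_cauchy]
    | trigonometric =>
      simp only [RKind.multiplier]
      rw [map_mul, expandHom_C, HahnSeries.C_mul_eq_smul, HahnSeries.coeff_smul, smul_eq_mul,
        coeff_expandHom_cauchy]
  rw [h]
  split_ifs <;> simp_all

theorem trTwo_rLamMu (g : LieKind) (ρ : RKind) (a b : CP1) (i j : ℤ)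
    {Y : Matrix (Fin N) (Fin N) ℂ} (hY : g = .sl → Y.trace = 0) :
    trTwo (rLamMu N g ρ a b i j * ((1 : Matrix (Fin N) (Fin N) ℂ) ⊗ₖ Y)) =
      kernelAct ρ a b i j Y := by
  rw [rLamMu_eq, trTwo_smul_casimir_add g hY, trTwo_rConst g ρ hY, kernelAct]
  cases ρ with
  | rational => simp [RKind.constPart]
  | trigonometric =>
    simp only [RKind.constPart]
    split_ifs
    · rw [add_smul, one_smul, add_assoc]
      congr 1
      rw [← sub_eq_add_neg, sub_eq_iff_eq_add, upperHalf_add_lowerHalf]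
    · simp

/-- Exchanging the two orders of expansion amounts, up to sign, to exchanging the two factors. -/
theorem trace_trTwo_rMuLam_mul (g : LieKind) (ρ : RKind) (a b : CP1) (i j : ℤ)
    (X : Matrix (Fin N) (Fin N) ℂ) {Y : Matrix (Fin N) (Fin N) ℂ} (hY : g = .sl → Y.trace = 0) :
    (trTwo (rMuLam N g ρ a b i j * ((1 : Matrix (Fin N) (Fin N) ℂ) ⊗ₖ Y)) * X).trace =
      -(kernelAct ρ b a j i X * Y).trace := by
  rw [rMuLam_eq, trTwo_smul_casimir_add g hY, trTwo_rConst g ρ hY, kernelAct, add_mul, add_mul,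
    Matrix.trace_add, Matrix.trace_add, smul_mul_assoc, smul_mul_assoc, Matrix.trace_smul,
    Matrix.trace_smul, neg_add, neg_smul, Matrix.trace_mul_comm Y]
  congr 1
  by_cases h : i = 0 ∧ j = 0
  · rw [if_pos h, if_pos h.symm]
    cases ρ with
    | rational => simp [RKind.constPart]
    | trigonometric =>
      simp only [RKind.constPart]
      rw [trace_upperHalf_mul, neg_mul, Matrix.trace_neg]
  · rw [if_neg h, if_neg fun h' => h h'.symm]
    simp

end RMatrix

/-! ### The Lax matrix and the potential term -/

section Potential

variable {N : ℕ}

theorem RKind.constPart_zero (ρ : RKind) : ρ.constPart (0 : Matrix (Fin N) (Fin N) ℂ) = 0 := by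
  cases ρ with
  | rational => rfl
  | trigonometric => ext i j; simp [RKind.constPart, upperHalf]

theorem kernelAct_zero (ρ : RKind) (a b : CP1) (i j : ℤ) :
    kernelAct ρ a b i j (0 : Matrix (Fin N) (Fin N) ℂ) = 0 := by
  simp [kernelAct, RKind.constPart_zero]

theorem kernelAct_of_neg (ρ : RKind) (a b : CP1) (i : ℤ) {j : ℤ} (hj : j < 0)
    (Y : Matrix (Fin N) (Fin N) ℂ) : kernelAct ρ a b i j Y = 0 := by
  simp [kernelAct, cauchyCoeff_of_neg b hj, hj.ne]

theorem VanishesBelow.lcoeff_eq_zero {Y : Matrix (Fin N) (Fin N) (LaurentSeries ℂ)} {B n : ℤ}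
    (hY : VanishesBelow B Y) (hn : n < B) : lcoeff Y n = 0 := by
  ext i j
  exact hY i j n hn

theorem kernelAct_support_subset (ρ : RKind) (a b : CP1) (i q : ℤ)
    {Y : Matrix (Fin N) (Fin N) (LaurentSeries ℂ)} {B : ℤ} (hY : VanishesBelow B Y) {j : ℤ}
    (hj : j ∉ Finset.Icc 0 (q - B)) : kernelAct ρ a b i j (lcoeff Y (q - j)) = 0 := by
  rw [Finset.mem_Icc, not_and_or] at hj
  rcases hj with hj | hj
  · exact kernelAct_of_neg ρ a b i (by omega) _
  · rw [hY.lcoeff_eq_zero (by omega), kernelAct_zero]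

theorem lcoeff_ratPartAt_eq_sum (ρ : RKind) (a b : CP1) (q n : ℤ)
    {Y : Matrix (Fin N) (Fin N) (LaurentSeries ℂ)} {B : ℤ} (hY : VanishesBelow B Y) :
    lcoeff (ratPartAt ρ b q Y a) n =
      ∑ j ∈ Finset.Icc 0 (q - B), kernelAct ρ a b n j (lcoeff Y (q - j)) := by
  have h1 : ∑ j ∈ Finset.Icc 0 (q - B),
      (if n = 0 ∧ j = 0 then ρ.constPart (lcoeff Y (q - j)) else 0) =
      if n = 0 then ρ.constPart (lcoeff Y q) else 0 := by
    by_cases hq : 0 ≤ q - B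
    · rw [Finset.sum_eq_single_of_mem 0 (by rw [Finset.mem_Icc]; omega)]
      · simp
      · intro j _ hj
        simp [hj]
    · rw [Finset.Icc_eq_empty (by omega), Finset.sum_empty, hY.lcoeff_eq_zero (by omega),
        RKind.constPart_zero, ite_self]
  simp only [kernelAct]
  rw [Finset.sum_add_distrib, h1]
  ext x y
  rw [lcoeff, Matrix.map_apply, ratPartAt, Matrix.map_apply, ratPart, Matrix.add_apply,
    Matrix.smul_apply, Matrix.map_apply, Matrix.map_apply, map_add, expandHom_C,
    HahnSeries.coeff_add, smul_eq_mul, cauchyTransform_eq_sum (hY x y), Finset.mul_sum, map_sum,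
    HahnSeries.coeff_sum, Matrix.add_apply, Matrix.sum_apply]
  congr 1
  · refine Finset.sum_congr rfl fun j _ => ?_
    rw [mul_left_comm, map_mul (expandHom a), expandHom_C, HahnSeries.C_mul_eq_smul,
      HahnSeries.coeff_smul, smul_eq_mul, Matrix.smul_apply, smul_eq_mul, mul_comm]
    rfl
  · rw [HahnSeries.C_apply, HahnSeries.coeff_single]
    by_cases hn : n = 0 <;> simp [hn]

theorem lcoeff_ratPartAt_eq_finsum (ρ : RKind) (a b : CP1) (q n : ℤ)
    (Y : Matrix (Fin N) (Fin N) (LaurentSeries ℂ)) :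
    lcoeff (ratPartAt ρ b q Y a) n = ∑ᶠ j : ℤ, kernelAct ρ a b n j (lcoeff Y (q - j)) := by
  obtain ⟨B, hB⟩ := exists_vanishesBelow Y
  rw [lcoeff_ratPartAt_eq_sum ρ a b q n hB, finsum_eq_sum_of_support_subset]
  intro j hj
  by_contra h
  exact hj (kernelAct_support_subset ρ a b n q hB h)

theorem exists_kernelAct_eq_zero (ρ : RKind) (a b : CP1) (j₀ : ℤ) :
    ∃ D : ℤ, ∀ i < D, ∀ j ≤ j₀, ∀ Y : Matrix (Fin N) (Fin N) ℂ, kernelAct ρ a b i j Y = 0 := by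
  obtain ⟨D, hD⟩ := exists_common_lower_bound fun j : Finset.Icc 0 j₀ =>
    expandHom a (ρ.multiplier * cauchyCoeff b j)
  refine ⟨min D 0, fun i hi j hj Y => ?_⟩
  by_cases h : j < 0
  · exact kernelAct_of_neg ρ a b i h Y
  · rw [kernelAct, hD ⟨j, by simp; omega⟩ i (by omega), if_neg (by omega), zero_smul, add_zero]

variable (ρ : RKind) (a b : CP1) (p q : ℤ) (X Y : Matrix (Fin N) (Fin N) (LaurentSeries ℂ))

theorem finite_support_kernelAct :
    (Function.support fun ij : ℤ × ℤ => (kernelAct ρ a b ij.1 ij.2 (lcoeff Y (q - ij.2)) *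
      lcoeff X (p - ij.1)).trace).Finite := by
  obtain ⟨A, hA⟩ := exists_vanishesBelow X
  obtain ⟨B, hB⟩ := exists_vanishesBelow Y
  obtain ⟨D, hD⟩ := exists_kernelAct_eq_zero (N := N) ρ a b (q - B)
  refine (Finset.finite_toSet (Finset.Icc D (p - A) ×ˢ Finset.Icc 0 (q - B))).subset ?_
  rintro ⟨i, j⟩ hij
  rw [Function.mem_support] at hij
  simp only at hij
  have hj : j ∈ Finset.Icc 0 (q - B) := by
    by_contra h
    rw [kernelAct_support_subset ρ a b i q hB h, zero_mul, Matrix.trace_zero] at hij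
    exact hij rfl
  have hi : i ∈ Finset.Icc D (p - A) := by
    rw [Finset.mem_Icc] at hj ⊢
    constructor
    · by_contra h
      rw [hD i (by omega) j hj.2, zero_mul, Matrix.trace_zero] at hij
      exact hij rfl
    · by_contra h
      rw [hA.lcoeff_eq_zero (by omega), mul_zero, Matrix.trace_zero] at hij
      exact hij rfl
  simp only [Finset.coe_product, Set.mem_prod, Finset.mem_coe]
  exact ⟨hi, hj⟩

theorem finsum_kernelAct :
    ∑ᶠ ij : ℤ × ℤ, (kernelAct ρ a b ij.1 ij.2 (lcoeff Y (q - ij.2)) *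
      lcoeff X (p - ij.1)).trace = (ratPartAt ρ b q Y a * X).trace.coeff p := by
  rw [finsum_curry _ (finite_support_kernelAct ρ a b p q X Y)]
  obtain ⟨A, hA⟩ := exists_vanishesBelow X
  obtain ⟨B, hB⟩ := exists_vanishesBelow Y
  obtain ⟨D, hD⟩ := exists_vanishesBelow (ratPartAt ρ b q Y a)
  have h1 : ∀ i, ∑ᶠ j : ℤ, (kernelAct ρ a b i j (lcoeff Y (q - j)) * lcoeff X (p - i)).trace =
      (lcoeff (ratPartAt ρ b q Y a) i * lcoeff X (p - i)).trace := by
    intro i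
    rw [lcoeff_ratPartAt_eq_sum ρ a b q i hB, Finset.sum_mul, Matrix.trace_sum,
      finsum_eq_sum_of_support_subset]
    intro j hj
    by_contra h
    apply hj
    simp only
    rw [kernelAct_support_subset ρ a b i q hB h, zero_mul, Matrix.trace_zero]
  simp only [h1]
  rw [coeff_trace_eq, lcoeff_mul_eq_sum hD hA, Matrix.trace_sum, finsum_eq_sum_of_support_subset]
  intro i hi
  rw [Function.mem_support] at hi
  simp only [Finset.coe_Icc, Set.mem_Icc]
  constructor
  · by_contra h
    rw [hD.lcoeff_eq_zero (by omega), zero_mul, Matrix.trace_zero] at hi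
    exact hi rfl
  · by_contra h
    rw [hA.lcoeff_eq_zero (by omega), mul_zero, Matrix.trace_zero] at hi
    exact hi rfl

variable {ρ a b p q}

/-- The Lax matrix is the expansion of a rational function of `λ`. -/
theorem laxV_eq_lcoeff_ratPartAt {g : LieKind}
    {Fm : CP1 → Matrix (Fin N) (Fin N) (LaurentSeries ℂ)} {φ : Config N} {t : TimeIdx → ℝ}
    (h : g = .sl → (orbitQ Fm φ t b).trace = 0) :
    laxV g ρ Fm φ t a b p q = lcoeff (ratPartAt ρ b q (orbitQ Fm φ t b) a) p := by
  rw [lcoeff_ratPartAt_eq_finsum, laxV]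
  refine finsum_congr fun j => trTwo_rLamMu g ρ a b p j fun hg => ?_
  rw [← coeff_trace_eq, h hg, HahnSeries.coeff_zero]

theorem potential_eq {g : LieKind}
    {Fm : CP1 → Matrix (Fin N) (Fin N) (LaurentSeries ℂ)} {φ : Config N} {t : TimeIdx → ℝ}
    (h : g = .sl → (orbitQ Fm φ t b).trace = 0) :
    potential g ρ Fm φ t a b p q =
      1 / 2 * ((ratPartAt ρ b q (orbitQ Fm φ t b) a * orbitQ Fm φ t a).trace.coeff p -
        (ratPartAt ρ a p (orbitQ Fm φ t a) b * orbitQ Fm φ t b).trace.coeff q) := by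
  rw [potential, ← finsum_kernelAct, ← finsum_kernelAct,
    ← finsum_comp_equiv (Equiv.prodComm ℤ ℤ) (f := fun ij : ℤ × ℤ =>
      (kernelAct ρ b a ij.1 ij.2 (lcoeff (orbitQ Fm φ t a) (p - ij.2)) *
        lcoeff (orbitQ Fm φ t b) (q - ij.1)).trace), ← finsum_sub_distrib]
  · congr 1
    refine finsum_congr fun ij => ?_
    have hY : g = .sl → (lcoeff (orbitQ Fm φ t b) (q - ij.2)).trace = 0 := fun hg => by
      rw [← coeff_trace_eq, h hg, HahnSeries.coeff_zero]
    rw [add_mul, add_mul, Matrix.trace_add, trace_mul_kronecker, trace_mul_kronecker,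
      trTwo_rLamMu g ρ a b ij.1 ij.2 hY, trace_trTwo_rMuLam_mul g ρ a b ij.1 ij.2 _ hY,
      ← sub_eq_add_neg]
    rfl
  · exact finite_support_kernelAct ρ a b p q _ _
  · exact (finite_support_kernelAct ρ b a q p _ _).preimage
      ((Equiv.prodComm ℤ ℤ).injective.injOn)

end Potential

/-! ### Coefficientwise derivatives of curves of Laurent matrices -/

open Filter Topology

section Derivatives

variable {N : ℕ}

/-- The curve `A` of Laurent matrices has, coefficient by coefficient, the derivative `A'` at `x`;
the pole orders are bounded near `x`. -/
def HasLaurentDerivAt (A : ℝ → Matrix (Fin N) (Fin N) (LaurentSeries ℂ))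
    (A' : Matrix (Fin N) (Fin N) (LaurentSeries ℂ)) (x : ℝ) : Prop :=
  (∃ B, ∀ᶠ u in 𝓝 x, VanishesBelow B (A u)) ∧
    ∀ i j n, HasDerivAt (fun u => (A u i j).coeff n) ((A' i j).coeff n) x

variable {A C : ℝ → Matrix (Fin N) (Fin N) (LaurentSeries ℂ)}
  {A' C' : Matrix (Fin N) (Fin N) (LaurentSeries ℂ)} {x : ℝ}

theorem HasLaurentDerivAt.congr (hA : HasLaurentDerivAt A A' x) (h : ∀ᶠ u in 𝓝 x, C u = A u) :
    HasLaurentDerivAt C A' x := by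
  obtain ⟨⟨B, hB⟩, hd⟩ := hA
  refine ⟨⟨B, ?_⟩, fun i j n => (hd i j n).congr_of_eventuallyEq ?_⟩
  · filter_upwards [hB, h] with u h1 h2
    rwa [h2]
  · filter_upwards [h] with u hu
    rw [hu]

theorem HasLaurentDerivAt.unique (hA : HasLaurentDerivAt A A' x) (hA' : HasLaurentDerivAt A C' x) :
    A' = C' := by
  ext i j n
  exact (hA.2 i j n).unique (hA'.2 i j n)

/-- The bound for the pole orders also holds for the derivative. -/
theorem HasLaurentDerivAt.exists_bound (hA : HasLaurentDerivAt A A' x) :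
    ∃ B, (∀ᶠ u in 𝓝 x, VanishesBelow B (A u)) ∧ VanishesBelow B (A x) ∧ VanishesBelow B A' := by
  obtain ⟨⟨B, hB⟩, hd⟩ := hA
  refine ⟨B, hB, hB.self_of_nhds, fun i j n hn => (hd i j n).unique ?_⟩
  refine (hasDerivAt_const x (0 : ℂ)).congr_of_eventuallyEq ?_
  filter_upwards [hB] with u hu
  exact hu i j n hn

theorem hasLaurentDerivAt_const (M : Matrix (Fin N) (Fin N) (LaurentSeries ℂ)) (x : ℝ) :
    HasLaurentDerivAt (fun _ => M) 0 x := by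
  obtain ⟨B, hB⟩ := exists_vanishesBelow M
  exact ⟨⟨B, Eventually.of_forall fun _ => hB⟩, fun i j n => by
    simpa using hasDerivAt_const x ((M i j).coeff n)⟩

theorem HasLaurentDerivAt.sub (hA : HasLaurentDerivAt A A' x) (hC : HasLaurentDerivAt C C' x) :
    HasLaurentDerivAt (fun u => A u - C u) (A' - C') x := by
  obtain ⟨⟨B, hB⟩, hd⟩ := hA
  obtain ⟨⟨D, hD⟩, hd'⟩ := hC
  refine ⟨⟨min B D, ?_⟩, fun i j n => ?_⟩
  · filter_upwards [hB, hD] with u h1 h2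
    exact (h1.mono (min_le_left _ _)).sub (h2.mono (min_le_right _ _))
  · simpa using (hd i j n).fun_sub (hd' i j n)

theorem HasLaurentDerivAt.mul (hA : HasLaurentDerivAt A A' x) (hC : HasLaurentDerivAt C C' x) :
    HasLaurentDerivAt (fun u => A u * C u) (A' * C x + A x * C') x := by
  obtain ⟨B, hB, hBx, hB'⟩ := hA.exists_bound
  obtain ⟨D, hD, hDx, hD'⟩ := hC.exists_bound
  refine ⟨⟨B + D, ?_⟩, fun i j n => ?_⟩
  · filter_upwards [hB, hD] with u h1 h2
    exact h1.mul h2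
  · have h1 : ∀ {X Y : Matrix (Fin N) (Fin N) (LaurentSeries ℂ)}, VanishesBelow B X →
        VanishesBelow D Y → ((X * Y) i j).coeff n = ∑ m ∈ Finset.Icc B (n - D), ∑ k,
          (X i k).coeff m * (Y k j).coeff (n - m) := by
      intro X Y hX hY
      have := congrFun₂ (lcoeff_mul_eq_sum hX hY n) i j
      rw [Matrix.sum_apply] at this
      exact this
    rw [Matrix.add_apply, HahnSeries.coeff_add, h1 hB' hDx, h1 hBx hD', ← Finset.sum_add_distrib]
    simp only [← Finset.sum_add_distrib]
    have h2 : HasDerivAt (fun u => ∑ m ∈ Finset.Icc B (n - D), ∑ k,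
        (A u i k).coeff m * (C u k j).coeff (n - m)) (∑ m ∈ Finset.Icc B (n - D), ∑ k,
        ((A' i k).coeff m * (C x k j).coeff (n - m) +
          (A x i k).coeff m * (C' k j).coeff (n - m))) x :=
      HasDerivAt.fun_sum fun m _ => HasDerivAt.fun_sum fun k _ =>
        (hA.2 i k m).mul (hC.2 k j (n - m))
    refine h2.congr_of_eventuallyEq ?_
    filter_upwards [hB, hD] with u h3 h4
    exact h1 h3 h4

theorem HasLaurentDerivAt.coeff_trace (hA : HasLaurentDerivAt A A' x) (n : ℤ) :
    HasDerivAt (fun u => (A u).trace.coeff n) (A'.trace.coeff n) x := by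
  simp only [Matrix.trace, HahnSeries.coeff_sum]
  exact HasDerivAt.fun_sum fun i _ => hA.2 i i n

theorem exists_kernelAct_apply_eq_mul (ρ : RKind) (a b : CP1) (i j : ℤ) (k l : Fin N) :
    ∃ c : ℂ, ∀ Y : Matrix (Fin N) (Fin N) ℂ, kernelAct ρ a b i j Y k l = c * Y k l := by
  have h : ∃ c : ℂ, ∀ Y : Matrix (Fin N) (Fin N) ℂ, ρ.constPart Y k l = c * Y k l := by
    cases ρ with
    | rational => exact ⟨0, fun Y => by simp [RKind.constPart]⟩
    | trigonometric =>
      refine ⟨if k < l then 1 else if k = l then 1 / 2 else 0, fun Y => ?_⟩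
      simp only [RKind.constPart, upperHalf, Matrix.of_apply]
      split_ifs <;> ring
  obtain ⟨c, hc⟩ := h
  refine ⟨(expandHom a (ρ.multiplier * cauchyCoeff b j)).coeff i +
    if i = 0 ∧ j = 0 then c else 0, fun Y => ?_⟩
  rw [kernelAct, Matrix.add_apply, Matrix.smul_apply, smul_eq_mul, add_mul]
  split_ifs
  · rw [hc]
  · simp

theorem HasLaurentDerivAt.ratPartAt (hA : HasLaurentDerivAt A A' x) (ρ : RKind) (a b : CP1)
    (q : ℤ) : HasLaurentDerivAt (fun u => ratPartAt ρ b q (A u) a)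
      (AdelicMultiform.ratPartAt ρ b q A' a) x := by
  obtain ⟨B, hB, -, hB'⟩ := hA.exists_bound
  obtain ⟨D, hD⟩ := exists_kernelAct_eq_zero (N := N) ρ a b (q - B)
  refine ⟨⟨D, ?_⟩, fun i j n => ?_⟩
  · filter_upwards [hB] with u hu i j n hn
    have h1 := lcoeff_ratPartAt_eq_sum ρ a b q n hu
    rw [Finset.sum_eq_zero fun k hk => hD n hn k (Finset.mem_Icc.1 hk).2 _] at h1
    exact congrFun₂ h1 i j
  · have h1 : ∀ {Y : Matrix (Fin N) (Fin N) (LaurentSeries ℂ)}, VanishesBelow B Y →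
        (AdelicMultiform.ratPartAt ρ b q Y a i j).coeff n =
          ∑ k ∈ Finset.Icc 0 (q - B), kernelAct ρ a b n k (lcoeff Y (q - k)) i j := by
      intro Y hY
      have := congrFun₂ (lcoeff_ratPartAt_eq_sum ρ a b q n hY) i j
      rw [Matrix.sum_apply] at this
      exact this
    rw [h1 hB']
    have h2 : HasDerivAt (fun u => ∑ k ∈ Finset.Icc 0 (q - B),
        kernelAct ρ a b n k (lcoeff (A u) (q - k)) i j)
        (∑ k ∈ Finset.Icc 0 (q - B), kernelAct ρ a b n k (lcoeff A' (q - k)) i j) x := by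
      refine HasDerivAt.fun_sum fun k _ => ?_
      obtain ⟨c, hc⟩ := exists_kernelAct_apply_eq_mul ρ a b n k i j
      simp only [hc]
      exact (hA.2 i j (q - k)).const_mul c
    refine h2.congr_of_eventuallyEq ?_
    filter_upwards [hB] with u hu
    exact h1 hu

/-! ### Curves of matrices of Taylor series and their inverses -/

/-- All coefficients of the curve `f` of power series are differentiable at `x`. -/
def CoeffDifferentiableAt (f : ℝ → ℂ⟦X⟧) (x : ℝ) : Prop :=
  ∀ m, DifferentiableAt ℝ (fun u => PowerSeries.coeff m (f u)) x

theorem coeffDifferentiableAt_const (f : ℂ⟦X⟧) (x : ℝ) :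
    CoeffDifferentiableAt (fun _ => f) x :=
  fun _ => differentiableAt_const _

theorem CoeffDifferentiableAt.mul {f g : ℝ → ℂ⟦X⟧} (hf : CoeffDifferentiableAt f x)
    (hg : CoeffDifferentiableAt g x) : CoeffDifferentiableAt (fun u => f u * g u) x := by
  intro m
  simp only [PowerSeries.coeff_mul]
  exact DifferentiableAt.fun_sum fun i _ => (hf _).mul (hg _)

theorem CoeffDifferentiableAt.sum {ι : Type*} {s : Finset ι} {f : ι → ℝ → ℂ⟦X⟧}
    (hf : ∀ i ∈ s, CoeffDifferentiableAt (f i) x) :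
    CoeffDifferentiableAt (fun u => ∑ i ∈ s, f i u) x := by
  intro m
  simp only [map_sum]
  exact DifferentiableAt.fun_sum fun i hi => hf i hi m

theorem CoeffDifferentiableAt.prod {ι : Type*} {s : Finset ι} {f : ι → ℝ → ℂ⟦X⟧}
    (hf : ∀ i ∈ s, CoeffDifferentiableAt (f i) x) :
    CoeffDifferentiableAt (fun u => ∏ i ∈ s, f i u) x := by
  classical
  induction s using Finset.induction_on with
  | empty => simpa using coeffDifferentiableAt_const 1 x
  | insert i s hi ih =>
    simp only [Finset.prod_insert hi]
    exact (hf i (Finset.mem_insert_self i s)).mul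
      (ih fun j hj => hf j (Finset.mem_insert_of_mem hj))

theorem CoeffDifferentiableAt.det {φ : ℝ → Matrix (Fin N) (Fin N) ℂ⟦X⟧}
    (hφ : ∀ i j, CoeffDifferentiableAt (fun u => φ u i j) x) :
    CoeffDifferentiableAt (fun u => (φ u).det) x := by
  simp only [Matrix.det_apply']
  exact .sum fun σ _ => (coeffDifferentiableAt_const _ x).mul (.prod fun i _ => hφ _ _)

theorem CoeffDifferentiableAt.inv {f : ℝ → ℂ⟦X⟧} (hf : CoeffDifferentiableAt f x)
    (h0 : PowerSeries.constantCoeff (f x) ≠ 0) :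
    CoeffDifferentiableAt (fun u => (f u)⁻¹) x := by
  have hinv : DifferentiableAt ℝ (fun u => (PowerSeries.constantCoeff (f u))⁻¹) x := by
    have := (hf 0).fun_inv (by simpa using h0)
    simpa using this
  intro m
  induction m using Nat.strong_induction_on with
  | _ m ih =>
    have heq : (fun u => PowerSeries.coeff m (f u)⁻¹) = _ :=
      funext fun u => PowerSeries.coeff_inv m (f u)
    rw [heq]
    by_cases hm : m = 0
    · simpa only [if_pos hm] using hinv
    · simp only [if_neg hm]
      refine hinv.neg.mul (DifferentiableAt.fun_sum fun i _ => ?_)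
      by_cases hi : i.2 < m
      · simp only [if_pos hi]
        exact (hf _).mul (ih _ hi)
      · simp only [if_neg hi]
        exact differentiableAt_const _

theorem coeffDifferentiableAt_matrix_inv {φ : ℝ → Matrix (Fin N) (Fin N) ℂ⟦X⟧}
    (hφ : ∀ i j, CoeffDifferentiableAt (fun u => φ u i j) x)
    (hdet : ∀ᶠ u in 𝓝 x, IsUnit (φ u).det) (i j : Fin N) :
    CoeffDifferentiableAt (fun u => (φ u)⁻¹ i j) x := by
  have h0 : ∀ u, IsUnit (φ u).det → PowerSeries.constantCoeff (φ u).det ≠ 0 := fun u hu =>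
    (hu.map PowerSeries.constantCoeff).ne_zero
  have h1 : CoeffDifferentiableAt (fun u => (φ u).det⁻¹ * (φ u).adjugate i j) x := by
    refine (CoeffDifferentiableAt.det hφ).inv (h0 x hdet.self_of_nhds) |>.mul ?_
    simp only [Matrix.adjugate_apply]
    refine CoeffDifferentiableAt.det fun k l => ?_
    by_cases hk : k = j
    · subst hk
      simpa only [Matrix.updateRow_self] using coeffDifferentiableAt_const _ x
    · simpa only [Matrix.updateRow_ne hk] using hφ k l
  intro m
  refine (h1 m).congr_of_eventuallyEq ?_
  filter_upwards [hdet] with u hu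
  rw [Matrix.inv_def, Matrix.smul_apply, smul_eq_mul]
  congr 2
  exact (PowerSeries.eq_inv_iff_mul_eq_one (h0 u hu)).2 (Ring.inverse_mul_cancel _ hu)

/-- The curve `φ` of matrices of Taylor series has, coefficient by coefficient, the derivative `φ'`
at `x`. -/
def HasTaylorDerivAt (φ : ℝ → Matrix (Fin N) (Fin N) ℂ⟦X⟧) (φ' : Matrix (Fin N) (Fin N) ℂ⟦X⟧)
    (x : ℝ) : Prop :=
  ∀ i j m, HasDerivAt (fun u => PowerSeries.coeff m (φ u i j)) (PowerSeries.coeff m (φ' i j)) x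

theorem vanishesBelow_toL (M : Matrix (Fin N) (Fin N) ℂ⟦X⟧) : VanishesBelow 0 (toL M) :=
  fun _ _ _ hn => coeff_ofPowerSeries_of_neg _ hn

theorem HasTaylorDerivAt.toL {φ : ℝ → Matrix (Fin N) (Fin N) ℂ⟦X⟧}
    {φ' : Matrix (Fin N) (Fin N) ℂ⟦X⟧} (h : HasTaylorDerivAt φ φ' x) :
    HasLaurentDerivAt (fun u => toL (φ u)) (AdelicMultiform.toL φ') x := by
  refine ⟨⟨0, Eventually.of_forall fun u => vanishesBelow_toL _⟩, fun i j n => ?_⟩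
  simp only [AdelicMultiform.toL, Matrix.map_apply, PowerSeries.coeff_coe]
  by_cases hn : n < 0
  · simpa only [if_pos hn] using hasDerivAt_const x (0 : ℂ)
  · simpa only [if_neg hn] using h i j _

theorem toL_mul (A B : Matrix (Fin N) (Fin N) ℂ⟦X⟧) : toL (A * B) = toL A * toL B :=
  Matrix.map_mul

theorem toL_one : toL (1 : Matrix (Fin N) (Fin N) ℂ⟦X⟧) = 1 :=
  Matrix.map_one _ (map_zero _) (map_one _)

theorem toL_mul_toL_inv {M : Matrix (Fin N) (Fin N) ℂ⟦X⟧} (hM : IsUnit M.det) :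
    toL M * toL M⁻¹ = 1 := by
  rw [← toL_mul, Matrix.mul_nonsing_inv _ hM, toL_one]

theorem toL_inv_mul_toL {M : Matrix (Fin N) (Fin N) ℂ⟦X⟧} (hM : IsUnit M.det) :
    toL M⁻¹ * toL M = 1 := by
  rw [← toL_mul, Matrix.nonsing_inv_mul _ hM, toL_one]

variable {φ : ℝ → Matrix (Fin N) (Fin N) ℂ⟦X⟧} {φ' : Matrix (Fin N) (Fin N) ℂ⟦X⟧}

theorem HasTaylorDerivAt.toL_inv (h : HasTaylorDerivAt φ φ' x)
    (hdet : ∀ᶠ u in 𝓝 x, IsUnit (φ u).det) :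
    HasLaurentDerivAt (fun u => AdelicMultiform.toL (φ u)⁻¹)
      (-(AdelicMultiform.toL (φ x)⁻¹ * AdelicMultiform.toL φ' *
        AdelicMultiform.toL (φ x)⁻¹)) x := by
  have hd := coeffDifferentiableAt_matrix_inv (φ := φ) (x := x)
    (fun i j m => (h i j m).differentiableAt) hdet
  let ψ : Matrix (Fin N) (Fin N) ℂ⟦X⟧ := Matrix.of fun i j => PowerSeries.mk fun m =>
    deriv (fun u => PowerSeries.coeff m ((φ u)⁻¹ i j)) x
  have hψ : HasTaylorDerivAt (fun u => (φ u)⁻¹) ψ x := fun i j m => by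
    simpa [ψ] using (hd i j m).hasDerivAt
  have hprod := h.toL.mul hψ.toL
  have hone : HasLaurentDerivAt (fun u => AdelicMultiform.toL (φ u) *
      AdelicMultiform.toL (φ u)⁻¹) 0 x :=
    (hasLaurentDerivAt_const 1 x).congr (hdet.mono fun u hu => toL_mul_toL_inv hu)
  have h0 := hprod.unique hone
  have h1 := toL_inv_mul_toL hdet.self_of_nhds
  have key : AdelicMultiform.toL ψ = -(AdelicMultiform.toL (φ x)⁻¹ * AdelicMultiform.toL φ' *
      AdelicMultiform.toL (φ x)⁻¹) := by
    have := congrArg (AdelicMultiform.toL (φ x)⁻¹ * ·) h0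
    simp only [mul_add, ← mul_assoc, h1, one_mul, mul_zero] at this
    exact eq_neg_of_add_eq_zero_right this
  rw [← key]
  exact hψ.toL

theorem conj_derivative_identity {R : Type*} [CommRing R] (P P' F Q : Matrix (Fin N) (Fin N) R)
    (h : Q * P = 1) :
    P' * Q * (P * F * Q) - P * F * Q * (P' * Q) =
      (P' * F + P * 0) * Q + P * F * -(Q * P' * Q) := by
  have h3 : P' * Q * (P * F * Q) = P' * (Q * P) * F * Q := by
    simp only [mul_assoc]
  rw [h3, h, mul_zero, add_zero, mul_one]
  simp only [mul_neg, ← mul_assoc, sub_eq_add_neg]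

/-- The derivative of a curve in an adjoint orbit. -/
theorem HasTaylorDerivAt.conj (h : HasTaylorDerivAt φ φ' x)
    (hdet : ∀ᶠ u in 𝓝 x, IsUnit (φ u).det) (F : Matrix (Fin N) (Fin N) (LaurentSeries ℂ)) :
    HasLaurentDerivAt
      (fun u => AdelicMultiform.toL (φ u) * F * AdelicMultiform.toL (φ u)⁻¹)
      (AdelicMultiform.toL φ' * AdelicMultiform.toL (φ x)⁻¹ *
          (AdelicMultiform.toL (φ x) * F * AdelicMultiform.toL (φ x)⁻¹) -
        AdelicMultiform.toL (φ x) * F * AdelicMultiform.toL (φ x)⁻¹ *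
          (AdelicMultiform.toL φ' * AdelicMultiform.toL (φ x)⁻¹)) x := by
  have h1 := toL_inv_mul_toL hdet.self_of_nhds
  have h2 := (h.toL.mul (hasLaurentDerivAt_const F x)).mul (h.toL_inv hdet)
  convert h2 using 1
  exact conj_derivative_identity _ _ F _ h1

end Derivatives

/-! ### Functions of the times -/

section Times

variable {Ω : Set (TimeIdx → ℝ)} {f : (TimeIdx → ℝ) → ℂ} {t : TimeIdx → ℝ}

open scoped Classical in
theorem slice_update (t : TimeIdx → ℝ) {s : Finset TimeIdx} {σ : TimeIdx} (hσ : σ ∈ s)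
    (x : s → ℝ) (v : ℝ) :
    slice t s (Function.update x ⟨σ, hσ⟩ v) = Function.update (slice t s x) σ v := by
  funext i
  by_cases hi : i = σ
  · subst hi
    simp [slice, hσ]
  · by_cases his : i ∈ s
    · simp [slice, his, hi]
    · simp [slice, his, hi]

theorem two_le_smooth : (2 : WithTop ℕ∞) ≤ ((⊤ : ℕ∞) : WithTop ℕ∞) :=
  WithTop.coe_le_coe.2 (le_top : (2 : ℕ∞) ≤ ⊤)

theorem slice_restrict (t : TimeIdx → ℝ) (s : Finset TimeIdx) :
    slice t s (fun i => t i) = t := by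
  funext i
  simp [slice]

theorem SmoothOn.contDiffAt (hf : SmoothOn Ω f) (hΩ : IsTimeDomain Ω) (t : TimeIdx → ℝ)
    (s : Finset TimeIdx) {x : s → ℝ} (hx : slice t s x ∈ Ω) :
    ContDiffAt ℝ ((⊤ : ℕ∞) : WithTop ℕ∞) (fun x : s → ℝ => f (slice t s x)) x :=
  (hf t s).contDiffAt ((hΩ t s).mem_nhds hx)

open scoped Classical in
theorem SmoothOn.hasDerivAt_slice (hf : SmoothOn Ω f) (hΩ : IsTimeDomain Ω) (t : TimeIdx → ℝ)
    {s : Finset TimeIdx} {σ : TimeIdx} (hσ : σ ∈ s) {x : s → ℝ} (hx : slice t s x ∈ Ω) :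
    HasDerivAt (fun u => f (Function.update (slice t s x) σ u))
      (fderiv ℝ (fun x : s → ℝ => f (slice t s x)) x (Pi.single ⟨σ, hσ⟩ 1)) (slice t s x σ) := by
  have h1 := ((hf.contDiffAt hΩ t s hx).differentiableAt (by simp)).hasFDerivAt
  have h2 := hasDerivAt_update x ⟨σ, hσ⟩ (x ⟨σ, hσ⟩)
  have h3 : Function.update x ⟨σ, hσ⟩ (x ⟨σ, hσ⟩) = x := Function.update_eq_self _ _
  have h4 := HasFDerivAt.comp_hasDerivAt (x ⟨σ, hσ⟩) (by rw [h3]; exact h1) h2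
  have h5 : slice t s x σ = x ⟨σ, hσ⟩ := by simp [slice, hσ]
  rw [h5]
  refine h4.congr_of_eventuallyEq (Eventually.of_forall fun u => ?_)
  simp only [Function.comp_apply, slice_update]

open scoped Classical in
theorem SmoothOn.pd_slice (hf : SmoothOn Ω f) (hΩ : IsTimeDomain Ω) (t : TimeIdx → ℝ)
    {s : Finset TimeIdx} {σ : TimeIdx} (hσ : σ ∈ s) {x : s → ℝ} (hx : slice t s x ∈ Ω) :
    pd σ f (slice t s x) =
      fderiv ℝ (fun x : s → ℝ => f (slice t s x)) x (Pi.single ⟨σ, hσ⟩ 1) :=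
  (hf.hasDerivAt_slice hΩ t hσ hx).deriv

open scoped Classical in
theorem eventually_update_mem (hΩ : IsTimeDomain Ω) (ht : t ∈ Ω) (τ : TimeIdx) :
    ∀ᶠ u in 𝓝 (t τ), Function.update t τ u ∈ Ω := by
  have hτ : τ ∈ ({τ} : Finset TimeIdx) := Finset.mem_singleton_self τ
  have h1 : Continuous fun u : ℝ =>
      Function.update (fun i : ({τ} : Finset TimeIdx) => t i) ⟨τ, hτ⟩ u :=
    continuous_const.update _ continuous_id
  have h2 := ((hΩ t {τ}).preimage h1).mem_nhds (x := t τ) (by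
    simp only [Set.mem_preimage, Set.mem_ofPred_eq, slice_restrict,
      Function.update_eq_self]
    exact ht)
  filter_upwards [h2] with u hu
  simpa only [Set.mem_preimage, Set.mem_ofPred_eq, slice_update, slice_restrict] using hu

open scoped Classical in
theorem SmoothOn.hasDerivAt (hf : SmoothOn Ω f) (hΩ : IsTimeDomain Ω) (ht : t ∈ Ω)
    (τ : TimeIdx) : HasDerivAt (fun u => f (Function.update t τ u)) (pd τ f t) (t τ) := by
  have h := hf.hasDerivAt_slice hΩ t (Finset.mem_singleton_self τ) (x := fun i => t i)
    (by rwa [slice_restrict])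
  rw [slice_restrict] at h
  exact h.differentiableAt.hasDerivAt

open scoped Classical in
theorem SmoothOn.hasDerivAt_pd_aux (hf : SmoothOn Ω f) (hΩ : IsTimeDomain Ω) (ht : t ∈ Ω)
    {s : Finset TimeIdx} {σ τ : TimeIdx} (hσ : σ ∈ s) (hτ : τ ∈ s) :
    HasDerivAt (fun u => pd σ f (Function.update t τ u))
      (fderiv ℝ (fderiv ℝ fun x : s → ℝ => f (slice t s x)) (fun i => t i)
        (Pi.single ⟨τ, hτ⟩ 1) (Pi.single ⟨σ, hσ⟩ 1)) (t τ) := by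
  set G := fun x : s → ℝ => f (slice t s x) with hG
  set x₀ : s → ℝ := fun i => t i with hx₀
  have hx : slice t s x₀ = t := slice_restrict t s
  have h1 : DifferentiableAt ℝ (fderiv ℝ G) x₀ :=
    ((hf.contDiffAt hΩ t s (x := x₀) (by rwa [hx])).fderiv_right (m := 1)
      (one_add_one_eq_two.trans_le two_le_smooth)).differentiableAt (by simp)
  have h2 := hasDerivAt_update x₀ ⟨τ, hτ⟩ (t τ)
  have h3 : Function.update x₀ ⟨τ, hτ⟩ (t τ) = x₀ := Function.update_eq_self _ _
  have h4 := HasFDerivAt.comp_hasDerivAt (t τ) (by rw [h3]; exact h1.hasFDerivAt) h2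
  have h5 := h4.clm_apply (hasDerivAt_const (t τ) (Pi.single (⟨σ, hσ⟩ : s) (1 : ℝ)))
  simp only [map_zero, add_zero] at h5
  refine h5.congr_of_eventuallyEq ?_
  filter_upwards [eventually_update_mem hΩ ht τ] with u hu
  have h6 : Function.update t τ u = slice t s (Function.update x₀ ⟨τ, hτ⟩ u) := by
    rw [slice_update, hx]
  rw [h6] at hu ⊢
  exact hf.pd_slice hΩ t hσ hu

open scoped Classical in
theorem SmoothOn.hasDerivAt_pd (hf : SmoothOn Ω f) (hΩ : IsTimeDomain Ω) (ht : t ∈ Ω)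
    (σ τ : TimeIdx) :
    HasDerivAt (fun u => pd σ f (Function.update t τ u)) (pd τ (pd σ f) t) (t τ) :=
  (hf.hasDerivAt_pd_aux hΩ ht (s := {σ, τ}) (by simp) (by simp)).differentiableAt.hasDerivAt

/-- The time derivatives commute. -/
theorem SmoothOn.pd_comm (hf : SmoothOn Ω f) (hΩ : IsTimeDomain Ω) (ht : t ∈ Ω)
    (σ τ : TimeIdx) : pd τ (pd σ f) t = pd σ (pd τ f) t := by
  classical
  have hσ : σ ∈ ({σ, τ} : Finset TimeIdx) := by simp
  have hτ : τ ∈ ({σ, τ} : Finset TimeIdx) := by simp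
  have h1 := (hf.hasDerivAt_pd_aux hΩ ht hσ hτ).deriv
  have h2 := (hf.hasDerivAt_pd_aux hΩ ht hτ hσ).deriv
  have h3 := (hf.contDiffAt hΩ t {σ, τ} (x := fun i => t i)
    (by rwa [slice_restrict])).isSymmSndFDerivAt (by simpa using two_le_smooth)
  refine Eq.trans ?_ ((h1.trans (h3 _ _)).trans (h2.symm.trans ?_))
  · unfold pd; congr!
  · unfold pd; congr!

variable {h : ℝ → (TimeIdx → ℝ) → ℂ}

theorem SmoothFamilyOn.smoothOn (hh : SmoothFamilyOn Ω h) (ε : ℝ) : SmoothOn Ω (h ε) := by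
  intro t s
  exact (hh t s).comp (f := fun x : s → ℝ => (ε, x)) (contDiff_const.prodMk contDiff_id).contDiffOn
    fun x hx => hx

theorem SmoothFamilyOn.contDiffAt (hh : SmoothFamilyOn Ω h) (hΩ : IsTimeDomain Ω)
    (t : TimeIdx → ℝ) (s : Finset TimeIdx) (ε : ℝ) {x : s → ℝ} (hx : slice t s x ∈ Ω) :
    ContDiffAt ℝ ((⊤ : ℕ∞) : WithTop ℕ∞) (fun y : ℝ × (s → ℝ) => h y.1 (slice t s y.2))
      (ε, x) :=
  (hh t s).contDiffAt (((hΩ t s).preimage continuous_snd).mem_nhds hx)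

theorem SmoothFamilyOn.differentiableAt (hh : SmoothFamilyOn Ω h) (hΩ : IsTimeDomain Ω)
    (ht : t ∈ Ω) (ε : ℝ) : DifferentiableAt ℝ (fun ε => h ε t) ε := by
  have h1 := (hh.contDiffAt hΩ t ∅ ε (x := fun i => t i)
    (by rwa [slice_restrict])).differentiableAt (by simp)
  have h2 := h1.comp ε (f := fun ε : ℝ => (ε, fun i : (∅ : Finset TimeIdx) => t i))
    (differentiableAt_id.prodMk (differentiableAt_const _))
  simpa only [Function.comp_def, slice_restrict] using h2

theorem SmoothFamilyOn.differentiableAt_pd (hh : SmoothFamilyOn Ω h) (hΩ : IsTimeDomain Ω)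
    (ht : t ∈ Ω) (τ : TimeIdx) (ε : ℝ) : DifferentiableAt ℝ (fun ε => pd τ (h ε) t) ε := by
  classical
  have hτ : τ ∈ ({τ} : Finset TimeIdx) := Finset.mem_singleton_self τ
  set H := fun y : ℝ × (({τ} : Finset TimeIdx) → ℝ) => h y.1 (slice t {τ} y.2) with hH
  set x₀ : ({τ} : Finset TimeIdx) → ℝ := fun i => t i with hx₀
  have hx : slice t {τ} x₀ = t := slice_restrict t _
  have hsm : ∀ ε, ContDiffAt ℝ ((⊤ : ℕ∞) : WithTop ℕ∞) H (ε, x₀) := fun ε =>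
    hh.contDiffAt hΩ t {τ} ε (x := x₀) (by rwa [hx])
  have key : ∀ ε, pd τ (h ε) t = fderiv ℝ H (ε, x₀) (0, Pi.single ⟨τ, hτ⟩ 1) := by
    intro ε
    have h1 := (hh.smoothOn ε).pd_slice hΩ t hτ (x := x₀) (by rwa [hx])
    rw [hx] at h1
    rw [h1]
    have h2 : HasFDerivAt (fun x : ({τ} : Finset TimeIdx) → ℝ => (ε, x))
        (ContinuousLinearMap.inr ℝ ℝ (({τ} : Finset TimeIdx) → ℝ)) x₀ :=
      hasFDerivAt_prodMk_right ε x₀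
    have h3 := (((hsm ε).differentiableAt (by simp)).hasFDerivAt.comp x₀ h2).fderiv
    exact congrArg (fun l => l (Pi.single ⟨τ, hτ⟩ 1)) h3
  simp only [key]
  have h1 : DifferentiableAt ℝ (fderiv ℝ H) (ε, x₀) :=
    ((hsm ε).fderiv_right (m := 1)
      (one_add_one_eq_two.trans_le two_le_smooth)).differentiableAt (by simp)
  have h2 := h1.comp ε (f := fun ε : ℝ => (ε, x₀))
    (differentiableAt_id.prodMk (differentiableAt_const _))
  exact h2.clm_apply (differentiableAt_const _)

end Times

/-! ### The double zero formula for the exterior derivative of the multiform -/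

section Traceless

variable {N : ℕ}

theorem trace_lowerHalf (M : Matrix (Fin N) (Fin N) ℂ) : (lowerHalf M).trace = M.trace / 2 := by
  simp [Matrix.trace, lowerHalf, Finset.sum_div]

theorem trace_upperHalf (M : Matrix (Fin N) (Fin N) ℂ) : (upperHalf M).trace = M.trace / 2 := by
  simp [Matrix.trace, upperHalf, Finset.sum_div]

theorem trace_constL (M : Matrix (Fin N) (Fin N) ℂ) : (constL M).trace = HahnSeries.C M.trace := by
  simp only [Matrix.trace, map_sum]
  rfl

theorem trace_truncLT {Y : Matrix (Fin N) (Fin N) (LaurentSeries ℂ)} (hY : Y.trace = 0) (k : ℤ) :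
    (Y.map (HahnSeries.truncLT k)).trace = 0 := by
  ext n
  have h : (lcoeff Y n).trace = 0 := by rw [← coeff_trace_eq, hY, HahnSeries.coeff_zero]
  rw [coeff_trace_eq, HahnSeries.coeff_zero]
  by_cases hn : n < k
  · rw [← h]
    refine Finset.sum_congr rfl fun i _ => ?_
    simp [lcoeff, HahnSeries.coeff_truncLT, hn]
  · refine Finset.sum_eq_zero fun i _ => ?_
    simp [lcoeff, HahnSeries.coeff_truncLT, hn]

theorem trace_finsum_eq_zero {ι : Type*} {f : ι → Matrix (Fin N) (Fin N) ℂ}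
    (hf : ∀ i, (f i).trace = 0) : (∑ᶠ i, f i).trace = 0 := by
  refine finsum_induction (p := fun M : Matrix (Fin N) (Fin N) ℂ => M.trace = 0) ?_ ?_ hf
  · exact Matrix.trace_zero _ _
  · intro x y hx hy
    rw [Matrix.trace_add, hx, hy, add_zero]

theorem trace_principalPart (ρ : RKind) (a : CP1)
    {Y : Matrix (Fin N) (Fin N) (LaurentSeries ℂ)} (hY : Y.trace = 0) :
    (principalPart ρ a Y).trace = 0 := by
  have h : ∀ n, (lcoeff Y n).trace = 0 := fun n => by
    rw [← coeff_trace_eq, hY, HahnSeries.coeff_zero]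
  cases ρ with
  | rational =>
    induction a using OnePoint.rec with
    | infty => exact trace_truncLT hY 1
    | coe z => exact trace_truncLT hY 0
  | trigonometric =>
    induction a using OnePoint.rec with
    | infty =>
      simp only [principalPart]
      rw [Matrix.trace_add, trace_truncLT hY, trace_constL, trace_upperHalf, h]
      simp
    | coe z =>
      simp only [principalPart]
      split_ifs
      · rw [Matrix.trace_add, trace_truncLT hY, trace_constL, trace_lowerHalf, h]
        simp
      · rw [Matrix.trace_add, trace_truncLT hY, add_zero]
        refine (Matrix.trace_neg _).trans ?_
        rw [trace_constL, trace_lowerHalf, trace_finsum_eq_zero]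
        · simp
        · intro n
          rw [Matrix.trace_smul, h, smul_zero]

theorem IsPartialFraction.trace_eq_zero {g : LieKind} {ρ : RKind}
    {F : Matrix (Fin N) (Fin N) (RatFunc ℂ)} {S : Finset CP1}
    {Fm : CP1 → Matrix (Fin N) (Fin N) (LaurentSeries ℂ)} (hF : IsPartialFraction g ρ F S Fm)
    (hg : g = .sl) (a : CP1) : (Fm a).trace = 0 := by
  subst hg
  by_cases ha : a ∈ S
  · obtain ⟨Y, hY, h⟩ := hF.1 a ha
    rw [h]
    exact trace_principalPart ρ a hY
  · rw [hF.2.1 a ha, Matrix.trace_zero]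

end Traceless

section Field

variable {N : ℕ} {g : LieKind} {ρ : RKind} {Ω : Set (TimeIdx → ℝ)} {φ : Config N}
  {Fm : CP1 → Matrix (Fin N) (Fin N) (LaurentSeries ℂ)} {t : TimeIdx → ℝ}

/-- The right logarithmic derivative `∂_τ φ^a (φ^a)⁻¹`. -/
def rightLogDeriv (φ : Config N) (τ : TimeIdx) (t : TimeIdx → ℝ) (a : CP1) :
    Matrix (Fin N) (Fin N) (LaurentSeries ℂ) :=
  toL (dField φ τ t a) * toL (φ t a)⁻¹

/-- The difference between `∂_τ φ^a (φ^a)⁻¹`, for the time `τ` which is the coefficient of `μ_b^q`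
in `𝓓_{μ_b}`, and the Lax matrix of this time. The generating Lax equation says that it commutes
with `Q^a`. -/
def laxDefect (ρ : RKind) (Fm : CP1 → Matrix (Fin N) (Fin N) (LaurentSeries ℂ)) (φ : Config N)
    (t : TimeIdx → ℝ) (a b : CP1) (q : ℤ) : Matrix (Fin N) (Fin N) (LaurentSeries ℂ) :=
  rightLogDeriv φ (timeOf ρ b q) t a - ratPartAt ρ b q (orbitQ Fm φ t b) a

theorem IsField.isUnit_det (hφ : IsField g ρ Ω φ) (ht : t ∈ Ω) (a : CP1) :
    IsUnit (φ t a).det := by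
  have h := (hφ.1 t ht).1 a
  cases g with
  | gl => exact h
  | sl => exact (show (φ t a).det = 1 from h) ▸ isUnit_one

theorem trace_orbitQ (hφ : IsField g ρ Ω φ) (ht : t ∈ Ω) (a : CP1) :
    (orbitQ Fm φ t a).trace = (Fm a).trace := by
  rw [orbitQ, Matrix.trace_mul_comm, ← mul_assoc, toL_inv_mul_toL (hφ.isUnit_det ht a), one_mul]

open scoped Classical in
theorem IsField.hasTaylorDerivAt (hφ : IsField g ρ Ω φ) (hΩ : IsTimeDomain Ω) (ht : t ∈ Ω)
    (τ : TimeIdx) (a : CP1) :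
    HasTaylorDerivAt (fun u => φ (Function.update t τ u) a) (dField φ τ t a) (t τ) := by
  intro i j m
  simpa only [dField, Matrix.of_apply, PowerSeries.coeff_mk] using (hφ.2 a i j m).hasDerivAt hΩ ht τ

/-- The second time derivatives `∂_τ ∂_σ φ^a`. -/
def ddField (φ : Config N) (σ τ : TimeIdx) (t : TimeIdx → ℝ) (a : CP1) :
    Matrix (Fin N) (Fin N) ℂ⟦X⟧ :=
  Matrix.of fun i j => PowerSeries.mk fun m =>
    pd τ (pd σ fun u => PowerSeries.coeff m (φ u a i j)) t

theorem IsField.ddField_comm (hφ : IsField g ρ Ω φ) (hΩ : IsTimeDomain Ω) (ht : t ∈ Ω)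
    (σ τ : TimeIdx) (a : CP1) : ddField φ σ τ t a = ddField φ τ σ t a := by
  ext i j m
  simp only [ddField, Matrix.of_apply, PowerSeries.coeff_mk]
  exact (hφ.2 a i j m).pd_comm hΩ ht σ τ

open scoped Classical in
theorem IsField.hasTaylorDerivAt_dField (hφ : IsField g ρ Ω φ) (hΩ : IsTimeDomain Ω) (ht : t ∈ Ω)
    (σ τ : TimeIdx) (a : CP1) :
    HasTaylorDerivAt (fun u => dField φ σ (Function.update t τ u) a) (ddField φ σ τ t a)
      (t τ) := by
  intro i j m
  simpa only [dField, ddField, Matrix.of_apply, PowerSeries.coeff_mk] using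
    (hφ.2 a i j m).hasDerivAt_pd hΩ ht σ τ

open scoped Classical in
theorem IsField.eventually_isUnit_det (hφ : IsField g ρ Ω φ) (hΩ : IsTimeDomain Ω) (ht : t ∈ Ω)
    (τ : TimeIdx) (a : CP1) : ∀ᶠ u in 𝓝 (t τ), IsUnit (φ (Function.update t τ u) a).det :=
  (eventually_update_mem hΩ ht τ).mono fun _ hu => hφ.isUnit_det hu a

open scoped Classical in
/-- The time evolution of `Q^a` is isospectral. -/
theorem IsField.hasLaurentDerivAt_orbitQ (hφ : IsField g ρ Ω φ) (hΩ : IsTimeDomain Ω)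
    (ht : t ∈ Ω) (τ : TimeIdx) (a : CP1) :
    HasLaurentDerivAt (fun u => orbitQ Fm φ (Function.update t τ u) a)
      (rightLogDeriv φ τ t a * orbitQ Fm φ t a - orbitQ Fm φ t a * rightLogDeriv φ τ t a)
      (t τ) := by
  have h := (hφ.hasTaylorDerivAt hΩ ht τ a).conj (hφ.eventually_isUnit_det hΩ ht τ a) (Fm a)
  simp only [Function.update_eq_self] at h
  exact h

open scoped Classical in
theorem IsField.hasDerivAt_kinHalf (hφ : IsField g ρ Ω φ) (hΩ : IsTimeDomain Ω)
    (ht : t ∈ Ω) (τ : TimeIdx) (a b : CP1) (p q : ℤ) :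
    HasDerivAt (fun u => kinHalf ρ Fm φ (Function.update t τ u) a b p q)
      (pd τ (fun u => kinHalf ρ Fm φ u a b p q) t) (t τ) ∧
    pd τ (fun u => kinHalf ρ Fm φ u a b p q) t =
      (((-(toL (φ t a)⁻¹ * toL (dField φ τ t a) * toL (φ t a)⁻¹) *
          toL (dField φ (timeOf ρ b q) t a) +
        toL (φ t a)⁻¹ * toL (ddField φ (timeOf ρ b q) τ t a)) * Fm a +
        toL (φ t a)⁻¹ * toL (dField φ (timeOf ρ b q) t a) * 0).trace).coeff p := by
  have h := ((((hφ.hasTaylorDerivAt hΩ ht τ a).toL_inv (hφ.eventually_isUnit_det hΩ ht τ a)).mul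
    (hφ.hasTaylorDerivAt_dField hΩ ht (timeOf ρ b q) τ a).toL).mul
    (hasLaurentDerivAt_const (Fm a) (t τ))).coeff_trace p
  simp only [Function.update_eq_self] at h
  exact ⟨h.differentiableAt.hasDerivAt, h.deriv⟩

theorem kinetic_identity {R : Type*} [CommRing R] (P Q Dβ Dγ D F : Matrix (Fin N) (Fin N) R)
    (h : Q * P = 1) :
    ((-(Q * Dγ * Q) * Dβ + Q * D) * F + Q * Dβ * 0).trace -
      ((-(Q * Dβ * Q) * Dγ + Q * D) * F + Q * Dγ * 0).trace =
      ((Dβ * Q * (Dγ * Q) - Dγ * Q * (Dβ * Q)) * (P * F * Q)).trace := by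
  have h1 : (Dβ * Q * (Dγ * Q) - Dγ * Q * (Dβ * Q)) * (P * F * Q) =
      (Dβ * Q * Dγ - Dγ * Q * Dβ) * (Q * P) * F * Q := by noncomm_ring
  rw [h1, h, mul_one, Matrix.trace_mul_comm _ Q, ← Matrix.trace_sub]
  congr 1
  noncomm_ring

/-- The exterior derivative of the kinetic term contains no second derivatives of the field. -/
theorem IsField.pd_kinHalf_sub (hφ : IsField g ρ Ω φ) (hΩ : IsTimeDomain Ω)
    (ht : t ∈ Ω) (a b c : CP1) (p q s : ℤ) :
    pd (timeOf ρ c s) (fun u => kinHalf ρ Fm φ u a b p q) t -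
      pd (timeOf ρ b q) (fun u => kinHalf ρ Fm φ u a c p s) t =
      ((rightLogDeriv φ (timeOf ρ b q) t a * rightLogDeriv φ (timeOf ρ c s) t a -
        rightLogDeriv φ (timeOf ρ c s) t a * rightLogDeriv φ (timeOf ρ b q) t a) *
          orbitQ Fm φ t a).trace.coeff p := by
  rw [(hφ.hasDerivAt_kinHalf hΩ ht _ a b p q).2, (hφ.hasDerivAt_kinHalf hΩ ht _ a c p s).2,
    hφ.ddField_comm hΩ ht (timeOf ρ c s) (timeOf ρ b q) a, ← HahnSeries.coeff_sub]
  exact congrArg (fun f : LaurentSeries ℂ => f.coeff p) (kinetic_identity _ _ _ _ _ _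
    (toL_inv_mul_toL (hφ.isUnit_det ht a)))

theorem trace_mul_commutator_eq_zero {R : Type*} [CommRing R] (A B : Matrix (Fin N) (Fin N) R) :
    (A * (B * A - A * B)).trace = 0 := by
  rw [mul_sub, Matrix.trace_sub, ← mul_assoc, ← mul_assoc, Matrix.trace_mul_comm (A * B) A,
    ← mul_assoc, sub_self]

open scoped Classical in
/-- The derivative of the potential term, in which only one of the two orders of expansion of the
`r`-matrix is left. -/
theorem IsField.hasDerivAt_potential (hF : g = .sl → ∀ a, (Fm a).trace = 0)
    (hφ : IsField g ρ Ω φ) (hΩ : IsTimeDomain Ω) (ht : t ∈ Ω) (τ : TimeIdx) (a b : CP1)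
    (p q : ℤ) :
    HasDerivAt (fun u => potential g ρ Fm φ (Function.update t τ u) a b p q)
      ((ratPartAt ρ b q (orbitQ Fm φ t b) a * (rightLogDeriv φ τ t a * orbitQ Fm φ t a -
          orbitQ Fm φ t a * rightLogDeriv φ τ t a)).trace.coeff p -
        (ratPartAt ρ a p (orbitQ Fm φ t a) b * (rightLogDeriv φ τ t b * orbitQ Fm φ t b -
          orbitQ Fm φ t b * rightLogDeriv φ τ t b)).trace.coeff q) (t τ) := by
  have hQa := hφ.hasLaurentDerivAt_orbitQ (Fm := Fm) hΩ ht τ a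
  have hQb := hφ.hasLaurentDerivAt_orbitQ (Fm := Fm) hΩ ht τ b
  have h1 := ((hQb.ratPartAt ρ a b q).mul hQa).coeff_trace p
  have h2 := ((hQa.ratPartAt ρ b a p).mul hQb).coeff_trace q
  have h3 := (h1.fun_sub h2).const_mul (1 / 2 : ℂ)
  simp only [Function.update_eq_self] at h3
  refine (h3.congr_of_eventuallyEq (f₁ := fun u =>
    potential g ρ Fm φ (Function.update t τ u) a b p q)
    ((eventually_update_mem hΩ ht τ).mono fun u hu => ?_)).congr_deriv ?_
  · exact potential_eq fun hg => (trace_orbitQ hφ hu _).trans (hF hg _)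
  have h5 := skew_ratPartAt ρ a b p q (orbitQ Fm φ t a) (rightLogDeriv φ τ t b * orbitQ Fm φ t b -
    orbitQ Fm φ t b * rightLogDeriv φ τ t b) (by rintro rfl; exact trace_mul_commutator_eq_zero _ _)
  have h6 := skew_ratPartAt ρ b a q p (orbitQ Fm φ t b) (rightLogDeriv φ τ t a * orbitQ Fm φ t a -
    orbitQ Fm φ t a * rightLogDeriv φ τ t a) (by rintro rfl; exact trace_mul_commutator_eq_zero _ _)
  rw [Matrix.trace_add, Matrix.trace_add, HahnSeries.coeff_add, HahnSeries.coeff_add]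
  linear_combination (1 / 2 : ℂ) * h5 - (1 / 2 : ℂ) * h6

theorem IsField.pd_lagrangian (hF : g = .sl → ∀ a, (Fm a).trace = 0)
    (hφ : IsField g ρ Ω φ) (hΩ : IsTimeDomain Ω) (ht : t ∈ Ω) (τ : TimeIdx) (a b : CP1)
    (p q : ℤ) :
    pd τ (fun u => lagrangian g ρ Fm φ u a b p q) t =
      pd τ (fun u => kinHalf ρ Fm φ u a b p q) t - pd τ (fun u => kinHalf ρ Fm φ u b a q p) t -
      ((ratPartAt ρ b q (orbitQ Fm φ t b) a * (rightLogDeriv φ τ t a * orbitQ Fm φ t a -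
          orbitQ Fm φ t a * rightLogDeriv φ τ t a)).trace.coeff p -
        (ratPartAt ρ a p (orbitQ Fm φ t a) b * (rightLogDeriv φ τ t b * orbitQ Fm φ t b -
          orbitQ Fm φ t b * rightLogDeriv φ τ t b)).trace.coeff q) := by
  classical
  have h := (((hφ.hasDerivAt_kinHalf (Fm := Fm) hΩ ht τ a b p q).1.fun_sub
    (hφ.hasDerivAt_kinHalf (Fm := Fm) hΩ ht τ b a q p).1).fun_sub
    (hφ.hasDerivAt_potential hF hΩ ht τ a b p q)).deriv
  rw [← h]
  unfold pd lagrangian kinetic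
  congr!

theorem double_zero_identity {R : Type*} [CommRing R] (A B V W Q : Matrix (Fin N) (Fin N) R) :
    ((A * B - B * A) * Q).trace - (V * (B * Q - Q * B)).trace + (W * (A * Q - Q * A)).trace =
      (((A - V) * (B - W) - (B - W) * (A - V)) * Q).trace - ((V * W - W * V) * Q).trace := by
  have e : ((A - V) * (B - W) - (B - W) * (A - V)) * Q =
      A * B * Q - A * W * Q - V * B * Q + V * W * Q -
        (B * A * Q - B * V * Q - W * A * Q + W * V * Q) := by noncomm_ring
  rw [e]
  simp only [sub_mul, mul_sub, Matrix.trace_sub, Matrix.trace_add, ← mul_assoc]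
  rw [Matrix.trace_mul_cycle V Q B, Matrix.trace_mul_cycle W Q A]
  ring

/-- On the space of all fields, the exterior derivative of the Lagrangian multiform is quadratic in
the defects of the Lax equations. -/
theorem IsField.dLagrangian_eq (hF : g = .sl → ∀ a, (Fm a).trace = 0)
    (hφ : IsField g ρ Ω φ) (hΩ : IsTimeDomain Ω) (ht : t ∈ Ω) (a b c : CP1) (p q s : ℤ) :
    dLagrangian g ρ Fm φ t a b c p q s =
      ((laxDefect ρ Fm φ t a b q * laxDefect ρ Fm φ t a c s -
        laxDefect ρ Fm φ t a c s * laxDefect ρ Fm φ t a b q) * orbitQ Fm φ t a).trace.coeff p +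
      ((laxDefect ρ Fm φ t b c s * laxDefect ρ Fm φ t b a p -
        laxDefect ρ Fm φ t b a p * laxDefect ρ Fm φ t b c s) * orbitQ Fm φ t b).trace.coeff q +
      ((laxDefect ρ Fm φ t c a p * laxDefect ρ Fm φ t c b q -
        laxDefect ρ Fm φ t c b q * laxDefect ρ Fm φ t c a p) * orbitQ Fm φ t c).trace.coeff s := by
  have key : ∀ (a b c : CP1) (p q s : ℤ), _ := fun a b c p q s =>
    congrArg (fun f : LaurentSeries ℂ => f.coeff p) (double_zero_identity
      (rightLogDeriv φ (timeOf ρ b q) t a) (rightLogDeriv φ (timeOf ρ c s) t a)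
      (ratPartAt ρ b q (orbitQ Fm φ t b) a) (ratPartAt ρ c s (orbitQ Fm φ t c) a)
      (orbitQ Fm φ t a))
  simp only [HahnSeries.coeff_sub, HahnSeries.coeff_add] at key
  have ka := key a b c p q s
  have kb := key b c a q s p
  have kc := key c a b s p q
  have hcl := closure_ratPartAt ρ a b c p q s (orbitQ Fm φ t a) (orbitQ Fm φ t b)
    (orbitQ Fm φ t c) (by rintro rfl; rfl) (by rintro rfl; rfl) (by rintro rfl; rfl)
  have hKa := hφ.pd_kinHalf_sub (Fm := Fm) hΩ ht a b c p q s
  have hKb := hφ.pd_kinHalf_sub (Fm := Fm) hΩ ht b c a q s p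
  have hKc := hφ.pd_kinHalf_sub (Fm := Fm) hΩ ht c a b s p q
  rw [dLagrangian, hφ.pd_lagrangian hF hΩ ht, hφ.pd_lagrangian hF hΩ ht,
    hφ.pd_lagrangian hF hΩ ht]
  unfold laxDefect
  linear_combination hKa + hKb + hKc + ka + kb + kc - hcl

end Field

/-! ### The Lax equation in terms of the defects -/

section Lax

variable {N : ℕ} {g : LieKind} {ρ : RKind} {Ω : Set (TimeIdx → ℝ)} {φ : Config N}
  {Fm : CP1 → Matrix (Fin N) (Fin N) (LaurentSeries ℂ)} {t : TimeIdx → ℝ}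

theorem finsum_lie_lcoeff (V Q : Matrix (Fin N) (Fin N) (LaurentSeries ℂ)) (p : ℤ) :
    ∑ᶠ n : ℤ, ⁅lcoeff V (p - n), lcoeff Q n⁆ = lcoeff (V * Q - Q * V) p := by
  obtain ⟨A, hA⟩ := exists_vanishesBelow V
  obtain ⟨B, hB⟩ := exists_vanishesBelow Q
  have hs : Function.support (fun n : ℤ => ⁅lcoeff V (p - n), lcoeff Q n⁆) ⊆
      (Finset.Icc B (p - A) : Finset ℤ) := by
    intro n hn
    rw [Finset.coe_Icc, Set.mem_Icc]
    by_contra h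
    refine hn ?_
    rcases not_and_or.1 h with h | h
    · simp [hB.lcoeff_eq_zero (not_le.1 h), Ring.lie_def]
    · simp [hA.lcoeff_eq_zero (n := p - n) (by omega), Ring.lie_def]
  rw [finsum_eq_sum_of_support_subset _ hs, lcoeff_sub, lcoeff_mul_eq_sum hA hB,
    lcoeff_mul_eq_sum hB hA]
  simp only [Ring.lie_def, Finset.sum_sub_distrib]
  congr 1
  refine Finset.sum_nbij' (fun n => p - n) (fun n => p - n) ?_ ?_ ?_ ?_ ?_ <;>
    simp only [Finset.mem_Icc, sub_sub_cancel, implies_true]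
  · omega
  · omega

theorem ext_lcoeff {X Y : Matrix (Fin N) (Fin N) (LaurentSeries ℂ)}
    (h : ∀ n, lcoeff X n = lcoeff Y n) : X = Y := by
  ext i j n
  exact congrFun (congrFun (h n) i) j

theorem commute_sub_iff {R : Type*} [Ring R] (A V Q : R) :
    (A - V) * Q = Q * (A - V) ↔ A * Q - Q * A = V * Q - Q * V := by
  rw [← sub_eq_zero, ← sub_eq_zero (b := V * Q - Q * V)]
  have : (A - V) * Q - Q * (A - V) = A * Q - Q * A - (V * Q - Q * V) := by noncomm_ring
  rw [this]

/-- The generating Lax equation says that all the defects commute with the matrices `Q^a`. -/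
theorem IsField.generatingLax_iff (hF : g = .sl → ∀ a, (Fm a).trace = 0)
    (hφ : IsField g ρ Ω φ) (hΩ : IsTimeDomain Ω) :
    GeneratingLax g ρ Fm Ω φ ↔ ∀ t ∈ Ω, ∀ (a b : CP1) (q : ℤ),
      laxDefect ρ Fm φ t a b q * orbitQ Fm φ t a = orbitQ Fm φ t a * laxDefect ρ Fm φ t a b q := by
  refine forall₂_congr fun t ht => forall₂_congr fun a b => ?_
  rw [forall_comm]
  refine forall_congr' fun q => ?_
  have hl : ∀ p, (Matrix.of fun i j =>
      pd (timeOf ρ b q) (fun u => lcoeff (orbitQ Fm φ u a) p i j) t) =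
      lcoeff (rightLogDeriv φ (timeOf ρ b q) t a * orbitQ Fm φ t a -
        orbitQ Fm φ t a * rightLogDeriv φ (timeOf ρ b q) t a) p := fun p => by
    ext i j
    exact ((hφ.hasLaurentDerivAt_orbitQ hΩ ht (timeOf ρ b q) a).2 i j p).deriv
  have hr : ∀ p, ∑ᶠ n : ℤ, ⁅laxV g ρ Fm φ t a b (p - n) q, lcoeff (orbitQ Fm φ t a) n⁆ =
      lcoeff (ratPartAt ρ b q (orbitQ Fm φ t b) a * orbitQ Fm φ t a -
        orbitQ Fm φ t a * ratPartAt ρ b q (orbitQ Fm φ t b) a) p := fun p => by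
    simp only [laxV_eq_lcoeff_ratPartAt fun hg => (trace_orbitQ hφ ht b).trans (hF hg b),
      finsum_lie_lcoeff]
  simp only [hl, hr]
  refine Iff.trans ⟨ext_lcoeff, fun h n => by rw [h]⟩ (commute_sub_iff _ _ _).symm

end Lax

/-! ### The Lax equation implies the Euler-Lagrange equations -/

section LaxToEL

variable {N : ℕ} {g : LieKind} {ρ : RKind} {Ω : Set (TimeIdx → ℝ)} {φ : Config N}
  {Fm : CP1 → Matrix (Fin N) (Fin N) (LaurentSeries ℂ)} {t : TimeIdx → ℝ}

theorem dField_congr {φ ψ : Config N} (hΩ : IsTimeDomain Ω) (ht : t ∈ Ω)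
    (h : ∀ u ∈ Ω, ψ u = φ u) (τ : TimeIdx) (a : CP1) : dField ψ τ t a = dField φ τ t a := by
  classical
  ext i j m
  simp only [dField, Matrix.of_apply, PowerSeries.coeff_mk]
  have h1 : (fun u => PowerSeries.coeff m (ψ (Function.update t τ u) a i j)) =ᶠ[𝓝 (t τ)]
      fun u => PowerSeries.coeff m (φ (Function.update t τ u) a i j) :=
    (eventually_update_mem hΩ ht τ).mono fun u hu => by simp only [h _ hu]
  have h2 := h1.deriv_eq
  unfold pd
  convert h2

theorem laxDefect_congr {φ ψ : Config N} (hΩ : IsTimeDomain Ω) (ht : t ∈ Ω)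
    (h : ∀ u ∈ Ω, ψ u = φ u) (a b : CP1) (q : ℤ) :
    laxDefect ρ Fm ψ t a b q = laxDefect ρ Fm φ t a b q := by
  simp only [laxDefect, rightLogDeriv, orbitQ, dField_congr hΩ ht h, h t ht]

theorem IsVariation.isField {Φ : ℝ → Config N} (hΦ : IsVariation g ρ Ω φ Φ) (ε : ℝ) :
    IsField g ρ Ω (Φ ε) :=
  ⟨hΦ.2.1 ε, fun a i j m => (hΦ.2.2 a i j m).smoothOn ε⟩

/-- The variation `δφ^a` of the field at `t`. -/
def variationDeriv (Φ : ℝ → Config N) (t : TimeIdx → ℝ) (a : CP1) :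
    Matrix (Fin N) (Fin N) ℂ⟦X⟧ :=
  Matrix.of fun i j => PowerSeries.mk fun m =>
    deriv (fun ε => PowerSeries.coeff m (Φ ε t a i j)) 0

theorem IsVariation.hasTaylorDerivAt {Φ : ℝ → Config N} (hΦ : IsVariation g ρ Ω φ Φ)
    (hΩ : IsTimeDomain Ω) (ht : t ∈ Ω) (a : CP1) :
    HasTaylorDerivAt (fun ε => Φ ε t a) (variationDeriv Φ t a) 0 := by
  intro i j m
  simpa only [variationDeriv, Matrix.of_apply, PowerSeries.coeff_mk] using
    ((hΦ.2.2 a i j m).differentiableAt hΩ ht 0).hasDerivAt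

theorem IsVariation.exists_hasTaylorDerivAt_dField {Φ : ℝ → Config N}
    (hΦ : IsVariation g ρ Ω φ Φ) (hΩ : IsTimeDomain Ω) (ht : t ∈ Ω) (τ : TimeIdx) (a : CP1) :
    ∃ D, HasTaylorDerivAt (fun ε => dField (Φ ε) τ t a) D 0 := by
  refine ⟨Matrix.of fun i j => PowerSeries.mk fun m =>
    deriv (fun ε => PowerSeries.coeff m (dField (Φ ε) τ t a i j)) 0, fun i j m => ?_⟩
  simp only [Matrix.of_apply, PowerSeries.coeff_mk]
  refine DifferentiableAt.hasDerivAt ?_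
  simpa only [dField, Matrix.of_apply, PowerSeries.coeff_mk] using
    (hΦ.2.2 a i j m).differentiableAt_pd hΩ ht τ 0

theorem IsVariation.isUnit_det {Φ : ℝ → Config N} (hΦ : IsVariation g ρ Ω φ Φ) (ht : t ∈ Ω)
    (a : CP1) (x : ℝ) : ∀ᶠ ε in 𝓝 x, IsUnit (Φ ε t a).det :=
  Eventually.of_forall fun ε => (hΦ.isField ε).isUnit_det ht a

theorem IsVariation.hasLaurentDerivAt_orbitQ {Φ : ℝ → Config N} (hΦ : IsVariation g ρ Ω φ Φ)
    (hΩ : IsTimeDomain Ω) (ht : t ∈ Ω) (a : CP1) :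
    ∃ ξ, HasLaurentDerivAt (fun ε => orbitQ Fm (Φ ε) t a)
      (ξ * orbitQ Fm (Φ 0) t a - orbitQ Fm (Φ 0) t a * ξ) 0 :=
  ⟨_, (hΦ.hasTaylorDerivAt hΩ ht a).conj (hΦ.isUnit_det ht a 0) (Fm a)⟩

theorem IsVariation.exists_hasLaurentDerivAt_laxDefect {Φ : ℝ → Config N}
    (hΦ : IsVariation g ρ Ω φ Φ) (hΩ : IsTimeDomain Ω) (ht : t ∈ Ω) (a b : CP1) (q : ℤ) :
    ∃ E, HasLaurentDerivAt (fun ε => laxDefect ρ Fm (Φ ε) t a b q) E 0 := by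
  obtain ⟨D, hD⟩ := hΦ.exists_hasTaylorDerivAt_dField hΩ ht (timeOf ρ b q) a
  obtain ⟨ξ, hξ⟩ := hΦ.hasLaurentDerivAt_orbitQ (Fm := Fm) hΩ ht b
  exact ⟨_, (hD.toL.mul ((hΦ.hasTaylorDerivAt hΩ ht a).toL_inv (hΦ.isUnit_det ht a 0))).sub
    (hξ.ratPartAt ρ a b q)⟩

/-- The derivative of `Tr ([A, B] Q)` vanishes at a point where `A` and `B` commute with `Q`, if `Q`
moves in its adjoint orbit. -/
theorem trace_commutator_derivative_eq_zero {R : Type*} [CommRing R]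
    (A B Q A' B' ξ : Matrix (Fin N) (Fin N) R) (hA : A * Q = Q * A) (hB : B * Q = Q * B) :
    ((A' * B + A * B' - (B' * A + B * A')) * Q + (A * B - B * A) * (ξ * Q - Q * ξ)).trace = 0 := by
  have h1 : (A' * B * Q).trace = (B * A' * Q).trace := by
    rw [mul_assoc, hB, ← mul_assoc, Matrix.trace_mul_comm, ← mul_assoc]
  have h2 : (A * B' * Q).trace = (B' * A * Q).trace := by
    rw [mul_assoc B', hA, ← mul_assoc, Matrix.trace_mul_comm (B' * Q), ← mul_assoc]
  have hC : (A * B - B * A) * Q = Q * (A * B - B * A) := by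
    rw [sub_mul, mul_sub, mul_assoc, hB, ← mul_assoc, hA, mul_assoc B, hA, ← mul_assoc, hB,
      mul_assoc, mul_assoc]
  have h3 : ((A * B - B * A) * (ξ * Q - Q * ξ)).trace = 0 := by
    rw [mul_sub, Matrix.trace_sub, ← mul_assoc, Matrix.trace_mul_comm _ Q, ← mul_assoc, ← mul_assoc,
      ← hC, sub_self]
  rw [Matrix.trace_add, h3, sub_mul, add_mul, add_mul, Matrix.trace_sub, Matrix.trace_add,
    Matrix.trace_add, h1, h2]
  ring

theorem IsVariation.hasDerivAt_trace_commutator {Φ : ℝ → Config N} (hΦ : IsVariation g ρ Ω φ Φ)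
    (hΩ : IsTimeDomain Ω) (ht : t ∈ Ω)
    (hlax : ∀ (a b : CP1) (q : ℤ),
      laxDefect ρ Fm φ t a b q * orbitQ Fm φ t a = orbitQ Fm φ t a * laxDefect ρ Fm φ t a b q)
    (a b c : CP1) (p q s : ℤ) :
    HasDerivAt (fun ε => ((laxDefect ρ Fm (Φ ε) t a b q * laxDefect ρ Fm (Φ ε) t a c s -
      laxDefect ρ Fm (Φ ε) t a c s * laxDefect ρ Fm (Φ ε) t a b q) *
        orbitQ Fm (Φ ε) t a).trace.coeff p) 0 0 := by
  obtain ⟨ξ, hξ⟩ := hΦ.hasLaurentDerivAt_orbitQ (Fm := Fm) hΩ ht a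
  obtain ⟨B, hB⟩ := hΦ.exists_hasLaurentDerivAt_laxDefect (Fm := Fm) hΩ ht a b q
  obtain ⟨C, hC⟩ := hΦ.exists_hasLaurentDerivAt_laxDefect (Fm := Fm) hΩ ht a c s
  refine ((((hB.mul hC).sub (hC.mul hB)).mul hξ).coeff_trace p).congr_deriv ?_
  have h0 : ∀ b q, laxDefect ρ Fm (Φ 0) t a b q * orbitQ Fm (Φ 0) t a =
      orbitQ Fm (Φ 0) t a * laxDefect ρ Fm (Φ 0) t a b q := fun b q => by
    have e : orbitQ Fm (Φ 0) t a = orbitQ Fm φ t a := by rw [orbitQ, orbitQ, hΦ.1 t ht]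
    rw [laxDefect_congr hΩ ht hΦ.1, e]
    exact hlax a b q
  exact congrArg (fun f : LaurentSeries ℂ => f.coeff p)
    (trace_commutator_derivative_eq_zero _ _ _ _ _ _ (h0 b q) (h0 c s))

/-- Solutions of the Lax equation are zeros of order two of the exterior derivative of the
multiform. -/
theorem multiformEL_of_generatingLax (hF : g = .sl → ∀ a, (Fm a).trace = 0)
    (hφ : IsField g ρ Ω φ) (hΩ : IsTimeDomain Ω) (h : GeneratingLax g ρ Fm Ω φ) :
    MultiformEL g ρ Fm Ω φ := by
  intro Φ hΦ t ht a b c p q s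
  have hlax := (hφ.generatingLax_iff hF hΩ).1 h t ht
  simp only [(hΦ.isField _).dLagrangian_eq hF hΩ ht]
  have h1 := ((hΦ.hasDerivAt_trace_commutator hΩ ht hlax a b c p q s).fun_add
    (hΦ.hasDerivAt_trace_commutator hΩ ht hlax b c a q s p)).fun_add
    (hΦ.hasDerivAt_trace_commutator hΩ ht hlax c a b s p q)
  simpa only [add_zero] using h1

end LaxToEL

/-! ### Nilpotent variations of the field -/

section Bump

variable {N : ℕ} {g : LieKind} {ρ : RKind} {Ω : Set (TimeIdx → ℝ)} {φ : Config N}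
  {Fm : CP1 → Matrix (Fin N) (Fin N) (LaurentSeries ℂ)} {t : TimeIdx → ℝ} {u v : Fin N → ℂ} {n : ℕ}

/-- The monomial matrix `c u vᵀ X^n`. -/
def rankOneMonomial (u v : Fin N → ℂ) (n : ℕ) (c : ℂ) : Matrix (Fin N) (Fin N) ℂ⟦X⟧ :=
  Matrix.of fun i j => PowerSeries.monomial n (c * (u i * v j))

theorem det_one_add_rankOneMonomial (huv : v ⬝ᵥ u = 0) (n : ℕ) (c : ℂ) :
    (1 + rankOneMonomial u v n c).det = 1 := by
  have h : rankOneMonomial u v n c =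
      Matrix.replicateCol Unit (fun i => PowerSeries.C (u i)) *
        Matrix.replicateRow Unit (fun j => PowerSeries.monomial n (c * v j)) := by
    ext1 i j
    simp only [rankOneMonomial, Matrix.of_apply, Matrix.mul_apply, Matrix.replicateCol_apply,
      Matrix.replicateRow_apply, Finset.univ_unique, Finset.sum_singleton]
    ext m
    simp only [PowerSeries.coeff_C_mul, PowerSeries.coeff_monomial]
    split_ifs <;> ring
  rw [h, Matrix.det_one_add_replicateCol_mul_replicateRow, add_eq_left]
  ext m
  simp only [dotProduct, map_sum, PowerSeries.coeff_mul_C, PowerSeries.coeff_monomial, map_zero]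
  split_ifs
  · rw [← mul_zero c, ← huv, dotProduct, Finset.mul_sum]
    exact Finset.sum_congr rfl fun i _ => by ring
  · simp

theorem coeff_rankOneMonomial_mul (u v : Fin N → ℂ) (n : ℕ) (c : ℂ)
    (M : Matrix (Fin N) (Fin N) ℂ⟦X⟧) (i j : Fin N) (m : ℕ) :
    PowerSeries.coeff m ((rankOneMonomial u v n c * M) i j) =
      c * PowerSeries.coeff m ((rankOneMonomial u v n 1 * M) i j) := by
  have h : ∀ k, rankOneMonomial u v n c i k =
      PowerSeries.C c * rankOneMonomial u v n 1 i k := fun k => by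
    ext m
    simp only [rankOneMonomial, Matrix.of_apply, PowerSeries.coeff_C_mul,
      PowerSeries.coeff_monomial]
    split_ifs <;> ring
  simp only [Matrix.mul_apply, h, mul_assoc, ← Finset.mul_sum, PowerSeries.coeff_C_mul]

theorem constantCoeff_rankOneMonomial_mul (u v : Fin N → ℂ) (hn : n ≠ 0) (c : ℂ)
    (M : Matrix (Fin N) (Fin N) ℂ⟦X⟧) (i j : Fin N) :
    PowerSeries.constantCoeff ((rankOneMonomial u v n c * M) i j) = 0 := by
  rw [Matrix.mul_apply, map_sum]
  refine Finset.sum_eq_zero fun k _ => ?_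
  rw [map_mul, rankOneMonomial, Matrix.of_apply, ← PowerSeries.coeff_zero_eq_constantCoeff_apply,
    PowerSeries.coeff_monomial, if_neg hn.symm, zero_mul]

open scoped Classical in
/-- The variation `φ^a ↦ (1 + ε (t_τ - t₀_τ) u vᵀ λ_a^n) φ^a` at the point `a`. At `t₀` it changes
neither the field nor its derivatives in the directions other than `τ`. -/
def bump (φ : Config N) (a : CP1) (τ : TimeIdx) (t₀ : TimeIdx → ℝ) (u v : Fin N → ℂ) (n : ℕ)
    (ε : ℝ) : Config N := fun t z =>
  if z = a then (1 + rankOneMonomial u v n ((ε * (t τ - t₀ τ) : ℝ) : ℂ)) * φ t z else φ t z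

theorem coeff_bump_self (φ : Config N) (a : CP1) (τ : TimeIdx) (t₀ : TimeIdx → ℝ)
    (u v : Fin N → ℂ) (n : ℕ) (ε : ℝ) (t : TimeIdx → ℝ) (i j : Fin N) (m : ℕ) :
    PowerSeries.coeff m (bump φ a τ t₀ u v n ε t a i j) = PowerSeries.coeff m (φ t a i j) +
      ((ε * (t τ - t₀ τ) : ℝ) : ℂ) *
        PowerSeries.coeff m ((rankOneMonomial u v n 1 * φ t a) i j) := by
  rw [bump, if_pos rfl, add_mul, one_mul, Matrix.add_apply, map_add, coeff_rankOneMonomial_mul]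

theorem bump_of_ne (φ : Config N) {a z : CP1} (hz : z ≠ a) (τ : TimeIdx) (t₀ : TimeIdx → ℝ)
    (u v : Fin N → ℂ) (n : ℕ) (ε : ℝ) (t : TimeIdx → ℝ) : bump φ a τ t₀ u v n ε t z = φ t z :=
  if_neg hz

theorem bump_eq_self (φ : Config N) (a : CP1) (τ : TimeIdx) (t₀ : TimeIdx → ℝ)
    (u v : Fin N → ℂ) (n : ℕ) {ε : ℝ} {t : TimeIdx → ℝ} (h : ε * (t τ - t₀ τ) = 0) :
    bump φ a τ t₀ u v n ε t = φ t := by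
  funext z
  by_cases hz : z = a
  · subst hz
    ext i j m
    rw [coeff_bump_self, h]
    simp
  · exact bump_of_ne φ hz ..

theorem constantCoeff_bump (φ : Config N) (a : CP1) (τ : TimeIdx) (t₀ : TimeIdx → ℝ)
    (u v : Fin N → ℂ) (hn : n ≠ 0) (ε : ℝ) (t : TimeIdx → ℝ) (z : CP1) (i j : Fin N) :
    PowerSeries.constantCoeff (bump φ a τ t₀ u v n ε t z i j) =
      PowerSeries.constantCoeff (φ t z i j) := by
  by_cases hz : z = a
  · rw [bump, if_pos hz, add_mul, one_mul, Matrix.add_apply, map_add,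
      constantCoeff_rankOneMonomial_mul u v hn, add_zero]
  · rw [bump_of_ne φ hz]

theorem det_bump (φ : Config N) (a : CP1) (τ : TimeIdx) (t₀ : TimeIdx → ℝ)
    (huv : v ⬝ᵥ u = 0) (n : ℕ) (ε : ℝ) (t : TimeIdx → ℝ) (z : CP1) :
    (bump φ a τ t₀ u v n ε t z).det = (φ t z).det := by
  by_cases hz : z = a
  · rw [bump, if_pos hz, Matrix.det_mul, det_one_add_rankOneMonomial huv, one_mul]
  · rw [bump_of_ne φ hz]

theorem inAdelicGroup_bump (huv : v ⬝ᵥ u = 0) (hn : n ≠ 0) (a : CP1) (τ : TimeIdx)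
    (t₀ : TimeIdx → ℝ) (ε : ℝ) (h : InAdelicGroup g ρ (φ t)) :
    InAdelicGroup g ρ (bump φ a τ t₀ u v n ε t) := by
  refine ⟨fun z => ?_, ?_⟩
  · have := h.1 z
    cases g <;> simpa only [InGroup, det_bump φ a τ t₀ huv] using this
  · have := h.2
    cases ρ with
    | rational =>
      rw [← this]
      ext i j
      exact constantCoeff_bump φ a τ t₀ u v hn ε t _ i j
    | trigonometric => simpa only [constantCoeff_bump φ a τ t₀ u v hn] using this

theorem SmoothOn.coeff_rankOneMonomial_mul {a : CP1}
    (hφ : ∀ i j m, SmoothOn Ω fun t => PowerSeries.coeff m (φ t a i j)) (u v : Fin N → ℂ) (n : ℕ)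
    (i j : Fin N) (m : ℕ) :
    SmoothOn Ω fun t => PowerSeries.coeff m ((rankOneMonomial u v n 1 * φ t a) i j) := by
  intro t s
  simp only [Matrix.mul_apply, map_sum, PowerSeries.coeff_mul]
  exact ContDiffOn.sum fun k _ => ContDiffOn.sum fun x _ => contDiffOn_const.mul (hφ k j x.2 t s)

theorem SmoothOn.smoothFamilyOn_add {f h : (TimeIdx → ℝ) → ℂ} (hf : SmoothOn Ω f)
    (hh : SmoothOn Ω h) (τ : TimeIdx) (x₀ : ℝ) :
    SmoothFamilyOn Ω fun ε t => f t + ((ε * (t τ - x₀) : ℝ) : ℂ) * h t := by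
  intro t s
  have hmap : Set.MapsTo (Prod.snd : ℝ × (s → ℝ) → (s → ℝ)) {y | slice t s y.2 ∈ Ω}
      {x | slice t s x ∈ Ω} := fun y hy => hy
  have h1 := (hf t s).comp contDiff_snd.contDiffOn hmap
  have h2 := (hh t s).comp contDiff_snd.contDiffOn hmap
  have h3 : ContDiff ℝ ((⊤ : ℕ∞) : WithTop ℕ∞) fun y : ℝ × (s → ℝ) => slice t s y.2 τ := by
    by_cases hτ : τ ∈ s
    · simp only [slice, dif_pos hτ]
      fun_prop
    · simp only [slice, dif_neg hτ]
      fun_prop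
  have h4 : ContDiff ℝ ((⊤ : ℕ∞) : WithTop ℕ∞) fun y : ℝ × (s → ℝ) =>
      ((y.1 * (slice t s y.2 τ - x₀) : ℝ) : ℂ) :=
    Complex.ofRealCLM.contDiff.comp (contDiff_fst.mul (h3.sub contDiff_const))
  exact h1.add (h4.contDiffOn.mul h2)

theorem IsField.isVariation_bump (hφ : IsField g ρ Ω φ) (huv : v ⬝ᵥ u = 0) (hn : n ≠ 0) (a : CP1)
    (τ : TimeIdx) (t₀ : TimeIdx → ℝ) : IsVariation g ρ Ω φ (bump φ a τ t₀ u v n) := by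
  refine ⟨fun t _ => bump_eq_self φ a τ t₀ u v n (zero_mul _),
    fun ε t ht => inAdelicGroup_bump huv hn a τ t₀ ε (hφ.1 t ht), fun z i j m => ?_⟩
  by_cases hz : z = a
  · subst hz
    simp only [coeff_bump_self]
    exact (hφ.2 z i j m).smoothFamilyOn_add
      (SmoothOn.coeff_rankOneMonomial_mul (hφ.2 z) u v n i j m) τ (t₀ τ)
  · simp only [bump_of_ne φ hz]
    intro t s
    exact (hφ.2 z i j m t s).comp contDiff_snd.contDiffOn fun y hy => hy

theorem pd_add_mul_self {f h : (TimeIdx → ℝ) → ℂ} (hf : SmoothOn Ω f)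
    (hh : SmoothOn Ω h) (hΩ : IsTimeDomain Ω) (ht : t ∈ Ω) (τ : TimeIdx) (ε : ℝ) :
    pd τ (fun x => f x + ((ε * (x τ - t τ) : ℝ) : ℂ) * h x) t = pd τ f t + ε * h t := by
  classical
  have h1 : HasDerivAt (fun x : ℝ => ((ε * (x - t τ) : ℝ) : ℂ)) ε (t τ) := by
    have := (((hasDerivAt_id (t τ)).sub_const (t τ)).const_mul ε).ofReal_comp
    simpa using this
  have h2 := ((hf.hasDerivAt hΩ ht τ).fun_add (h1.fun_mul (hh.hasDerivAt hΩ ht τ))).deriv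
  simp only [Function.update_eq_self, sub_self, mul_zero, Complex.ofReal_zero, zero_mul,
    add_zero] at h2
  rw [← h2, pd]
  congr! 4
  simp

theorem pd_add_mul_of_ne (f h : (TimeIdx → ℝ) → ℂ) {σ τ : TimeIdx} (hστ : σ ≠ τ) (ε : ℝ) :
    pd σ (fun x => f x + ((ε * (x τ - t τ) : ℝ) : ℂ) * h x) t = pd σ f t := by
  classical
  unfold pd
  simp [Function.update_of_ne hστ.symm]

theorem IsField.dField_bump_self (hφ : IsField g ρ Ω φ) (hΩ : IsTimeDomain Ω) (ht : t ∈ Ω)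
    (a : CP1) (τ : TimeIdx) (u v : Fin N → ℂ) (n : ℕ) (ε : ℝ) :
    dField (bump φ a τ t u v n ε) τ t a = dField φ τ t a + rankOneMonomial u v n ε * φ t a := by
  ext i j m
  rw [Matrix.add_apply, map_add, AdelicMultiform.coeff_rankOneMonomial_mul]
  simp only [dField, Matrix.of_apply, PowerSeries.coeff_mk, coeff_bump_self]
  exact pd_add_mul_self (hφ.2 a i j m) (SmoothOn.coeff_rankOneMonomial_mul (hφ.2 a) u v n i j m)
    hΩ ht τ ε

theorem dField_bump_of_ne (φ : Config N) {a z : CP1} {σ τ : TimeIdx} (h : z ≠ a ∨ σ ≠ τ)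
    (t : TimeIdx → ℝ) (u v : Fin N → ℂ) (n : ℕ) (ε : ℝ) :
    dField (bump φ a τ t u v n ε) σ t z = dField φ σ t z := by
  ext i j m
  by_cases hz : z = a
  · subst hz
    simp only [dField, Matrix.of_apply, PowerSeries.coeff_mk, coeff_bump_self]
    exact pd_add_mul_of_ne _ _ (h.resolve_left fun h => h rfl) ε
  · simp only [dField, Matrix.of_apply, PowerSeries.coeff_mk, bump_of_ne φ hz]

theorem bump_apply_self (φ : Config N) (a : CP1) (τ : TimeIdx) (t : TimeIdx → ℝ)
    (u v : Fin N → ℂ) (n : ℕ) (ε : ℝ) : bump φ a τ t u v n ε t = φ t :=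
  bump_eq_self φ a τ t u v n (by rw [sub_self, mul_zero])

theorem orbitQ_bump (φ : Config N) (a z : CP1) (τ : TimeIdx) (t : TimeIdx → ℝ)
    (u v : Fin N → ℂ) (n : ℕ) (ε : ℝ) :
    orbitQ Fm (bump φ a τ t u v n ε) t z = orbitQ Fm φ t z := by
  rw [orbitQ, orbitQ, bump_apply_self]

theorem toL_add (A B : Matrix (Fin N) (Fin N) ℂ⟦X⟧) : toL (A + B) = toL A + toL B := by
  ext i j
  simp [toL]

theorem IsField.laxDefect_bump_self (hφ : IsField g ρ Ω φ) (hΩ : IsTimeDomain Ω) (ht : t ∈ Ω)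
    (a c : CP1) (s : ℤ) (u v : Fin N → ℂ) (n : ℕ) (ε : ℝ) :
    laxDefect ρ Fm (bump φ a (timeOf ρ c s) t u v n ε) t a c s =
      laxDefect ρ Fm φ t a c s + toL (rankOneMonomial u v n ε) := by
  rw [laxDefect, laxDefect, rightLogDeriv, rightLogDeriv, orbitQ_bump, bump_apply_self,
    hφ.dField_bump_self hΩ ht, toL_add, toL_mul, add_mul, mul_assoc,
    toL_mul_toL_inv (hφ.isUnit_det ht a), mul_one]
  abel

theorem laxDefect_bump_of_ne (φ : Config N) {a z b : CP1} {q : ℤ} {τ : TimeIdx}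
    (h : z ≠ a ∨ timeOf ρ b q ≠ τ) (t : TimeIdx → ℝ) (u v : Fin N → ℂ) (n : ℕ) (ε : ℝ) :
    laxDefect ρ Fm (bump φ a τ t u v n ε) t z b q = laxDefect ρ Fm φ t z b q := by
  rw [laxDefect, laxDefect, rightLogDeriv, rightLogDeriv, orbitQ_bump, bump_apply_self,
    dField_bump_of_ne φ h]

theorem timeOf_ne {b c : CP1} (h : b ≠ c) (q s : ℤ) : timeOf ρ b q ≠ timeOf ρ c s := by
  have h1 : ∀ (a : CP1) (p : ℤ), (timeOf ρ a p).1 = a := fun a p => by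
    induction a using OnePoint.rec <;> rfl
  intro h2
  exact h (by rw [← h1 b q, h2, h1])

end Bump

/-! ### The Euler-Lagrange equations imply the Lax equation -/

section ELToLax

variable {N : ℕ} {g : LieKind} {ρ : RKind} {Ω : Set (TimeIdx → ℝ)} {φ : Config N}
  {Fm : CP1 → Matrix (Fin N) (Fin N) (LaurentSeries ℂ)} {t : TimeIdx → ℝ}

/-- The nilpotent matrices of rank one span the traceless matrices. -/
theorem eq_zero_of_nilpotent_pairing (hN : 1 ≤ N) {M : Matrix (Fin N) (Fin N) ℂ}
    (htr : M.trace = 0) (h : ∀ u v : Fin N → ℂ, v ⬝ᵥ u = 0 → v ⬝ᵥ M.mulVec u = 0) : M = 0 := by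
  have hoff : ∀ i j, i ≠ j → M i j = 0 := fun i j hij => by
    simpa using h (Pi.single j 1) (Pi.single i 1) (by simp [hij])
  have hdiag : ∀ i j, M i i = M j j := fun i j => by
    by_cases hij : i = j
    · rw [hij]
    have h1 := h (Pi.single i 1 + Pi.single j 1) (Pi.single i 1 - Pi.single j 1)
      (by simp [hij, Ne.symm hij])
    simp [sub_dotProduct, Matrix.mulVec_add, hoff i j hij, hoff j i (Ne.symm hij)] at h1
    exact sub_eq_zero.1 h1
  have h0 : ∀ i, M i i = 0 := fun i => by
    have h1 : M.trace = N * M i i := by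
      refine (Finset.sum_congr rfl fun k _ => hdiag k i).trans ?_
      simp
    rw [h1] at htr
    exact (mul_eq_zero.1 htr).resolve_left (Nat.cast_ne_zero.2 (by omega))
  ext i j
  by_cases hij : i = j
  · rw [hij, h0, Matrix.zero_apply]
  · rw [hoff i j hij, Matrix.zero_apply]

theorem coeff_trace_rankOneMonomial_mul (u v : Fin N → ℂ) (n : ℕ) (c : ℂ)
    (W : Matrix (Fin N) (Fin N) (LaurentSeries ℂ)) (p : ℤ) :
    (toL (rankOneMonomial u v n c) * W).trace.coeff p =
      c * (v ⬝ᵥ (lcoeff W (p - n)).mulVec u) := by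
  have h : ∀ x : ℂ, HahnSeries.ofPowerSeries ℤ ℂ (PowerSeries.monomial n x) =
      HahnSeries.single (n : ℤ) x := fun x => by
    have e : PowerSeries.monomial n x = PowerSeries.C x * PowerSeries.X ^ n := by
      ext m
      simp [PowerSeries.coeff_monomial, PowerSeries.coeff_X_pow]
    rw [e, map_mul, HahnSeries.ofPowerSeries_C,
      HahnSeries.ofPowerSeries_X_pow, HahnSeries.C_apply, HahnSeries.single_mul_single]
    simp
  simp only [Matrix.trace, Matrix.diag_apply, Matrix.mul_apply, toL, Matrix.map_apply,
    rankOneMonomial, Matrix.of_apply, h, HahnSeries.coeff_sum, HahnSeries.coeff_single_mul,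
    dotProduct, Matrix.mulVec, lcoeff, Finset.mul_sum]
  rw [Finset.sum_comm]
  exact Finset.sum_congr rfl fun i _ => Finset.sum_congr rfl fun j _ => by ring

theorem trace_commutator_add_right {R : Type*} [CommRing R] (E B H Q : Matrix (Fin N) (Fin N) R) :
    ((E * (B + H) - (B + H) * E) * Q).trace =
      ((E * B - B * E) * Q).trace - (H * (E * Q - Q * E)).trace := by
  have e : (E * (B + H) - (B + H) * E) * Q =
      (E * B - B * E) * Q - (H * E * Q - E * H * Q) := by noncomm_ring
  rw [e, Matrix.trace_sub, mul_sub, Matrix.trace_sub, Matrix.trace_sub, ← mul_assoc, ← mul_assoc,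
    Matrix.trace_mul_cycle H Q E]

theorem trace_commutator_add_left {R : Type*} [CommRing R] (E B H Q : Matrix (Fin N) (Fin N) R) :
    (((B + H) * E - E * (B + H)) * Q).trace =
      ((B * E - E * B) * Q).trace + (H * (E * Q - Q * E)).trace := by
  have e : ((B + H) * E - E * (B + H)) * Q =
      (B * E - E * B) * Q + (H * E * Q - E * H * Q) := by noncomm_ring
  rw [e, Matrix.trace_add, mul_sub, Matrix.trace_sub, Matrix.trace_sub, ← mul_assoc, ← mul_assoc,
    Matrix.trace_mul_cycle H Q E]

/-- The commutator of the defect with `Q^a`. -/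
def laxCommutator (ρ : RKind) (Fm : CP1 → Matrix (Fin N) (Fin N) (LaurentSeries ℂ)) (φ : Config N)
    (t : TimeIdx → ℝ) (a b : CP1) (q : ℤ) : Matrix (Fin N) (Fin N) (LaurentSeries ℂ) :=
  laxDefect ρ Fm φ t a b q * orbitQ Fm φ t a - orbitQ Fm φ t a * laxDefect ρ Fm φ t a b q

theorem trace_lcoeff_laxCommutator (φ : Config N) (t : TimeIdx → ℝ) (a b : CP1) (q n : ℤ) :
    (lcoeff (laxCommutator ρ Fm φ t a b q) n).trace = 0 := by
  rw [← coeff_trace_eq, laxCommutator, Matrix.trace_sub, Matrix.trace_mul_comm, sub_self,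
    HahnSeries.coeff_zero]

/-- The pole order in `λ_a` of the commutators is bounded independently of the degree `q`. -/
theorem exists_vanishesBelow_laxCommutator (φ : Config N) (t : TimeIdx → ℝ) (a b : CP1) :
    ∃ B, ∀ q, VanishesBelow B (laxCommutator ρ Fm φ t a b q) := by
  obtain ⟨B, hB⟩ := exists_vanishesBelow (orbitQ Fm φ t a)
  refine ⟨B, fun q => ?_⟩
  have hI := vanishesBelow_integralPart ρ b q (orbitQ Fm φ t b) a
  have hR : VanishesBelow 0 (rightLogDeriv φ (timeOf ρ b q) t a) := by
    rw [← add_zero (0 : ℤ)]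
    exact (vanishesBelow_toL _).mul (vanishesBelow_toL _)
  -- The Lax matrix may be replaced by an integral adèle, since the difference commutes with `Q^a`.
  have hc : pointAdele ρ b q (orbitQ Fm φ t b) a * orbitQ Fm φ t a =
      orbitQ Fm φ t a * pointAdele ρ b q (orbitQ Fm φ t b) a := by
    rw [pointAdele]
    split_ifs with hab
    · subst hab
      rw [mul_scaleMatrix, scaleMatrix_mul]
    · rw [zero_mul, mul_zero]
  have e : ∀ A V P Q : Matrix (Fin N) (Fin N) (LaurentSeries ℂ), P * Q = Q * P →
      (A - V) * Q - Q * (A - V) = (A - (V + P)) * Q - Q * (A - (V + P)) := fun A V P Q h => by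
    simp only [sub_mul, mul_sub, add_mul, mul_add, h]
    abel
  rw [laxCommutator, laxDefect, e _ _ _ _ hc]
  have h1 := hR.sub hI
  have h2 := h1.mul hB
  have h3 := hB.mul h1
  rw [zero_add] at h2
  rw [add_zero] at h3
  exact h2.sub h3

/-- The Euler-Lagrange equation for a nilpotent variation concentrated at the point `a`. -/
theorem IsField.pairing_of_multiformEL (hF : g = .sl → ∀ a, (Fm a).trace = 0)
    (hφ : IsField g ρ Ω φ) (hΩ : IsTimeDomain Ω) (h : MultiformEL g ρ Fm Ω φ) (ht : t ∈ Ω)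
    (a b : CP1) (p q : ℤ) {n : ℕ} (hn : n ≠ 0) {u v : Fin N → ℂ} (huv : v ⬝ᵥ u = 0) :
    v ⬝ᵥ (lcoeff (laxCommutator ρ Fm φ t a b q) (p - n)).mulVec u =
      open scoped Classical in
      if a = b then v ⬝ᵥ (lcoeff (laxCommutator ρ Fm φ t a b p) (q - n)).mulVec u else 0 := by
  classical
  -- The times of a third point `c` are distinct from those of `a` and `b`, and the variation in
  -- the direction of one of them affects no other defect than `E^{a,c}`.
  obtain ⟨c, hc⟩ := Infinite.exists_notMem_finset ({a, b} : Finset CP1)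
  have hca : c ≠ a := fun h => hc (by simp [h])
  have hcb : c ≠ b := fun h => hc (by simp [h])
  have hΦ := hφ.isVariation_bump huv hn a (timeOf ρ c 0) t
  have hEL := h _ hΦ t ht a b c p q 0
  simp only [(hΦ.isField _).dLagrangian_eq hF hΩ ht, orbitQ_bump, hφ.laxDefect_bump_self hΩ ht,
    laxDefect_bump_of_ne φ (Or.inr (timeOf_ne hcb.symm _ _)),
    laxDefect_bump_of_ne φ (Or.inr (timeOf_ne hca.symm _ _)),
    trace_commutator_add_right, HahnSeries.coeff_sub] at hEL
  -- For these variations the exterior derivative of the multiform is affine in `ε`.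
  have key : ∀ (f : ℝ → ℂ) (x : ℂ), (∀ ε : ℝ, f ε = f 0 + ε * x) → HasDerivAt f 0 0 → x = 0 :=
    fun f x hf hd => by
      have h1 : HasDerivAt (fun ε : ℝ => f 0 + (ε : ℂ) * x) x 0 := by
        simpa using (((hasDerivAt_id (0 : ℝ)).ofReal_comp).mul_const x).const_add (f 0)
      exact (h1.congr_of_eventuallyEq (Eventually.of_forall hf)).unique hd
  by_cases hab : a = b
  · subst hab
    rw [if_pos rfl, ← sub_eq_zero, ← neg_eq_zero]
    simp only [hφ.laxDefect_bump_self hΩ ht, trace_commutator_add_left, HahnSeries.coeff_add,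
      coeff_trace_rankOneMonomial_mul] at hEL
    refine key _ _ (fun ε => ?_) hEL
    simp only [Complex.ofReal_zero, zero_mul, laxCommutator]
    ring
  · rw [if_neg hab, ← neg_eq_zero]
    simp only [laxDefect_bump_of_ne φ (Or.inl (Ne.symm hab)), coeff_trace_rankOneMonomial_mul]
      at hEL
    refine key _ _ (fun ε => ?_) hEL
    simp only [Complex.ofReal_zero, zero_mul, laxCommutator]
    ring

theorem generatingLax_of_multiformEL (hN : 1 ≤ N) (hF : g = .sl → ∀ a, (Fm a).trace = 0)
    (hφ : IsField g ρ Ω φ) (hΩ : IsTimeDomain Ω) (h : MultiformEL g ρ Fm Ω φ) :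
    GeneratingLax g ρ Fm Ω φ := by
  classical
  refine (hφ.generatingLax_iff hF hΩ).2 fun t ht a b q => sub_eq_zero.1 (ext_lcoeff fun n => ?_)
  change lcoeff (laxCommutator ρ Fm φ t a b q) n = lcoeff 0 n
  have h0 : lcoeff (0 : Matrix (Fin N) (Fin N) (LaurentSeries ℂ)) n = 0 := by
    ext i j
    simp [lcoeff]
  rw [h0]
  by_cases hab : a = b
  · subst hab
    have h1 : ∀ (m : ℕ), m ≠ 0 → ∀ p q : ℤ, lcoeff (laxCommutator ρ Fm φ t a a q) (p - m) =
        lcoeff (laxCommutator ρ Fm φ t a a p) (q - m) := fun m hm p q => by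
      refine sub_eq_zero.1 (eq_zero_of_nilpotent_pairing hN ?_ fun u v huv => ?_)
      · rw [Matrix.trace_sub, trace_lcoeff_laxCommutator, trace_lcoeff_laxCommutator, sub_zero]
      · have := hφ.pairing_of_multiformEL hF hΩ h ht a a p q hm huv
        rw [if_pos rfl] at this
        rw [Matrix.sub_mulVec, dotProduct_sub, this, sub_self]
    -- The variations of degrees one and two show together that the coefficient of
    -- `λ_a^n μ_a^q` depends only on `n + q`.
    have h2 : ∀ n q : ℤ, lcoeff (laxCommutator ρ Fm φ t a a q) n =
        lcoeff (laxCommutator ρ Fm φ t a a (q + 1)) (n - 1) := fun n q => by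
      have e1 := h1 1 one_ne_zero (n + 1) q
      have e2 := h1 2 two_ne_zero (n + 1) (q + 1)
      rw [Nat.cast_one, add_sub_cancel_right] at e1
      rw [e1, show n - 1 = n + 1 - (2 : ℕ) by push_cast; ring, e2]
      congr 1
      push_cast
      ring
    have h3 : ∀ (k : ℕ) (n q : ℤ), lcoeff (laxCommutator ρ Fm φ t a a q) n =
        lcoeff (laxCommutator ρ Fm φ t a a (q + k)) (n - k) := fun k => by
      induction k with
      | zero => intro n q; simp
      | succ k ih =>
        intro n q
        rw [ih, h2, Nat.cast_succ, add_assoc, sub_sub]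
    obtain ⟨B, hB⟩ := exists_vanishesBelow_laxCommutator (ρ := ρ) (Fm := Fm) φ t a a
    rw [h3 (n - B + 1).toNat]
    exact (hB _).lcoeff_eq_zero (by omega)
  · refine eq_zero_of_nilpotent_pairing hN (trace_lcoeff_laxCommutator φ t a b q n)
      fun u v huv => ?_
    have := hφ.pairing_of_multiformEL hF hΩ h ht a b (n + 1) q one_ne_zero huv
    rwa [if_neg hab, Nat.cast_one, add_sub_cancel_right] at this

end ELToLax

end

end AdelicMultiform

theorem mainTheorem1 (N : ℕ) (hN : 1 ≤ N) (g : AdelicMultiform.LieKind)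
    (ρ : AdelicMultiform.RKind)
    (F : Matrix (Fin N) (Fin N) (RatFunc ℂ))
    (S : Finset AdelicMultiform.CP1)
    (Fm : AdelicMultiform.CP1 → Matrix (Fin N) (Fin N) (LaurentSeries ℂ))
    (hF : AdelicMultiform.IsPartialFraction g ρ F S Fm)
    (Ω : Set (AdelicMultiform.TimeIdx → ℝ)) (hΩ : AdelicMultiform.IsTimeDomain Ω)
    (φ : AdelicMultiform.Config N) (hφ : AdelicMultiform.IsField g ρ Ω φ) :
    AdelicMultiform.MultiformEL g ρ Fm Ω φ ↔ AdelicMultiform.GeneratingLax g ρ Fm Ω φ :=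
  ⟨AdelicMultiform.generatingLax_of_multiformEL hN (fun hg => hF.trace_eq_zero hg) hφ hΩ,
    AdelicMultiform.multiformEL_of_generatingLax (fun hg => hF.trace_eq_zero hg) hφ hΩ⟩
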